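/- There is an absolute constant $C$ with the following property. Let $H$ be a complex Hilbert space, let $E_1$ and $E_2$ be Borel spectral measures on $\mathbb R$ in $H$, and let $f:\mathbb R\to\mathbb C$ be a Lipschitz function, with $\|f\|_{\rm Lip}=\sup_{x\ne y}|f(x)-f(y)|\,|x-y|^{-1}$. For a bounded operator $T$ on $H$ let $s_j(T)$, $j\ge0$, be its singular numbers, i.e. $s_j(T)$ is the distance in operator norm from $T$ to the operators of rank at most $j$. Put $\boldsymbol S_2=\{T:\sum_{j\ge0}s_j(T)^2<\infty\}$ (the Hilbert–Schmidt class) and $$\boldsymbol S_\omega=\Big\{T:\ \|T\|_{\boldsymbol S_\omega}=\sum_{j\ge0}\frac{s_j(T)}{1+j}<\infty\Big\}$$ (the Matsaev ideal); then $\boldsymbol S_2\subset\boldsymbol S_\omega$. For $T\in\boldsymbol S_2$ consider the double operator integral $$\mathcal I_{E_1,E_2}(f,T)=\iint_{\mathbb R\times\mathbb R}\frac{f(x)-f(y)}{x-y}\,dE_1(x)\,T\,dE_2(y),$$ where the divided difference is taken to be $0$ on the diagonal $x=y$; that is, the integral of the divided difference with respect to the unique countably additive operator-valued Borel measure $M$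 on $\mathbb R^2$ with $M(\Delta\times\Sigma)=E_1(\Delta)TE_2(\Sigma)$ for all Borel sets $\Delta,\Sigma\subset\mathbb R$ (such a measure exists for every $T\in\boldsymbol S_2$, and the integral is understood weakly: $\langle\mathcal I_{E_1,E_2}(f,T)u,v\rangle=\iint\frac{f(x)-f(y)}{x-y}\,d\langle M(x,y)u,v\rangle$ for all $u,v\in H$). Then the transformer $T\mapsto\mathcal I_{E_1,E_2}(f,T)$, defined on $\boldsymbol S_2$, extends to a bounded linear operator from $\boldsymbol S_\omega$ to the ideal of all compact operators on $H$, and the extension, denoted in the same way, satisfies $$\|\mathcal I_{E_1,E_2}(f,T)\|\le C\,\|f\|_{\rm Lip}\,\|T\|_{\boldsymbol S_\omega},\qquad T\in\boldsymbol S_\omega .$$ -/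

import Mathlib

open MeasureTheory

universe u

namespace DoubleOp

section SingularNumbers

variable {H : Type u} [NormedAddCommGroup H] [InnerProductSpace ℂ H]

/-- The `j`-th singular number (`j = 0, 1, 2, …`) of a bounded operator: its distance, in operator
norm, to the bounded operators of rank at most `j`. -/
noncomputable def singularNumber (T : H →L[ℂ] H) (j : ℕ) : ℝ :=
  ⨅ K : {K : H →L[ℂ] H // LinearMap.rank (K : H →ₗ[ℂ] H) ≤ (j : Cardinal)}, ‖T - K.1‖

theorem singularNumber_bddBelow (T : H →L[ℂ] H) (j : ℕ) :
    BddBelow (Set.range fun K : {K : H →L[ℂ] H //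
      LinearMap.rank (K : H →ₗ[ℂ] H) ≤ (j : Cardinal)} => ‖T - K.1‖) :=
  ⟨0, by rintro _ ⟨K, rfl⟩; exact norm_nonneg _⟩

theorem singularNumber_le (T K : H →L[ℂ] H) (j : ℕ)
    (hK : LinearMap.rank (K : H →ₗ[ℂ] H) ≤ (j : Cardinal)) :
    singularNumber T j ≤ ‖T - K‖ :=
  ciInf_le (singularNumber_bddBelow T j) ⟨K, hK⟩

instance (j : ℕ) : Nonempty {K : H →L[ℂ] H //
    LinearMap.rank (K : H →ₗ[ℂ] H) ≤ (j : Cardinal)} :=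
  ⟨⟨0, by simp [LinearMap.rank_zero]⟩⟩

theorem singularNumber_nonneg (T : H →L[ℂ] H) (j : ℕ) : 0 ≤ singularNumber T j :=
  le_ciInf fun _ => norm_nonneg _

theorem singularNumber_zero (j : ℕ) : singularNumber (0 : H →L[ℂ] H) j = 0 := by
  refine le_antisymm ?_ (singularNumber_nonneg _ _)
  simpa using singularNumber_le (0 : H →L[ℂ] H) 0 j (by simp [LinearMap.rank_zero])

theorem singularNumber_add_le (S T : H →L[ℂ] H) {i j n : ℕ} (h : i + j ≤ n) :
    singularNumber (S + T) n ≤ singularNumber S i + singularNumber T j := by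
  refine le_ciInf_add_ciInf fun K L => ?_
  refine (singularNumber_le (S + T) (K.1 + L.1) n ?_).trans ?_
  · refine (LinearMap.rank_add_le (K.1 : H →ₗ[ℂ] H) (L.1 : H →ₗ[ℂ] H)).trans ?_
    refine (add_le_add K.2 L.2).trans ?_
    exact_mod_cast h
  · rw [add_sub_add_comm]
    exact norm_add_le _ _

theorem singularNumber_smul_le (c : ℂ) (T : H →L[ℂ] H) (j : ℕ) :
    singularNumber (c • T) j ≤ ‖c‖ * singularNumber T j := by
  rw [singularNumber, singularNumber, Real.mul_iInf_of_nonneg (norm_nonneg c)]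
  refine le_ciInf fun K => ?_
  refine (singularNumber_le (c • T) (c • K.1) j ?_).trans ?_
  · refine le_trans ?_ K.2
    have : ((c • K.1 : H →L[ℂ] H) : H →ₗ[ℂ] H) =
        (c • LinearMap.id : H →ₗ[ℂ] H) ∘ₗ (K.1 : H →ₗ[ℂ] H) := by
      ext; simp
    rw [this]
    exact LinearMap.rank_comp_le_right _ _
  · rw [← smul_sub, norm_smul]

/-- `‖T‖_{S_ω} = ∑_{j ≥ 0} s_j(T) / (1 + j)`, meaningful for `T` in the Matsaev ideal. -/
noncomputable def matsaevNorm (T : H →L[ℂ] H) : ℝ :=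
  ∑' j : ℕ, singularNumber T j / (1 + j)

theorem summable_half (a : ℕ → ℝ) (ha : ∀ j, 0 ≤ a j)
    (h : Summable fun j : ℕ => a j / (1 + (j : ℝ))) :
    Summable fun j : ℕ => a (j / 2) / (1 + (j : ℝ)) := by
  have h0 : Summable fun k : ℕ => a (2 * k / 2) / (1 + ((2 * k : ℕ) : ℝ)) := by
    refine h.of_nonneg_of_le (fun k => div_nonneg (ha _) (by positivity)) fun k => ?_
    rw [Nat.mul_div_cancel_left k two_pos]
    refine div_le_div_of_nonneg_left (ha _) (by positivity) ?_
    push_cast; linarith [Nat.cast_nonneg (α := ℝ) k]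
  have h1 : Summable fun k : ℕ => a ((2 * k + 1) / 2) / (1 + ((2 * k + 1 : ℕ) : ℝ)) := by
    refine h.of_nonneg_of_le (fun k => div_nonneg (ha _) (by positivity)) fun k => ?_
    rw [show (2 * k + 1) / 2 = k by omega]
    refine div_le_div_of_nonneg_left (ha _) (by positivity) ?_
    push_cast; linarith [Nat.cast_nonneg (α := ℝ) k]
  exact (HasSum.even_add_odd (f := fun j : ℕ => a (j / 2) / (1 + (j : ℝ)))
    h0.hasSum h1.hasSum).summable

variable (H) in
/-- The Matsaev ideal `S_ω`: bounded operators with `∑_{j ≥ 0} s_j(T) / (1 + j) < ∞`. -/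
noncomputable def matsaevIdeal : Submodule ℂ (H →L[ℂ] H) where
  carrier := {T | Summable fun j : ℕ => singularNumber T j / (1 + j)}
  zero_mem' := by simp [singularNumber_zero]
  add_mem' := by
    intro S T hS hT
    refine ((summable_half _ (singularNumber_nonneg S) hS).add
      (summable_half _ (singularNumber_nonneg T) hT)).of_nonneg_of_le
      (fun k => div_nonneg (singularNumber_nonneg _ _) (by positivity)) fun k => ?_
    rw [← add_div]
    refine div_le_div_of_nonneg_right ?_ (by positivity)
    exact singularNumber_add_le S T (by omega)
  smul_mem' := by
    intro c T hT
    refine (Summable.mul_left ‖c‖ hT).of_nonneg_of_le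
      (fun k => div_nonneg (singularNumber_nonneg _ _) (by positivity)) fun k => ?_
    rw [← mul_div_assoc]
    exact div_le_div_of_nonneg_right (singularNumber_smul_le c T k) (by positivity)

variable (H) in
/-- The Hilbert–Schmidt class `S_2`: bounded operators with `∑_{j ≥ 0} s_j(T)² < ∞`. -/
def hilbertSchmidtClass : Set (H →L[ℂ] H) :=
  {T | Summable fun j : ℕ => singularNumber T j ^ 2}

theorem hilbertSchmidtClass_subset {T : H →L[ℂ] H} (hT : T ∈ hilbertSchmidtClass H) :
    T ∈ matsaevIdeal H := by
  have h2 : Summable fun j : ℕ => (1 / (1 + (j : ℝ))) ^ 2 := by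
    have := (summable_nat_add_iff 1).2 (Real.summable_one_div_nat_pow.2 one_lt_two)
    refine this.congr fun j => ?_
    push_cast
    rw [div_pow, one_pow, add_comm]
  refine (Summable.add hT h2).of_nonneg_of_le
    (fun k => div_nonneg (singularNumber_nonneg _ _) (by positivity)) fun k => ?_
  rw [div_eq_mul_one_div]
  nlinarith [sq_nonneg (singularNumber T k - 1 / (1 + (k : ℝ))),
    sq_nonneg (singularNumber T k), sq_nonneg (1 / (1 + (k : ℝ)))]

end SingularNumbers

/-- A spectral measure on a measurable space `α` in a Hilbert space `H`: orthogonal projections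
`E(s)` for measurable `s`, with `E(α) = I` and countable additivity in the strong operator
topology. The values on non-measurable sets are irrelevant. -/
structure SpectralMeasure (α : Type*) [MeasurableSpace α] (H : Type u) [NormedAddCommGroup H]
    [InnerProductSpace ℂ H] [CompleteSpace H] where
  toFun : Set α → H →L[ℂ] H
  isStarProjection' : ∀ s, MeasurableSet s → IsStarProjection (toFun s)
  univ' : toFun Set.univ = 1
  hasSum_iUnion' : ∀ s : ℕ → Set α, (∀ i, MeasurableSet (s i)) →
    Pairwise (fun i j => Disjoint (s i) (s j)) →
    ∀ x : H, HasSum (fun i => toFun (s i) x) (toFun (⋃ i, s i) x)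

instance (α : Type*) [MeasurableSpace α] (H : Type u) [NormedAddCommGroup H]
    [InnerProductSpace ℂ H] [CompleteSpace H] :
    CoeFun (SpectralMeasure α H) (fun _ => Set α → H →L[ℂ] H) :=
  ⟨SpectralMeasure.toFun⟩

section Integral

variable {H : Type u} [NormedAddCommGroup H] [InnerProductSpace ℂ H] [CompleteSpace H]

/-- The functional `A ↦ ⟨A u, v⟩` (inner product linear in the first place) on bounded operators. -/
noncomputable def matrixCoeff (u v : H) : (H →L[ℂ] H) →L[ℂ] ℂ :=
  (innerSL ℂ v).comp (ContinuousLinearMap.apply ℂ H u)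

/-- The scalar complex measure `S ↦ ⟨M(S) u, v⟩` of an operator valued measure `M`. -/
noncomputable def scalarMeasure {X : Type*} [MeasurableSpace X] (M : VectorMeasure X (H →L[ℂ] H))
    (u v : H) : ComplexMeasure X :=
  M.mapRange (matrixCoeff u v).toLinearMap.toAddMonoidHom (matrixCoeff u v).continuous

/-- `Q` is the double operator integral `∬ Φ(x, y) dE₁(x) T dE₂(y)`: the set function
`Δ × Σ ↦ E₁(Δ) T E₂(Σ)` extends to a countably additive operator valued Borel measure `M` on the
plane, and `Q = ∫ Φ dM`, that is, `⟨Q u, v⟩ = ∫ Φ d⟨M u, v⟩` for all vectors `u`, `v`. -/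
def IsDoubleOperatorIntegral (E₁ E₂ : SpectralMeasure ℝ H) (Φ : ℝ × ℝ → ℂ)
    (T Q : H →L[ℂ] H) : Prop :=
  ∃ M : VectorMeasure (ℝ × ℝ) (H →L[ℂ] H),
    (∀ s t : Set ℝ, MeasurableSet s → MeasurableSet t → M (s ×ˢ t) = E₁ s * T * E₂ t) ∧
    ∀ u v : H, (scalarMeasure M u v).Integrable Φ ∧
      inner ℂ v (Q u) = (scalarMeasure M u v).integral Φ (ContinuousLinearMap.mul ℝ ℂ)

/-- The double operator integral is unique when it exists. -/
theorem IsDoubleOperatorIntegral.unique {E₁ E₂ : SpectralMeasure ℝ H} {Φ : ℝ × ℝ → ℂ}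
    {T Q Q' : H →L[ℂ] H} (h : IsDoubleOperatorIntegral E₁ E₂ Φ T Q)
    (h' : IsDoubleOperatorIntegral E₁ E₂ Φ T Q') : Q = Q' := by
  obtain ⟨M, hM, hQ⟩ := h
  obtain ⟨M', hM', hQ'⟩ := h'
  have hMM : M = M' := by
    refine VectorMeasure.ext_of_generateFrom _ ?_ generateFrom_prod.symm isPiSystem_prod ?_
    · rintro _ ⟨s, hs, t, ht, rfl⟩
      rw [hM s t hs ht, hM' s t hs ht]
    · rw [← Set.univ_prod_univ, hM _ _ .univ .univ, hM' _ _ .univ .univ]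
  subst hMM
  ext u
  exact ext_inner_left ℂ fun v => by rw [(hQ u v).2, (hQ' u v).2]

end Integral

/-- The divided difference `(f(x) - f(y)) / (x - y)`, equal to zero on the diagonal. -/
noncomputable def dividedDifference (f : ℝ → ℂ) (p : ℝ × ℝ) : ℂ :=
  if p.1 = p.2 then 0 else (f p.1 - f p.2) / ((p.1 - p.2 : ℝ) : ℂ)

/-- `‖f‖_Lip = sup_{x ≠ y} |f(x) - f(y)| / |x - y|`, meaningful for Lipschitz `f`. -/
noncomputable def lipNorm (f : ℝ → ℂ) : ℝ :=
  ⨆ p : {p : ℝ × ℝ // p.1 ≠ p.2}, ‖f p.1.1 - f p.1.2‖ / |p.1.1 - p.1.2|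

end DoubleOp

/-! The heart of the matter is a logarithmic bound for finite rank, `norm_le_of_rank_le`: an
operator `T` of rank at most `2 ^ m` has a double operator integral of norm `O(L ‖T‖ (m + 2))`,
where `L` is the Lipschitz constant.

For unit vectors `u`, `v` the scalar spectral measures `μ = ‖E₁(·) v‖²` and `ν = ‖E₂(·) u‖²` are
probability measures. By `exists_kernel`, `T` has a kernel in `L²(μ × ν)` of norm at most its
Hilbert–Schmidt norm, and the matrix coefficient at `u`, `v` of the double operator integral is the
integral of the divided difference `D` against this kernel. By `exists_isTensorSum_integral_le`, `D`
lies within `O(L N^{-1/2})` in `L²(μ × ν)` of a kernel of rank `O(N)`, with constants independent of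
`μ` and `ν`. With `K j` such a kernel for `N = 2 ^ j`, `D` is the sum of `K 0`, the differences `K
(j + 1) - K j` for `j < m`, and `D - K m`. Pairing a kernel `Φ` of rank `r` with `T` costs at most
`√r ‖T‖ ‖Φ‖` (`norm_doubleForm_le_of_isTensorSum`), since `T` may be compressed to rank `r` without
changing the pairing; the remainder `D - K m` is handled by the bound `2 ^ (m / 2) ‖T‖` for the
Hilbert–Schmidt norm of `T`. Each of the `m + 2` pieces is thus `O(L ‖T‖)`.

For the approximation of `D`, the line is cut at quantiles of `μ + ν`, `D` is kept on the lines
through the cut points, and on a product of two gaps the variable in the shorter gap is frozen. The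
squared error is at most of order `L² min(1, (ℓ / d)²)`, with `ℓ` the length of the shorter gap and
`d` the distance of the gaps. It has a telescoping majorant, so its sum over the second gap is
bounded whatever the lengths (`sum_gapWeight_le`).

To pass to the Matsaev ideal, approximate `T` by operators of rank `2 ^ 2 ^ k`. Consecutive
approximants differ by about `s_{2 ^ 2 ^ k}(T)` in norm, so their integrals differ by `O(L 2 ^ k
s_{2 ^ 2 ^ k}(T))`. Two Cauchy condensations sum these against the Matsaev norm
(`sum_pow_mul_rankError_le`). The limit is the extension: it is linear because it does not depend on
the approximating sequence, it is right on Hilbert–Schmidt operators because the approximation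
converges there in Hilbert–Schmidt norm, and it is compact as a norm limit of integrals of finite
rank operators. -/

namespace DoubleOp

/-! ### Isometries between families with equal Gram matrices -/

section GramExtension

variable {ι V W : Type*} [NormedAddCommGroup V] [InnerProductSpace ℂ V] [NormedAddCommGroup W]
  [InnerProductSpace ℂ W]

theorem inner_linearCombination_eq {x : ι → V} {y : ι → W}
    (h : ∀ i j, inner ℂ (x i) (x j) = inner ℂ (y i) (y j)) (a b : ι →₀ ℂ) :
    inner ℂ (Finsupp.linearCombination ℂ x a) (Finsupp.linearCombination ℂ x b) =
      inner ℂ (Finsupp.linearCombination ℂ y a) (Finsupp.linearCombination ℂ y b) := by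
  simp only [Finsupp.linearCombination_apply, Finsupp.sum, sum_inner, inner_sum, inner_smul_left,
    inner_smul_right, h]

/-- Two families with the same Gram matrix, the first one total, are related by an isometry. -/
theorem exists_linearIsometry_of_inner_eq [CompleteSpace W] {x : ι → V} {y : ι → W}
    (h : ∀ i j, inner ℂ (x i) (x j) = inner ℂ (y i) (y j))
    (hx : Dense (Submodule.span ℂ (Set.range x) : Set V)) :
    ∃ U : V →ₗᵢ[ℂ] W, ∀ i, U (x i) = y i := by
  have hd : DenseRange (Finsupp.linearCombination ℂ x) := by
    rwa [DenseRange, ← LinearMap.coe_range, Finsupp.range_linearCombination]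
  -- Norms of combinations depend only on the Gram matrix, so sending a combination of `x` to that
  -- of `y` is well defined even for dependent `x`, and it extends to the closure.
  have hn : ∀ a, ‖Finsupp.linearCombination ℂ y a‖ = ‖Finsupp.linearCombination ℂ x a‖ := by
    intro a
    rw [norm_eq_sqrt_re_inner (𝕜 := ℂ), norm_eq_sqrt_re_inner (𝕜 := ℂ),
      inner_linearCombination_eq h]
  have hb : ∃ C : ℝ, ∀ a, ‖Finsupp.linearCombination ℂ y a‖ ≤
      C * ‖Finsupp.linearCombination ℂ x a‖ := ⟨1, fun a => by rw [one_mul, hn]⟩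
  have he := LinearMap.extendOfNorm_eq (f := Finsupp.linearCombination ℂ y) hd hb
  refine ⟨⟨((Finsupp.linearCombination ℂ y).extendOfNorm
    (Finsupp.linearCombination ℂ x)).toLinearMap, fun v => ?_⟩, fun i => ?_⟩
  · refine hd.induction_on (p := fun v => ‖(Finsupp.linearCombination ℂ y).extendOfNorm
      (Finsupp.linearCombination ℂ x) v‖ = ‖v‖) v (isClosed_eq (by fun_prop) (by fun_prop)) ?_
    intro a
    rw [he, hn]
  · simpa using he (Finsupp.single i 1)

end GramExtension

/-! ### Indicator functions in `L²` -/

section IndicatorSpan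

variable {α : Type*} [MeasurableSpace α] (μ : Measure α) [IsFiniteMeasure μ]

/-- The indicator function of a measurable set as an element of `L²`. -/
noncomputable def indicatorL2 (s : {s : Set α // MeasurableSet s}) : Lp ℂ 2 μ :=
  indicatorConstLp 2 s.2 (measure_ne_top μ _) 1

theorem coeFn_indicatorL2 (s : {s : Set α // MeasurableSet s}) :
    indicatorL2 μ s =ᵐ[μ] s.1.indicator fun _ => (1 : ℂ) :=
  indicatorConstLp_coeFn

theorem inner_indicatorL2 (s t : {s : Set α // MeasurableSet s}) :
    inner ℂ (indicatorL2 μ s) (indicatorL2 μ t) = (μ.real (s.1 ∩ t.1) : ℂ) := by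
  rw [indicatorL2, L2.inner_indicatorConstLp_one, indicatorL2,
    setIntegral_indicatorConstLp s.2, Set.inter_comm]
  simp

theorem dense_span_indicatorL2 :
    Dense (Submodule.span ℂ (Set.range (indicatorL2 μ)) : Set (Lp ℂ 2 μ)) := by
  rw [Submodule.dense_iff_topologicalClosure_eq_top, Submodule.eq_top_iff']
  intro f
  refine Lp.induction (by simp) (motive := fun f => f ∈ (Submodule.span ℂ
    (Set.range (indicatorL2 μ))).topologicalClosure) ?_ ?_ ?_ f
  · intro c s hs hμs
    refine Submodule.le_topologicalClosure _ ?_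
    have : (Lp.simpleFunc.indicatorConst 2 hs hμs.ne c : Lp ℂ 2 μ) =
        c • indicatorL2 μ ⟨s, hs⟩ := by
      rw [Lp.simpleFunc.coe_indicatorConst, indicatorL2]
      ext1
      refine indicatorConstLp_coeFn.trans ?_
      refine Filter.EventuallyEq.trans ?_ (Lp.coeFn_smul _ _).symm
      filter_upwards [coeFn_indicatorL2 μ ⟨s, hs⟩] with x hx
      rw [Pi.smul_apply]
      simp only [indicatorL2] at hx
      rw [hx]
      by_cases h : x ∈ s <;> simp [h]
    rw [this]
    exact Submodule.smul_mem _ _ (Submodule.subset_span ⟨_, rfl⟩)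
  · intro f g hf hg _ h1 h2
    exact Submodule.add_mem _ h1 h2
  · exact Submodule.isClosed_topologicalClosure _

end IndicatorSpan

/-! ### Spectral measures and their scalar measures -/

namespace SpectralMeasure

variable {α : Type*} [MeasurableSpace α] {H : Type u} [NormedAddCommGroup H]
  [InnerProductSpace ℂ H] [CompleteSpace H] (E : SpectralMeasure α H)

/-- Additivity along a sequence of empty sets makes a constant sequence summable, and its terms must
tend to zero. -/
theorem apply_empty : E ∅ = 0 := by
  ext x
  have h := E.hasSum_iUnion' (fun _ => ∅) (fun _ => MeasurableSet.empty) (by intro i j _; simp) x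
  exact tendsto_nhds_unique tendsto_const_nhds h.summable.tendsto_atTop_zero

theorem apply_union {s t : Set α} (hs : MeasurableSet s) (ht : MeasurableSet t)
    (hst : Disjoint s t) : E (s ∪ t) = E s + E t := by
  ext x
  have h := E.hasSum_iUnion' (fun n => if n = 0 then s else if n = 1 then t else ∅)
    (fun n => by split_ifs <;> simp [hs, ht]) (by
      intro i j hij
      rcases i with _ | _ | i <;> rcases j with _ | _ | j <;>
        simp_all [Disjoint.symm]) x
  have hU : (⋃ n : ℕ, if n = 0 then s else if n = 1 then t else ∅) = s ∪ t := by
    ext y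
    simp only [Set.mem_iUnion, Set.mem_union]
    constructor
    · rintro ⟨n, hn⟩
      split_ifs at hn
      · exact Or.inl hn
      · exact Or.inr hn
      · exact absurd hn (Set.notMem_empty y)
    · rintro (hy | hy)
      · exact ⟨0, by simpa using hy⟩
      · exact ⟨1, by simpa using hy⟩
  rw [hU] at h
  have h' := hasSum_sum_of_ne_finset_zero (L := SummationFilter.unconditional ℕ)
    (f := fun n => (E (if n = 0 then s else if n = 1 then t else ∅)) x)
    (s := Finset.range 2) (by
      intro n hn
      have : 1 < n := by simpa using hn
      simp [show n ≠ 0 by omega, show n ≠ 1 by omega, E.apply_empty])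
  rw [h.unique h']
  simp [Finset.sum_range_succ]

theorem mul_self {s : Set α} (hs : MeasurableSet s) : E s * E s = E s :=
  (E.isStarProjection' s hs).isIdempotentElem

/-- Multiplicativity is not part of the definition. Since `p + q = E (s ∪ t)` is idempotent, `pq +
qp = 0`; multiplying by `p` on either side gives `pq = -pqp = qp`, hence `2pq = 0`. -/
theorem mul_eq_zero_of_disjoint {s t : Set α} (hs : MeasurableSet s) (ht : MeasurableSet t)
    (hst : Disjoint s t) : E s * E t = 0 := by
  have h := E.mul_self (hs.union ht)
  have hp := E.mul_self hs
  have hq := E.mul_self ht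
  rw [E.apply_union hs ht hst] at h
  set p := E s
  set q := E t
  have h1 : p * q + q * p = 0 := by
    have : (p + q) * (p + q) = p * p + q * q + (p * q + q * p) := by noncomm_ring
    rw [this, hp, hq] at h
    simpa using h
  have h2 : p * q + p * q * p = 0 := by
    have : p * (p * q + q * p) = p * p * q + p * q * p := by noncomm_ring
    rw [h1, hp, mul_zero] at this
    exact this.symm
  have h3 : p * q * p + q * p = 0 := by
    have : (p * q + q * p) * p = p * q * p + q * (p * p) := by noncomm_ring
    rw [h1, hp, zero_mul] at this
    exact this.symm
  have h4 : p * q = q * p := by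
    rw [eq_neg_of_add_eq_zero_left h2, eq_neg_of_add_eq_zero_right h3]
  rw [← h4, ← two_smul ℂ] at h1
  exact (smul_eq_zero.1 h1).resolve_left two_ne_zero

theorem mul_eq_inter {s t : Set α} (hs : MeasurableSet s) (ht : MeasurableSet t) :
    E s * E t = E (s ∩ t) := by
  have h1 : E s = E (s ∩ t) + E (s \ t) := by
    rw [← E.apply_union (hs.inter ht) (hs.diff ht) Set.disjoint_sdiff_inter.symm,
      Set.inter_union_sdiff]
  have h2 : E t = E (s ∩ t) + E (t \ s) := by
    rw [Set.inter_comm, ← E.apply_union (ht.inter hs) (ht.diff hs) Set.disjoint_sdiff_inter.symm,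
      Set.inter_union_sdiff]
  rw [h1, h2, add_mul, mul_add, mul_add, E.mul_self (hs.inter ht),
    E.mul_eq_zero_of_disjoint (hs.inter ht) (ht.diff hs),
    E.mul_eq_zero_of_disjoint (hs.diff ht) (hs.inter ht),
    E.mul_eq_zero_of_disjoint (hs.diff ht) (ht.diff hs)]
  · simp
  · exact Set.disjoint_left.2 fun x hx hy => hy.2 hx.1
  · exact Set.disjoint_left.2 fun x hx hy => hx.2 hy.2
  · exact Set.disjoint_left.2 fun x hx hy => hy.2 hx.1

theorem inner_apply_left {s : Set α} (hs : MeasurableSet s) (x y : H) :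
    inner ℂ (E s x) y = inner ℂ x (E s y) := by
  have h := (E.isStarProjection' s hs).isSelfAdjoint
  rw [ContinuousLinearMap.isSelfAdjoint_iff'] at h
  rw [← ContinuousLinearMap.adjoint_inner_right, h]

theorem inner_apply_apply {s t : Set α} (hs : MeasurableSet s) (ht : MeasurableSet t) (x y : H) :
    inner ℂ (E s x) (E t y) = inner ℂ x (E (s ∩ t) y) := by
  rw [E.inner_apply_left hs, ← E.mul_eq_inter hs ht]
  rfl

theorem inner_self_apply {s : Set α} (hs : MeasurableSet s) (v : H) :
    inner ℂ v (E s v) = ((‖E s v‖ ^ 2 : ℝ) : ℂ) := by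
  have := E.inner_apply_apply hs hs v v
  rw [Set.inter_self] at this
  rw [← this, inner_self_eq_norm_sq_to_K]
  simp

theorem hasSum_norm_sq {s : ℕ → Set α} (hs : ∀ i, MeasurableSet (s i))
    (hd : Pairwise fun i j => Disjoint (s i) (s j)) (v : H) :
    HasSum (fun i => ‖E (s i) v‖ ^ 2) (‖E (⋃ i, s i) v‖ ^ 2) := by
  have h := (E.hasSum_iUnion' s hs hd v).mapL (innerSL ℂ v)
  simp only [innerSL_apply_apply] at h
  rw [E.inner_self_apply (MeasurableSet.iUnion hs)] at h
  simp only [E.inner_self_apply (hs _)] at h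
  exact_mod_cast h

/-- The scalar spectral measure `s ↦ ‖E(s) v‖² = ⟨E(s) v, v⟩`. -/
noncomputable def diag (v : H) : Measure α :=
  Measure.ofMeasurable (fun s _ => ENNReal.ofReal (‖E s v‖ ^ 2)) (by simp [E.apply_empty])
    fun s hs hd => by
      have h := E.hasSum_norm_sq hs hd v
      rw [← h.tsum_eq, ENNReal.ofReal_tsum_of_nonneg (fun _ => by positivity) h.summable]

theorem diag_apply (v : H) {s : Set α} (hs : MeasurableSet s) :
    E.diag v s = ENNReal.ofReal (‖E s v‖ ^ 2) := Measure.ofMeasurable_apply s hs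

theorem diag_univ (v : H) : E.diag v Set.univ = ENNReal.ofReal (‖v‖ ^ 2) := by
  rw [diag_apply _ _ MeasurableSet.univ, E.univ']; rfl

instance (v : H) : IsFiniteMeasure (E.diag v) :=
  ⟨by rw [diag_univ]; exact ENNReal.ofReal_lt_top⟩

theorem diag_real (v : H) {s : Set α} (hs : MeasurableSet s) :
    (E.diag v).real s = ‖E s v‖ ^ 2 := by
  rw [Measure.real, diag_apply _ _ hs, ENNReal.toReal_ofReal (by positivity)]

/-- By multiplicativity `⟨E(s) v, E(t) v⟩` is the mass of `s ∩ t`, which is also the inner product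
of the indicators, so the two Gram matrices agree. -/
theorem exists_isometry (v : H) : ∃ U : Lp ℂ 2 (E.diag v) →ₗᵢ[ℂ] H,
    ∀ s, U (indicatorL2 (E.diag v) s) = E s.1 v := by
  refine exists_linearIsometry_of_inner_eq (fun s t => ?_) (dense_span_indicatorL2 _)
  rw [inner_indicatorL2, E.inner_apply_apply s.2 t.2, E.inner_self_apply (s.2.inter t.2),
    diag_real _ _ (s.2.inter t.2)]

/-- The isometry `L²(‖E(·) v‖²) → H` that sends `1_s` to `E(s) v`. -/
noncomputable def isometry (v : H) : Lp ℂ 2 (E.diag v) →ₗᵢ[ℂ] H := (E.exists_isometry v).choose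

theorem isometry_indicator (v : H) (s : {s : Set α // MeasurableSet s}) :
    E.isometry v (indicatorL2 (E.diag v) s) = E s.1 v := (E.exists_isometry v).choose_spec s

end SpectralMeasure
-- Hilbert–Schmidt bounds
section HilbertSchmidtBound

variable {V W X : Type*} [NormedAddCommGroup V] [InnerProductSpace ℂ V] [NormedAddCommGroup W]
  [InnerProductSpace ℂ W] [NormedAddCommGroup X] [InnerProductSpace ℂ X]

/-- The Hilbert–Schmidt norm of `T` is at most `c`. -/
def HSBound (T : V →L[ℂ] W) (c : ℝ) : Prop :=
  0 ≤ c ∧ ∀ (n : ℕ) (e : Fin n → V), Orthonormal ℂ e → ∑ i, ‖T (e i)‖ ^ 2 ≤ c ^ 2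

theorem HSBound.sum_le {T : V →L[ℂ] W} {c : ℝ} (hT : HSBound T c) {ι : Type*} {e : ι → V}
    (he : Orthonormal ℂ e) (s : Finset ι) : ∑ i ∈ s, ‖T (e i)‖ ^ 2 ≤ c ^ 2 := by
  have h := hT.2 s.card (fun i => e (s.equivFin.symm i))
    (he.comp _ (Subtype.val_injective.comp s.equivFin.symm.injective))
  rwa [s.equivFin.symm.sum_comp (fun i => ‖T (e i)‖ ^ 2),
    Finset.sum_coe_sort s (fun i => ‖T (e i)‖ ^ 2)] at h

theorem HSBound.comp_isometry {T : V →L[ℂ] W} {c : ℝ} (hT : HSBound T c) (U : X →ₗᵢ[ℂ] V) :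
    HSBound (T ∘L U.toContinuousLinearMap) c :=
  ⟨hT.1, fun n _ he => hT.2 n _ (he.comp_linearIsometry U)⟩

theorem HSBound.comp_contraction {T : V →L[ℂ] W} {c : ℝ} (hT : HSBound T c) (A : W →L[ℂ] X)
    (hA : ‖A‖ ≤ 1) : HSBound (A ∘L T) c := by
  refine ⟨hT.1, fun n e he => le_trans (Finset.sum_le_sum fun i _ => ?_) (hT.2 n e he)⟩
  have : ‖A (T (e i))‖ ≤ ‖T (e i)‖ := by
    simpa using A.le_of_opNorm_le hA (T (e i))
  exact pow_le_pow_left₀ (norm_nonneg _) this 2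

end HilbertSchmidtBound

/-! ### Orthogonal series -/

section OrthogonalSeries

variable {V ι : Type*} [NormedAddCommGroup V] [InnerProductSpace ℂ V]

theorem norm_sum_sq_of_orthogonal {x : ι → V}
    (hx : Pairwise fun i j => inner ℂ (x i) (x j) = 0) (s : Finset ι) :
    ‖∑ i ∈ s, x i‖ ^ 2 = ∑ i ∈ s, ‖x i‖ ^ 2 := by
  classical
  induction s using Finset.induction_on with
  | empty => simp
  | insert a s ha ih =>
    rw [Finset.sum_insert ha, Finset.sum_insert ha, ← ih, sq, sq, sq]
    refine norm_add_sq_eq_norm_sq_add_norm_sq_of_inner_eq_zero (𝕜 := ℂ) _ _ ?_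
    rw [inner_sum]
    exact Finset.sum_eq_zero fun i hi => hx (by rintro rfl; exact ha hi)

/-- Pythagoras turns the Cauchy criterion for the squared norms into the one for the vectors. -/
theorem summable_of_orthogonal [CompleteSpace V] {x : ι → V} {c : ℝ} (hc : 0 ≤ c)
    (hx : Pairwise fun i j => inner ℂ (x i) (x j) = 0)
    (hs : ∀ s : Finset ι, ∑ i ∈ s, ‖x i‖ ^ 2 ≤ c ^ 2) :
    Summable x ∧ ‖∑' i, x i‖ ≤ c := by
  have hsq : Summable fun i => ‖x i‖ ^ 2 := summable_of_sum_le (fun _ => by positivity) hs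
  have hsum : Summable x := by
    rw [summable_iff_vanishing_norm] at hsq ⊢
    intro ε hε
    obtain ⟨s, h⟩ := hsq (ε ^ 2) (by positivity)
    refine ⟨s, fun t ht => ?_⟩
    have h1 := h t ht
    rw [Real.norm_of_nonneg (Finset.sum_nonneg fun _ _ => by positivity),
      ← norm_sum_sq_of_orthogonal hx] at h1
    exact lt_of_pow_lt_pow_left₀ 2 hε.le h1
  refine ⟨hsum, le_of_tendsto hsum.hasSum.norm (Filter.Eventually.of_forall fun s => ?_)⟩
  refine le_of_sq_le_sq ?_ hc
  rw [norm_sum_sq_of_orthogonal hx]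
  exact hs s

end OrthogonalSeries

/-! ### Kernels of Hilbert–Schmidt operators between `L²` spaces -/

section Tensor

variable {α β : Type*} [MeasurableSpace α] [MeasurableSpace β] {μ : Measure α} {ν : Measure β}

theorem memLp_tensor {a : α → ℂ} {b : β → ℂ} (ha : MemLp a 2 μ) (hb : MemLp b 2 ν) :
    MemLp (fun p : α × β => a p.1 * starRingEnd ℂ (b p.2)) 2 (μ.prod ν) := by
  have hm : AEStronglyMeasurable (fun p : α × β => a p.1 * starRingEnd ℂ (b p.2)) (μ.prod ν) :=
    ha.1.comp_fst.mul (RCLike.continuous_conj.comp_aestronglyMeasurable hb.1.comp_snd)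
  rw [memLp_two_iff_integrable_sq_norm hm]
  refine (Integrable.mul_prod ((memLp_two_iff_integrable_sq_norm ha.1).1 ha)
    ((memLp_two_iff_integrable_sq_norm hb.1).1 hb)).congr (Filter.Eventually.of_forall fun p => ?_)
  simp [mul_pow]

/-- The function `(x, y) ↦ a(x) conj(b(y))` as an element of `L²(μ × ν)`. -/
noncomputable def tensorConj (a : Lp ℂ 2 μ) (b : Lp ℂ 2 ν) : Lp ℂ 2 (μ.prod ν) :=
  (memLp_tensor (Lp.memLp a) (Lp.memLp b)).toLp _

theorem coeFn_tensorConj (a : Lp ℂ 2 μ) (b : Lp ℂ 2 ν) :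
    tensorConj a b =ᵐ[μ.prod ν] fun p => a p.1 * starRingEnd ℂ (b p.2) :=
  MemLp.coeFn_toLp _

variable [IsFiniteMeasure μ] [IsFiniteMeasure ν]

theorem inner_tensorConj (a a' : Lp ℂ 2 μ) (b b' : Lp ℂ 2 ν) :
    inner ℂ (tensorConj a b) (tensorConj a' b') = inner ℂ a a' * inner ℂ b' b := by
  rw [L2.inner_def, L2.inner_def, L2.inner_def, ← integral_prod_mul]
  refine integral_congr_ae ?_
  filter_upwards [coeFn_tensorConj a b, coeFn_tensorConj a' b'] with p h1 h2
  rw [h1, h2]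
  simp only [RCLike.inner_apply, map_mul, RCLike.conj_conj]
  ring

/-- Hilbert–Schmidt operators between `L²` spaces are integral operators. -/
theorem exists_kernel {A : Lp ℂ 2 ν →L[ℂ] Lp ℂ 2 μ} {c : ℝ} (hA : HSBound A c) :
    ∃ t : Lp ℂ 2 (μ.prod ν), ‖t‖ ≤ c ∧ ∀ a b, inner ℂ (tensorConj a b) t = inner ℂ a (A b) := by
  obtain ⟨w, φ, -⟩ := exists_hilbertBasis ℂ (Lp ℂ 2 ν)
  -- The kernel is the series of `(A φ_i)(x) conj(φ_i(y))` over a Hilbert basis `φ`. Its terms are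
  -- orthogonal with norms `‖A φ_i‖`, so the Hilbert–Schmidt bound makes it converge.
  have horth : Pairwise fun i j : w =>
      inner ℂ (tensorConj (A (φ i)) (φ i)) (tensorConj (A (φ j)) (φ j)) = 0 := by
    intro i j hij
    rw [inner_tensorConj, φ.orthonormal.2 hij.symm, mul_zero]
  have hnorm : ∀ i, ‖tensorConj (A (φ i)) (φ i)‖ = ‖A (φ i)‖ := by
    intro i
    have h := inner_tensorConj (A (φ i)) (A (φ i)) (φ i) (φ i)
    rw [inner_self_eq_norm_sq_to_K, inner_self_eq_norm_sq_to_K, inner_self_eq_norm_sq_to_K,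
      φ.orthonormal.1 i] at h
    have h' : ‖tensorConj (A (φ i)) (φ i)‖ ^ 2 = ‖A (φ i)‖ ^ 2 := by
      simp only [Complex.coe_algebraMap] at h
      norm_num at h
      exact_mod_cast h
    exact (sq_eq_sq₀ (norm_nonneg _) (norm_nonneg _)).1 h'
  obtain ⟨hs, ht⟩ := summable_of_orthogonal hA.1 horth (fun s => by
    simp only [hnorm]
    exact hA.sum_le φ.orthonormal s)
  refine ⟨_, ht, fun a b => ?_⟩
  have h1 := hs.hasSum.mapL (innerSL ℂ (tensorConj a b))
  simp only [innerSL_apply_apply, inner_tensorConj] at h1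
  have h2 := (φ.hasSum_repr b).mapL (innerSL ℂ a ∘L A)
  simp only [ContinuousLinearMap.comp_apply, innerSL_apply_apply, map_smul, smul_eq_mul,
    φ.repr_apply_apply] at h2
  refine h1.unique (h2.congr_fun fun i => ?_)
  rw [mul_comm]

end Tensor

/-! ### Operators from bounded sesquilinear forms -/

section Sesquilinear

variable {H : Type*} [NormedAddCommGroup H] [InnerProductSpace ℂ H]

theorem opNorm_le_of_inner {A : H →L[ℂ] H} {c : ℝ} (hc : 0 ≤ c)
    (h : ∀ u v, ‖inner ℂ v (A u)‖ ≤ c * ‖v‖ * ‖u‖) : ‖A‖ ≤ c := by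
  refine A.opNorm_le_bound hc fun u => ?_
  rcases eq_or_ne (A u) 0 with h0 | h0
  · rw [h0, norm_zero]; positivity
  · have h1 := h u (A u)
    rw [inner_self_eq_norm_sq_to_K] at h1
    have h2 : ‖A u‖ * ‖A u‖ ≤ ‖A u‖ * (c * ‖u‖) := by
      have : ‖((‖A u‖ : ℂ)) ^ 2‖ = ‖A u‖ * ‖A u‖ := by
        rw [norm_pow, Complex.norm_real, norm_norm, sq]
      have h3 : ‖A u‖ * ‖A u‖ ≤ c * ‖A u‖ * ‖u‖ := this ▸ h1
      linarith
    exact le_of_mul_le_mul_left h2 (norm_pos_iff.2 h0)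

/-- A bounded sesquilinear form is given by a bounded operator. -/
theorem exists_operator_of_sesquilinear [CompleteSpace H] (B : H → H → ℂ) (c : ℝ) (hc : 0 ≤ c)
    (hbound : ∀ v u, ‖B v u‖ ≤ c * ‖v‖ * ‖u‖)
    (hadd : ∀ v u u', B v (u + u') = B v u + B v u')
    (hsmul : ∀ (a : ℂ) v u, B v (a • u) = a * B v u)
    (hadd' : ∀ v v' u, B (v + v') u = B v u + B v' u)
    (hsmul' : ∀ (a : ℂ) v u, B (a • v) u = starRingEnd ℂ a * B v u) :
    ∃ A : H →L[ℂ] H, ‖A‖ ≤ c ∧ ∀ u v, inner ℂ v (A u) = B v u := by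
  let f : H →ₗ⋆[ℂ] H →ₗ[ℂ] ℂ := LinearMap.mk₂'ₛₗ (starRingEnd ℂ) (RingHom.id ℂ) B
    hadd' hsmul' hadd hsmul
  let g : H →L⋆[ℂ] H →L[ℂ] ℂ := f.mkContinuous₂ c hbound
  have h : ∀ u v, inner ℂ v
      (ContinuousLinearMap.adjoint (InnerProductSpace.continuousLinearMapOfBilin g) u) = B v u := by
    intro u v
    rw [ContinuousLinearMap.adjoint_inner_right,
      InnerProductSpace.continuousLinearMapOfBilin_apply]
    rfl
  exact ⟨_, opNorm_le_of_inner hc fun u v => by rw [h]; exact hbound v u, h⟩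

end Sesquilinear

/-! ### Measures and integrals on rectangles -/

section Rectangles

/-- Rectangles are a π-system generating the product σ-algebra. This reduces the identities between
plane measures below to `E₁ s * T * E₂ t`. -/
theorem vectorMeasure_ext_prod {α β F : Type*} [MeasurableSpace α] [MeasurableSpace β]
    [AddCommGroup F] [TopologicalSpace F] [T2Space F] {M M' : VectorMeasure (α × β) F}
    (h : ∀ s t, MeasurableSet s → MeasurableSet t → M (s ×ˢ t) = M' (s ×ˢ t)) : M = M' := by
  refine VectorMeasure.ext_of_generateFrom _ ?_ generateFrom_prod.symm isPiSystem_prod ?_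
  · rintro _ ⟨s, hs, t, ht, rfl⟩
    exact h s t hs ht
  · rw [← Set.univ_prod_univ, h _ _ .univ .univ]

variable {α β : Type*} [MeasurableSpace α] [MeasurableSpace β] {μ : Measure α} {ν : Measure β}
  [IsFiniteMeasure μ] [IsFiniteMeasure ν]

theorem setIntegral_prod_eq_inner (f : Lp ℂ 2 (μ.prod ν)) (s : {s : Set α // MeasurableSet s})
    (t : {t : Set β // MeasurableSet t}) :
    ∫ p in s.1 ×ˢ t.1, f p ∂(μ.prod ν) =
      inner ℂ (tensorConj (indicatorL2 μ s) (indicatorL2 ν t)) f := by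
  rw [L2.inner_def, ← integral_indicator (s.2.prod t.2)]
  refine integral_congr_ae ?_
  filter_upwards [coeFn_tensorConj (indicatorL2 μ s) (indicatorL2 ν t),
    Measure.quasiMeasurePreserving_fst.ae_eq_comp (coeFn_indicatorL2 μ s),
    Measure.quasiMeasurePreserving_snd.ae_eq_comp (coeFn_indicatorL2 ν t)] with p h1 h2 h3
  simp only [Function.comp_apply] at h2 h3
  rw [h1, h2, h3]
  by_cases hs : p.1 ∈ s.1 <;> by_cases ht : p.2 ∈ t.1 <;> simp [Set.indicator, hs, ht]

theorem norm_setIntegral_le_norm_mul_sqrt (f : Lp ℂ 2 (μ.prod ν)) {S : Set (α × β)}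
    (hS : MeasurableSet S) :
    ‖∫ p in S, f p ∂(μ.prod ν)‖ ≤ ‖f‖ * Real.sqrt ((μ.prod ν).real S) := by
  have h := norm_inner_le_norm (𝕜 := ℂ) (indicatorL2 (μ.prod ν) ⟨S, hS⟩) f
  rw [indicatorL2, L2.inner_indicatorConstLp_one] at h
  refine h.trans_eq ?_
  rw [mul_comm]
  congr 1
  rw [norm_indicatorConstLp (by simp) (by simp), Real.sqrt_eq_rpow]
  simp

end Rectangles

/-! ### The plane operator measure of a Hilbert–Schmidt operator -/

section Kernel

variable {H : Type u} [NormedAddCommGroup H] [InnerProductSpace ℂ H] [CompleteSpace H]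
  (E₁ E₂ : SpectralMeasure ℝ H)

/-- The measure `‖E₁(·) v‖² × ‖E₂(·) u‖²` on the plane. -/
noncomputable def planeMeasure (u v : H) : Measure (ℝ × ℝ) := (E₁.diag v).prod (E₂.diag u)

instance (u v : H) : IsFiniteMeasure (planeMeasure E₁ E₂ u v) := by
  unfold planeMeasure; infer_instance

theorem planeMeasure_real_univ (u v : H) :
    (planeMeasure E₁ E₂ u v).real Set.univ = (‖v‖ * ‖u‖) ^ 2 := by
  rw [planeMeasure, ← Set.univ_prod_univ, measureReal_prod_prod, E₁.diag_real _ .univ,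
    E₂.diag_real _ .univ, E₁.univ', E₂.univ', mul_pow]
  rfl

/-- With `U₁`, `U₂` the isometries from `L²` into `H`, the compression `U₁* T U₂` has no larger
Hilbert–Schmidt norm than `T`; its kernel is the one wanted. -/
theorem exists_operatorKernel {T : H →L[ℂ] H} {c : ℝ} (hT : HSBound T c) (u v : H) :
    ∃ t : Lp ℂ 2 (planeMeasure E₁ E₂ u v), ‖t‖ ≤ c ∧
      ∀ a b, inner ℂ (tensorConj a b) t = inner ℂ (E₁.isometry v a) (T (E₂.isometry u b)) := by
  have h := (hT.comp_isometry (E₂.isometry u)).comp_contraction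
    (ContinuousLinearMap.adjoint (E₁.isometry v).toContinuousLinearMap) (by
      rw [LinearIsometryEquiv.norm_map]
      exact (E₁.isometry v).norm_toContinuousLinearMap_le)
  obtain ⟨t, ht, h'⟩ := exists_kernel h
  refine ⟨t, ht, fun a b => ?_⟩
  rw [h']
  simp [ContinuousLinearMap.adjoint_inner_right]

open Classical in
/-- The kernel of `T` with respect to the scalar spectral measures of `E₁` at `v` and `E₂` at `u`. -/
noncomputable def operatorKernel (T : H →L[ℂ] H) (u v : H) : Lp ℂ 2 (planeMeasure E₁ E₂ u v) :=
  if h : ∃ c, HSBound T c then (exists_operatorKernel E₁ E₂ h.choose_spec u v).choose else 0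

theorem inner_operatorKernel {T : H →L[ℂ] H} {c : ℝ} (hT : HSBound T c) (u v : H)
    (a : Lp ℂ 2 (E₁.diag v)) (b : Lp ℂ 2 (E₂.diag u)) :
    inner ℂ (tensorConj a b) (operatorKernel E₁ E₂ T u v) =
      inner ℂ (E₁.isometry v a) (T (E₂.isometry u b)) := by
  have h : ∃ c, HSBound T c := ⟨c, hT⟩
  rw [operatorKernel, dif_pos h]
  exact (exists_operatorKernel E₁ E₂ h.choose_spec u v).choose_spec.2 a b

theorem integrable_Lp_two (u v : H) (t : Lp ℂ 2 (planeMeasure E₁ E₂ u v)) :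
    Integrable t (planeMeasure E₁ E₂ u v) :=
  (Lp.memLp t).integrable (by norm_num)

/-- The complex measure `S ↦ ⟨M(S) u, v⟩`, with `M` the extension of `s × t ↦ E₁(s) T E₂(t)`. -/
noncomputable def kernelMeasure (T : H →L[ℂ] H) (u v : H) : ComplexMeasure (ℝ × ℝ) :=
  (planeMeasure E₁ E₂ u v).withDensityᵥ (operatorKernel E₁ E₂ T u v)

theorem kernelMeasure_apply (T : H →L[ℂ] H) (u v : H) {S : Set (ℝ × ℝ)} (hS : MeasurableSet S) :
    kernelMeasure E₁ E₂ T u v S =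
      ∫ p in S, operatorKernel E₁ E₂ T u v p ∂(planeMeasure E₁ E₂ u v) :=
  withDensityᵥ_apply (integrable_Lp_two E₁ E₂ u v _) hS

theorem setIntegral_rectangle {T : H →L[ℂ] H} {u v : H} {k : Lp ℂ 2 (planeMeasure E₁ E₂ u v)}
    (hk : ∀ a b, inner ℂ (tensorConj a b) k = inner ℂ (E₁.isometry v a) (T (E₂.isometry u b)))
    {s t : Set ℝ} (hs : MeasurableSet s) (ht : MeasurableSet t) :
    ∫ p in s ×ˢ t, k p ∂(planeMeasure E₁ E₂ u v) = inner ℂ v (E₁ s (T (E₂ t u))) := by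
  have h := setIntegral_prod_eq_inner (μ := E₁.diag v) (ν := E₂.diag u) k ⟨s, hs⟩ ⟨t, ht⟩
  refine h.trans ?_
  rw [hk, SpectralMeasure.isometry_indicator, SpectralMeasure.isometry_indicator,
    E₁.inner_apply_left hs]

theorem kernelMeasure_rectangle {T : H →L[ℂ] H} {c : ℝ} (hT : HSBound T c) (u v : H)
    {s t : Set ℝ} (hs : MeasurableSet s) (ht : MeasurableSet t) :
    kernelMeasure E₁ E₂ T u v (s ×ˢ t) = inner ℂ v (E₁ s (T (E₂ t u))) := by
  rw [kernelMeasure_apply _ _ _ _ _ (hs.prod ht)]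
  exact setIntegral_rectangle E₁ E₂ (inner_operatorKernel E₁ E₂ hT u v) hs ht

/-- The kernel is obtained by choice, separately for each operator and from an arbitrary
Hilbert–Schmidt bound. Its linearity in `T` and its bound by any given `c` come from this
uniqueness. -/
theorem operatorKernel_ae_unique {T : H →L[ℂ] H} {c : ℝ} (hT : HSBound T c) (u v : H)
    {k : ℝ × ℝ → ℂ} (hk : Integrable k (planeMeasure E₁ E₂ u v))
    (h : ∀ s t, MeasurableSet s → MeasurableSet t →
      ∫ p in s ×ˢ t, k p ∂(planeMeasure E₁ E₂ u v) = inner ℂ v (E₁ s (T (E₂ t u)))) :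
    operatorKernel E₁ E₂ T u v =ᵐ[planeMeasure E₁ E₂ u v] k := by
  refine (integrable_Lp_two E₁ E₂ u v _).ae_eq_of_withDensityᵥ_eq hk (vectorMeasure_ext_prod ?_)
  intro s t hs ht
  rw [withDensityᵥ_apply hk (hs.prod ht), h s t hs ht]
  exact kernelMeasure_rectangle E₁ E₂ hT u v hs ht

theorem norm_operatorKernel_le {T : H →L[ℂ] H} {c : ℝ} (hT : HSBound T c) (u v : H) :
    ‖operatorKernel E₁ E₂ T u v‖ ≤ c := by
  obtain ⟨t, ht, h⟩ := exists_operatorKernel E₁ E₂ hT u v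
  have := operatorKernel_ae_unique E₁ E₂ hT u v (integrable_Lp_two E₁ E₂ u v t)
    fun s t hs ht => setIntegral_rectangle E₁ E₂ h hs ht
  rwa [Lp.ext this]

theorem operatorKernel_add {S T : H →L[ℂ] H} {a b c : ℝ} (hS : HSBound S a) (hT : HSBound T b)
    (hST : HSBound (S + T) c) (u v : H) :
    operatorKernel E₁ E₂ (S + T) u v = operatorKernel E₁ E₂ S u v + operatorKernel E₁ E₂ T u v := by
  ext1
  refine (operatorKernel_ae_unique E₁ E₂ hST u v ((integrable_Lp_two E₁ E₂ u v _).add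
    (integrable_Lp_two E₁ E₂ u v _)) fun s t hs ht => ?_).trans (Lp.coeFn_add _ _).symm
  rw [integral_add' (integrable_Lp_two E₁ E₂ u v _).integrableOn
    (integrable_Lp_two E₁ E₂ u v _).integrableOn,
    setIntegral_rectangle E₁ E₂ (inner_operatorKernel E₁ E₂ hS u v) hs ht,
    setIntegral_rectangle E₁ E₂ (inner_operatorKernel E₁ E₂ hT u v) hs ht]
  simp

theorem operatorKernel_smul {T : H →L[ℂ] H} {b c : ℝ} (hT : HSBound T b) (a : ℂ)
    (haT : HSBound (a • T) c) (u v : H) :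
    operatorKernel E₁ E₂ (a • T) u v = a • operatorKernel E₁ E₂ T u v := by
  ext1
  refine (operatorKernel_ae_unique E₁ E₂ haT u v ((integrable_Lp_two E₁ E₂ u v _).smul a)
    fun s t hs ht => ?_).trans (Lp.coeFn_smul _ _).symm
  simp only [Pi.smul_apply]
  rw [integral_smul, setIntegral_rectangle E₁ E₂ (inner_operatorKernel E₁ E₂ hT u v) hs ht]
  simp

theorem norm_kernelMeasure_le {T : H →L[ℂ] H} {c : ℝ} (hT : HSBound T c) (u v : H)
    (S : Set (ℝ × ℝ)) : ‖kernelMeasure E₁ E₂ T u v S‖ ≤ c * ‖v‖ * ‖u‖ := by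
  by_cases hS : MeasurableSet S
  · rw [kernelMeasure_apply _ _ _ _ _ hS]
    refine (norm_setIntegral_le_norm_mul_sqrt (μ := E₁.diag v) (ν := E₂.diag u) _ hS).trans ?_
    rw [mul_assoc]
    refine mul_le_mul (norm_operatorKernel_le E₁ E₂ hT u v) ?_ (Real.sqrt_nonneg _) hT.1
    rw [← Real.sqrt_sq (by positivity : 0 ≤ ‖v‖ * ‖u‖), ← planeMeasure_real_univ E₁ E₂]
    exact Real.sqrt_le_sqrt (measureReal_mono (Set.subset_univ _))
  · rw [VectorMeasure.not_measurable _ hS, norm_zero]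
    have := hT.1
    positivity

/-- Sesquilinearity in `u`, `v` is not visible from the densities, since the reference measure
itself varies with `u` and `v`. It is evident on rectangles and passes to all sets by uniqueness. -/
theorem exists_planeOperator {T : H →L[ℂ] H} {c : ℝ} (hT : HSBound T c) (S : Set (ℝ × ℝ)) :
    ∃ A : H →L[ℂ] H, ‖A‖ ≤ c ∧ ∀ u v, inner ℂ v (A u) = kernelMeasure E₁ E₂ T u v S := by
  have key : ∀ {u v : H} {ρ : ComplexMeasure (ℝ × ℝ)},
      (∀ s t, MeasurableSet s → MeasurableSet t →
        inner ℂ v (E₁ s (T (E₂ t u))) = ρ (s ×ˢ t)) → kernelMeasure E₁ E₂ T u v = ρ :=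
    fun h => vectorMeasure_ext_prod fun s t hs ht => by
      rw [kernelMeasure_rectangle E₁ E₂ hT _ _ hs ht, h s t hs ht]
  refine exists_operator_of_sesquilinear (fun v u => kernelMeasure E₁ E₂ T u v S) c hT.1
    (fun v u => norm_kernelMeasure_le E₁ E₂ hT u v S) ?_ ?_ ?_ ?_
  · intro v u u'
    rw [← add_apply]
    refine congrArg (fun ρ : ComplexMeasure (ℝ × ℝ) => ρ S) (key fun s t hs ht => ?_)
    simp [kernelMeasure_rectangle E₁ E₂ hT _ _ hs ht]
  · intro a v u
    rw [← smul_eq_mul, ← smul_apply]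
    refine congrArg (fun ρ : ComplexMeasure (ℝ × ℝ) => ρ S) (key fun s t hs ht => ?_)
    simp [kernelMeasure_rectangle E₁ E₂ hT _ _ hs ht]
  · intro v v' u
    rw [← add_apply]
    refine congrArg (fun ρ : ComplexMeasure (ℝ × ℝ) => ρ S) (key fun s t hs ht => ?_)
    simp [kernelMeasure_rectangle E₁ E₂ hT _ _ hs ht]
  · intro a v u
    rw [← smul_eq_mul, ← smul_apply]
    refine congrArg (fun ρ : ComplexMeasure (ℝ × ℝ) => ρ S) (key fun s t hs ht => ?_)
    simp [kernelMeasure_rectangle E₁ E₂ hT _ _ hs ht, mul_comm]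

open Classical in
/-- The operator `M(S)`, with `M` the extension of `s × t ↦ E₁(s) T E₂(t)`. -/
noncomputable def planeOperator (T : H →L[ℂ] H) (S : Set (ℝ × ℝ)) : H →L[ℂ] H :=
  if h : ∃ c, HSBound T c then (exists_planeOperator E₁ E₂ h.choose_spec S).choose else 0

theorem inner_planeOperator {T : H →L[ℂ] H} {c : ℝ} (hT : HSBound T c) (S : Set (ℝ × ℝ))
    (u v : H) : inner ℂ v (planeOperator E₁ E₂ T S u) = kernelMeasure E₁ E₂ T u v S := by
  have h : ∃ c, HSBound T c := ⟨c, hT⟩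
  rw [planeOperator, dif_pos h]
  exact (exists_planeOperator E₁ E₂ h.choose_spec S).choose_spec.2 u v

theorem norm_planeOperator_le {T : H →L[ℂ] H} {c : ℝ} (hT : HSBound T c) (S : Set (ℝ × ℝ)) :
    ‖planeOperator E₁ E₂ T S‖ ≤ c :=
  opNorm_le_of_inner hT.1 fun u v => by
    rw [inner_planeOperator E₁ E₂ hT]; exact norm_kernelMeasure_le E₁ E₂ hT u v S

theorem planeOperator_rectangle {T : H →L[ℂ] H} {c : ℝ} (hT : HSBound T c) {s t : Set ℝ}
    (hs : MeasurableSet s) (ht : MeasurableSet t) :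
    planeOperator E₁ E₂ T (s ×ˢ t) = E₁ s * T * E₂ t := by
  ext u
  refine ext_inner_left ℂ fun v => ?_
  rw [inner_planeOperator E₁ E₂ hT, kernelMeasure_rectangle E₁ E₂ hT _ _ hs ht]
  rfl

theorem planeOperator_add {S T : H →L[ℂ] H} {a b c : ℝ} (hS : HSBound S a) (hT : HSBound T b)
    (hST : HSBound (S + T) c) (X : Set (ℝ × ℝ)) :
    planeOperator E₁ E₂ (S + T) X = planeOperator E₁ E₂ S X + planeOperator E₁ E₂ T X := by
  ext u
  refine ext_inner_left ℂ fun v => ?_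
  rw [add_apply, inner_add_right, inner_planeOperator E₁ E₂ hST,
    inner_planeOperator E₁ E₂ hS, inner_planeOperator E₁ E₂ hT, ← add_apply]
  refine congrArg (fun ρ : ComplexMeasure (ℝ × ℝ) => ρ X) (vectorMeasure_ext_prod ?_)
  intro s t hs ht
  simp [kernelMeasure_rectangle E₁ E₂ hST _ _ hs ht, kernelMeasure_rectangle E₁ E₂ hS _ _ hs ht,
    kernelMeasure_rectangle E₁ E₂ hT _ _ hs ht]

end Kernel

/-! ### Singular numbers and Hilbert–Schmidt bounds -/

section SingularNumberEstimates

variable {H : Type u} [NormedAddCommGroup H] [InnerProductSpace ℂ H]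

theorem singularNumber_antitone (T : H →L[ℂ] H) : Antitone (singularNumber T) := by
  intro i j hij
  refine le_ciInf fun K => singularNumber_le T K.1 j (K.2.trans ?_)
  exact_mod_cast hij

theorem singularNumber_le_norm (T : H →L[ℂ] H) (j : ℕ) : singularNumber T j ≤ ‖T‖ := by
  simpa using singularNumber_le T 0 j (by simp [LinearMap.rank_zero])

theorem singularNumber_zero_index (T : H →L[ℂ] H) : singularNumber T 0 = ‖T‖ := by
  refine le_antisymm (singularNumber_le_norm T 0) (le_ciInf fun K => ?_)
  have h : (K.1 : H →ₗ[ℂ] H) = 0 := by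
    have h0 : LinearMap.rank (K.1 : H →ₗ[ℂ] H) = 0 := by simpa using K.2
    exact LinearMap.range_eq_bot.1 (Submodule.rank_eq_zero.1 h0)
  have h' : K.1 = 0 := by ext x; exact LinearMap.congr_fun h x
  rw [h', sub_zero]

theorem singularNumber_eq_zero_of_rank_le {T : H →L[ℂ] H} {n j : ℕ}
    (hT : LinearMap.rank (T : H →ₗ[ℂ] H) ≤ (n : Cardinal)) (hj : n ≤ j) :
    singularNumber T j = 0 := by
  refine le_antisymm ?_ (singularNumber_nonneg _ _)
  simpa using singularNumber_le T T j (hT.trans (by exact_mod_cast hj))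

theorem exists_rank_le_norm_sub_le (T : H →L[ℂ] H) (j : ℕ) {δ : ℝ} (hδ : 0 < δ) :
    ∃ K : H →L[ℂ] H, LinearMap.rank (K : H →ₗ[ℂ] H) ≤ (j : Cardinal) ∧
      ‖T - K‖ ≤ singularNumber T j + δ := by
  obtain ⟨K, hK⟩ := exists_lt_of_ciInf_lt (lt_add_of_pos_right (singularNumber T j) hδ)
  exact ⟨K.1, K.2, hK.le⟩

/-- Both sums are the trace of `A* A`; corestricting `A` to its finite-dimensional range makes the
adjoint available. -/
theorem sum_norm_sq_eq_of_orthonormalBasis {F W ι : Type*} [NormedAddCommGroup F]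
    [InnerProductSpace ℂ F] [FiniteDimensional ℂ F] [NormedAddCommGroup W] [InnerProductSpace ℂ W]
    [Fintype ι] (A : F →ₗ[ℂ] W) (b b' : OrthonormalBasis ι ℂ F) :
    ∑ i, ‖A (b i)‖ ^ 2 = ∑ i, ‖A (b' i)‖ ^ 2 := by
  let R := LinearMap.range A
  let B : F →ₗ[ℂ] R := A.rangeRestrict
  have h : ∀ b : OrthonormalBasis ι ℂ F, ((∑ i, ‖A (b i)‖ ^ 2 : ℝ) : ℂ) =
      LinearMap.trace ℂ F (LinearMap.adjoint B ∘ₗ B) := by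
    intro b
    rw [LinearMap.trace_eq_sum_inner _ b]
    push_cast
    refine Finset.sum_congr rfl fun i _ => ?_
    change _ = inner ℂ (b i) (LinearMap.adjoint B (B (b i)))
    rw [LinearMap.adjoint_inner_right, inner_self_eq_norm_sq_to_K]
    rfl
  exact_mod_cast (h b).trans (h b').symm

theorem exists_unit_vector_of_rank_lt {F : Submodule ℂ H} [FiniteDimensional ℂ F]
    {K : H →L[ℂ] H} {m : ℕ} (hK : LinearMap.rank (K : H →ₗ[ℂ] H) ≤ (m : Cardinal))
    (hF : m < Module.finrank ℂ F) : ∃ x : F, ‖x‖ = 1 ∧ K x = 0 := by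
  have hlt : Module.rank ℂ (LinearMap.range ((K : H →ₗ[ℂ] H) ∘ₗ F.subtype)) <
      Module.rank ℂ F := by
    refine lt_of_le_of_lt ((LinearMap.rank_comp_le_left F.subtype (K : H →ₗ[ℂ] H)).trans hK) ?_
    rw [← Module.finrank_eq_rank]
    exact_mod_cast hF
  obtain ⟨x, hx, hx0⟩ : ∃ x ∈ LinearMap.ker ((K : H →ₗ[ℂ] H) ∘ₗ F.subtype), x ≠ 0 := by
    refine Submodule.exists_mem_ne_zero_of_ne_bot fun h => ?_
    rw [LinearMap.ker_eq_bot] at h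
    exact absurd (rank_range_of_injective _ h) hlt.ne
  refine ⟨((‖x‖⁻¹ : ℝ) : ℂ) • x, ?_, ?_⟩
  · rw [norm_smul, Complex.norm_real, norm_inv, norm_norm, inv_mul_cancel₀ (norm_ne_zero_iff.2 hx0)]
  · have : K x = 0 := hx
    simp [this]

/-- Induction, without compactness or a singular value decomposition. The span of `m + 1`
orthonormal vectors contains a unit vector `x` killed by a nearly optimal `K` of rank at most `m`,
so `‖T x‖ ≤ s_m + δ`. Passing to an orthonormal basis of the span with last vector `x` does not
change the sum, and the other `m` vectors fall under the induction hypothesis. -/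
theorem sum_norm_sq_le_sum_singularNumber_sq (T : H →L[ℂ] H) (m : ℕ) (e : Fin m → H)
    (he : Orthonormal ℂ e) :
    ∑ i, ‖T (e i)‖ ^ 2 ≤ ∑ j ∈ Finset.range m, singularNumber T j ^ 2 := by
  induction m with
  | zero => simp
  | succ m ih =>
    have hfin : Module.finrank ℂ (Submodule.span ℂ (Set.range e)) = Fintype.card (Fin (m + 1)) :=
      finrank_span_eq_card he.linearIndependent
    set F := Submodule.span ℂ (Set.range e)
    have : FiniteDimensional ℂ F := FiniteDimensional.span_of_finite ℂ (Set.finite_range e)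
    let e' : Fin (m + 1) → F := fun i => ⟨e i, Submodule.subset_span ⟨i, rfl⟩⟩
    have he' : Orthonormal ℂ e' := ⟨fun i => he.1 i, fun i j hij => he.2 hij⟩
    obtain ⟨b', hb'⟩ := Orthonormal.exists_orthonormalBasis_extension_of_card_eq hfin
      (v := e') (s := Set.univ) (he'.comp _ Subtype.val_injective)
    have key : ∀ δ > 0, ∑ i, ‖T (e i)‖ ^ 2 ≤
        ∑ j ∈ Finset.range m, singularNumber T j ^ 2 + (singularNumber T m + δ) ^ 2 := by
      intro δ hδ
      obtain ⟨K, hK, hTK⟩ := exists_rank_le_norm_sub_le T m hδ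
      obtain ⟨x, hx, hKx⟩ := exists_unit_vector_of_rank_lt hK (F := F) (by simp [hfin])
      obtain ⟨b, hb⟩ := Orthonormal.exists_orthonormalBasis_extension_of_card_eq hfin
        (v := fun _ => x) (s := {Fin.last m}) (by
          refine ⟨fun _ => hx, fun i j hij => absurd (Subsingleton.elim i j) hij⟩)
      have h1 : ∑ i, ‖T (e i)‖ ^ 2 = ∑ i, ‖T (b i)‖ ^ 2 := by
        have h2 := sum_norm_sq_eq_of_orthonormalBasis ((T : H →ₗ[ℂ] H) ∘ₗ F.subtype) b' b
        simpa [hb' _ (Set.mem_univ _), e'] using h2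
      rw [h1, Fin.sum_univ_castSucc]
      refine add_le_add (ih _ ?_) ?_
      · exact ((b.orthonormal.comp_linearIsometry F.subtypeₗᵢ).comp _ (Fin.castSucc_injective m))
      · rw [hb _ rfl]
        refine pow_le_pow_left₀ (norm_nonneg _) ?_ 2
        have h3 : T x = (T - K) x := by simp [hKx]
        rw [h3]
        refine ((T - K).le_opNorm _).trans ?_
        rw [Submodule.norm_coe, hx, mul_one]
        exact hTK
    rw [Finset.sum_range_succ]
    have hlim : Filter.Tendsto (fun δ : ℝ => ∑ j ∈ Finset.range m, singularNumber T j ^ 2 +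
        (singularNumber T m + δ) ^ 2) (nhdsWithin 0 (Set.Ioi 0))
        (nhds (∑ j ∈ Finset.range m, singularNumber T j ^ 2 + (singularNumber T m + 0) ^ 2)) := by
      refine Filter.Tendsto.mono_left ?_ nhdsWithin_le_nhds
      exact Continuous.tendsto (by fun_prop) 0
    rw [add_zero] at hlim
    exact ge_of_tendsto hlim (Filter.eventually_of_mem self_mem_nhdsWithin key)

theorem hsBound_of_sum_le {T : H →L[ℂ] H} {c : ℝ} (hc : 0 ≤ c)
    (h : ∀ m, ∑ j ∈ Finset.range m, singularNumber T j ^ 2 ≤ c ^ 2) : HSBound T c :=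
  ⟨hc, fun m e he => (sum_norm_sq_le_sum_singularNumber_sq T m e he).trans (h m)⟩

/-- Only the first `n` singular numbers can be nonzero, and each is at most `‖T‖`. -/
theorem hsBound_of_rank_le {T : H →L[ℂ] H} {n : ℕ}
    (hT : LinearMap.rank (T : H →ₗ[ℂ] H) ≤ (n : Cardinal)) : HSBound T (Real.sqrt n * ‖T‖) := by
  refine hsBound_of_sum_le (by positivity) fun m => ?_
  rw [mul_pow, Real.sq_sqrt (Nat.cast_nonneg n)]
  calc ∑ j ∈ Finset.range m, singularNumber T j ^ 2
      ≤ ∑ j ∈ Finset.range m, if j < n then ‖T‖ ^ 2 else 0 := by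
        refine Finset.sum_le_sum fun j _ => ?_
        split_ifs with hj
        · exact pow_le_pow_left₀ (singularNumber_nonneg _ _) (singularNumber_le_norm T j) 2
        · rw [singularNumber_eq_zero_of_rank_le hT (not_lt.1 hj)]; simp
    _ = ∑ j ∈ (Finset.range m).filter (· < n), ‖T‖ ^ 2 := by rw [Finset.sum_filter]
    _ ≤ n * ‖T‖ ^ 2 := by
        rw [Finset.sum_const, nsmul_eq_mul]
        refine mul_le_mul_of_nonneg_right ?_ (by positivity)
        have : (Finset.range m).filter (· < n) ⊆ Finset.range n := by
          intro j hj; simpa using (Finset.mem_filter.1 hj).2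
        exact_mod_cast (Finset.card_le_card this).trans_eq (Finset.card_range n)

theorem hsBound_of_mem_hilbertSchmidtClass {T : H →L[ℂ] H} (hT : T ∈ hilbertSchmidtClass H) :
    HSBound T (Real.sqrt (∑' j, singularNumber T j ^ 2)) := by
  refine hsBound_of_sum_le (by positivity) fun m => ?_
  rw [Real.sq_sqrt (tsum_nonneg fun _ => by positivity)]
  exact Summable.sum_le_tsum _ (fun _ _ => by positivity) hT

/-- Subtracting an operator of rank at most `n` shifts singular numbers by at most `n`, so
`s_{j+2n}(T - K) ≤ s_{j+n}(T)`; the first `2n` are bounded by `‖T - K‖`. -/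
theorem hsBound_sub_of_rank_le {T K : H →L[ℂ] H} (hT : T ∈ hilbertSchmidtClass H) {n : ℕ}
    (hK : LinearMap.rank (K : H →ₗ[ℂ] H) ≤ (n : Cardinal)) :
    HSBound (T - K) (Real.sqrt (2 * n * ‖T - K‖ ^ 2 + ∑' j, singularNumber T (j + n) ^ 2)) := by
  have hs : Summable fun j => singularNumber T (j + n) ^ 2 :=
    (summable_nat_add_iff (f := fun j => singularNumber T j ^ 2) n).2 hT
  have hpos : 0 ≤ ∑' j, singularNumber T (j + n) ^ 2 := tsum_nonneg fun _ => by positivity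
  have hshift : ∀ j, singularNumber (T - K) (j + n + n) ≤ singularNumber T (j + n) := by
    intro j
    have h := singularNumber_add_le T (-K) (i := j + n) (j := n) (n := j + n + n) le_rfl
    have h0 : singularNumber (-K) n = 0 := by
      refine singularNumber_eq_zero_of_rank_le (n := n) ?_ le_rfl
      have : ((-K : H →L[ℂ] H) : H →ₗ[ℂ] H) = (-LinearMap.id : H →ₗ[ℂ] H) ∘ₗ (K : H →ₗ[ℂ] H) := by
        ext; simp
      rw [this]
      exact (LinearMap.rank_comp_le_right _ _).trans hK
    rwa [h0, add_zero, ← sub_eq_add_neg] at h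
  refine hsBound_of_sum_le (by positivity) fun m => ?_
  rw [Real.sq_sqrt (by positivity)]
  calc ∑ j ∈ Finset.range m, singularNumber (T - K) j ^ 2
      ≤ ∑ j ∈ Finset.range (n + n + m), singularNumber (T - K) j ^ 2 :=
        Finset.sum_le_sum_of_subset_of_nonneg
          (Finset.range_subset_range.2 (by omega)) fun _ _ _ => by positivity
    _ = ∑ j ∈ Finset.range (n + n), singularNumber (T - K) j ^ 2 +
          ∑ j ∈ Finset.range m, singularNumber (T - K) (n + n + j) ^ 2 :=
        Finset.sum_range_add _ _ _
    _ ≤ ∑ j ∈ Finset.range (n + n), ‖T - K‖ ^ 2 +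
          ∑ j ∈ Finset.range m, singularNumber T (j + n) ^ 2 := by
        refine add_le_add (Finset.sum_le_sum fun j _ => ?_) (Finset.sum_le_sum fun j _ => ?_)
        · exact pow_le_pow_left₀ (singularNumber_nonneg _ _) (singularNumber_le_norm _ j) 2
        · refine pow_le_pow_left₀ (singularNumber_nonneg _ _) ?_ 2
          rw [show n + n + j = j + n + n by ring]
          exact hshift j
    _ ≤ 2 * n * ‖T - K‖ ^ 2 + ∑' j, singularNumber T (j + n) ^ 2 := by
        refine add_le_add (le_of_eq ?_) (hs.sum_le_tsum _ fun _ _ => by positivity)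
        rw [Finset.sum_const, Finset.card_range, nsmul_eq_mul]
        push_cast
        ring

end SingularNumberEstimates
-- Stability of Hilbert–Schmidt bounds; finite rank operators
section HilbertSchmidtClosure

variable {V W : Type*} [NormedAddCommGroup V] [InnerProductSpace ℂ V] [NormedAddCommGroup W]
  [InnerProductSpace ℂ W]

/-- The constant is crude: where sums are formed, only the existence of some bound matters. -/
theorem HSBound.add {S T : V →L[ℂ] W} {a b : ℝ} (hS : HSBound S a) (hT : HSBound T b) :
    HSBound (S + T) (Real.sqrt (2 * (a ^ 2 + b ^ 2))) := by
  refine ⟨by positivity, fun n e he => ?_⟩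
  rw [Real.sq_sqrt (by positivity)]
  calc ∑ i, ‖(S + T) (e i)‖ ^ 2 ≤ ∑ i, 2 * (‖S (e i)‖ ^ 2 + ‖T (e i)‖ ^ 2) := by
        refine Finset.sum_le_sum fun i _ => ?_
        have h := norm_add_le (S (e i)) (T (e i))
        rw [← add_apply] at h
        nlinarith [sq_nonneg (‖S (e i)‖ - ‖T (e i)‖), norm_nonneg ((S + T) (e i)),
          norm_nonneg (S (e i)), norm_nonneg (T (e i))]
    _ ≤ _ := by
        rw [← Finset.mul_sum, Finset.sum_add_distrib]
        have := hS.2 n e he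
        have := hT.2 n e he
        linarith

theorem HSBound.smul {T : V →L[ℂ] W} {c : ℝ} (hT : HSBound T c) (a : ℂ) :
    HSBound (a • T) (‖a‖ * c) := by
  refine ⟨mul_nonneg (norm_nonneg _) hT.1, fun n e he => ?_⟩
  simp only [smul_apply, norm_smul, mul_pow]
  rw [← Finset.mul_sum]
  exact mul_le_mul_of_nonneg_left (hT.2 n e he) (by positivity)

theorem HSBound.neg {T : V →L[ℂ] W} {c : ℝ} (hT : HSBound T c) : HSBound (-T) c := by
  simpa using hT.smul (-1)

theorem hsBound_zero : HSBound (0 : V →L[ℂ] W) 0 := ⟨le_rfl, fun n e _ => by simp⟩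

theorem hsBound_rankOne {H : Type u} [NormedAddCommGroup H] [InnerProductSpace ℂ H]
    {T : H →L[ℂ] H} {e g : H} (hT : ∀ x, T x = inner ℂ e x • g) :
    ∃ c, HSBound T c := by
  have hr : LinearMap.rank (T : H →ₗ[ℂ] H) ≤ ((1 : ℕ) : Cardinal) := by
    have hle : LinearMap.range (T : H →ₗ[ℂ] H) ≤ Submodule.span ℂ {g} := by
      rintro _ ⟨x, rfl⟩
      exact Submodule.mem_span_singleton.2 ⟨_, (hT x).symm⟩
    refine (Submodule.rank_mono hle).trans ((rank_span_le _).trans ?_)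
    simp
  exact ⟨_, hsBound_of_rank_le hr⟩

theorem isCompactOperator_of_rank_le {H : Type u} [NormedAddCommGroup H]
    [InnerProductSpace ℂ H] {K : H →L[ℂ] H} {n : ℕ}
    (hK : LinearMap.rank (K : H →ₗ[ℂ] H) ≤ (n : Cardinal)) : IsCompactOperator K := by
  have hfin : FiniteDimensional ℂ (LinearMap.range (K : H →ₗ[ℂ] H)) :=
    Module.rank_lt_aleph0_iff.1 (lt_of_le_of_lt hK (Cardinal.natCast_lt_aleph0))
  have : ProperSpace (LinearMap.range (K : H →ₗ[ℂ] H)) := FiniteDimensional.proper ℂ _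
  have h : IsCompactOperator
      (K.codRestrict (LinearMap.range (K : H →ₗ[ℂ] H)) fun x => ⟨x, rfl⟩) :=
    isCompactOperator_of_locallyCompactSpace_dom _
  exact h.clm_comp (LinearMap.range (K : H →ₗ[ℂ] H)).subtypeL

end HilbertSchmidtClosure

/-! ### Countable additivity in norm and compactness of the plane operators -/

section CountableAdditivity

variable {H : Type u} [NormedAddCommGroup H] [InnerProductSpace ℂ H] [CompleteSpace H]
  (E₁ E₂ : SpectralMeasure ℝ H)

/-- For `T = ⟨e, ·⟩ g` all the measures `⟨M(·) u, v⟩` have densities with respect to the single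
measure `planeMeasure E₁ E₂ e g`, with `L²` norms at most `‖u‖ ‖v‖`. Hence the bound is uniform in
`u` and `v`, which gives norm rather than weak additivity. -/
theorem norm_planeOperator_rankOne_le {T : H →L[ℂ] H} {e g : H}
    (hT : ∀ x, T x = inner ℂ e x • g) {S : Set (ℝ × ℝ)} (hS : MeasurableSet S) :
    ‖planeOperator E₁ E₂ T S‖ ≤ Real.sqrt ((planeMeasure E₁ E₂ e g).real S) := by
  obtain ⟨c, hc⟩ := hsBound_rankOne hT
  refine opNorm_le_of_inner (Real.sqrt_nonneg _) fun u v => ?_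
  let a := ContinuousLinearMap.adjoint (E₁.isometry g).toContinuousLinearMap v
  let b := ContinuousLinearMap.adjoint (E₂.isometry e).toContinuousLinearMap u
  let f : Lp ℂ 2 (planeMeasure E₁ E₂ e g) := tensorConj a b
  have hf : Integrable (fun p => starRingEnd ℂ (f p)) (planeMeasure E₁ E₂ e g) :=
    (integrable_Lp_two E₁ E₂ e g f).norm.mono
      (RCLike.continuous_conj.comp_aestronglyMeasurable (Lp.aestronglyMeasurable f))
      (Filter.Eventually.of_forall fun p => by simp)
  -- The density is the conjugate of `f`, where `a` and `b` are the pullbacks of `v` and `u` along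
  -- the isometries attached to `g` and `e`.
  have key : kernelMeasure E₁ E₂ T u v =
      (planeMeasure E₁ E₂ e g).withDensityᵥ fun p => starRingEnd ℂ (f p) := by
    refine vectorMeasure_ext_prod fun s t hs ht => ?_
    have h := setIntegral_prod_eq_inner (μ := E₁.diag g) (ν := E₂.diag e) f ⟨s, hs⟩ ⟨t, ht⟩
    rw [kernelMeasure_rectangle E₁ E₂ hc u v hs ht, withDensityᵥ_apply hf (hs.prod ht)]
    refine Eq.trans ?_ (integral_conj (f := f)).symm
    refine Eq.trans ?_ (congrArg (starRingEnd ℂ) h).symm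
    rw [inner_tensorConj, hT]
    simp only [a, b, ContinuousLinearMap.adjoint_inner_right, ContinuousLinearMap.adjoint_inner_left,
      LinearIsometry.coe_toContinuousLinearMap, SpectralMeasure.isometry_indicator, map_mul,
      inner_conj_symm, map_smul, inner_smul_right]
    rw [← E₂.inner_apply_left ht, mul_comm]
  rw [inner_planeOperator E₁ E₂ hc, key, withDensityᵥ_apply hf hS]
  rw [show ∫ p in S, starRingEnd ℂ (f p) ∂(planeMeasure E₁ E₂ e g) = _ from
    integral_conj (f := f), RCLike.norm_conj]
  refine (norm_setIntegral_le_norm_mul_sqrt (μ := E₁.diag g) (ν := E₂.diag e) f hS).trans ?_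
  have hnorm : ‖f‖ = ‖a‖ * ‖b‖ := by
    have h := inner_tensorConj a a b b
    rw [inner_self_eq_norm_sq_to_K, inner_self_eq_norm_sq_to_K, inner_self_eq_norm_sq_to_K] at h
    have h' : ‖f‖ ^ 2 = (‖a‖ * ‖b‖) ^ 2 := by
      rw [mul_pow]; exact_mod_cast h
    exact (sq_eq_sq₀ (norm_nonneg _) (by positivity)).1 h'
  have ha : ‖a‖ ≤ ‖v‖ := by
    refine (ContinuousLinearMap.le_of_opNorm_le _ ?_ v).trans_eq (one_mul _)
    rw [LinearIsometryEquiv.norm_map]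
    exact (E₁.isometry g).norm_toContinuousLinearMap_le
  have hb : ‖b‖ ≤ ‖u‖ := by
    refine (ContinuousLinearMap.le_of_opNorm_le _ ?_ u).trans_eq (one_mul _)
    rw [LinearIsometryEquiv.norm_map]
    exact (E₂.isometry e).norm_toContinuousLinearMap_le
  change ‖f‖ * Real.sqrt ((planeMeasure E₁ E₂ e g).real S) ≤ _
  rw [hnorm, mul_comm, mul_assoc]
  exact mul_le_mul_of_nonneg_left (mul_le_mul ha hb (norm_nonneg _) (norm_nonneg _))
    (Real.sqrt_nonneg _)

theorem planeOperator_iUnion_sub_sum {T : H →L[ℂ] H} {c : ℝ} (hT : HSBound T c)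
    {S : ℕ → Set (ℝ × ℝ)} (hS : ∀ i, MeasurableSet (S i))
    (hd : Pairwise fun i j => Disjoint (S i) (S j)) (F : Finset ℕ) :
    planeOperator E₁ E₂ T (⋃ i, S i) - ∑ i ∈ F, planeOperator E₁ E₂ T (S i) =
      planeOperator E₁ E₂ T ((⋃ i, S i) \ ⋃ i ∈ F, S i) := by
  ext u
  refine ext_inner_left ℂ fun v => ?_
  have hm : MeasurableSet (⋃ i ∈ F, S i) := F.measurableSet_biUnion fun i _ => hS i
  have hsub : (⋃ i ∈ F, S i) ⊆ ⋃ i, S i := Set.iUnion₂_subset fun i _ => Set.subset_iUnion S i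
  rw [sub_apply, sum_apply, inner_sub_right, inner_sum]
  simp only [inner_planeOperator E₁ E₂ hT]
  rw [← VectorMeasure.of_biUnion_finset (fun i _ j _ hij => hd hij) fun i _ => hS i,
    sub_eq_iff_eq_add, add_comm, VectorMeasure.of_add_of_sdiff hm (MeasurableSet.iUnion hS) hsub]

/-- `M_T` is countably additive in norm. -/
def NormCountablyAdditive (T : H →L[ℂ] H) : Prop :=
  ∀ S : ℕ → Set (ℝ × ℝ), (∀ i, MeasurableSet (S i)) →
    Pairwise (fun i j => Disjoint (S i) (S j)) →
      HasSum (fun i => planeOperator E₁ E₂ T (S i)) (planeOperator E₁ E₂ T (⋃ i, S i))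

theorem normCountablyAdditive_rankOne {T : H →L[ℂ] H} {e g : H}
    (hT : ∀ x, T x = inner ℂ e x • g) : NormCountablyAdditive E₁ E₂ T := by
  intro S hS hd
  obtain ⟨c, hc⟩ := hsBound_rankOne hT
  have hm : HasSum (fun i => (planeMeasure E₁ E₂ e g).real (S i))
      ((planeMeasure E₁ E₂ e g).real (⋃ i, S i)) := by
    have h := measure_iUnion (μ := planeMeasure E₁ E₂ e g) hd hS
    have := ENNReal.summable_toReal (h ▸ measure_ne_top _ _)
    rw [Measure.real, h, ENNReal.tsum_toReal_eq fun i => measure_ne_top _ _]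
    exact this.hasSum
  have hlim : Filter.Tendsto (fun F : Finset ℕ => Real.sqrt
      ((planeMeasure E₁ E₂ e g).real ((⋃ i, S i) \ ⋃ i ∈ F, S i))) Filter.atTop (nhds 0) := by
    rw [← Real.sqrt_zero]
    refine (Real.continuous_sqrt.tendsto 0).comp ?_
    have h := (hm.const_sub ((planeMeasure E₁ E₂ e g).real (⋃ i, S i)))
    rw [sub_self] at h
    refine h.congr fun F => ?_
    rw [measureReal_sdiff (Set.iUnion₂_subset fun i _ => Set.subset_iUnion S i)
      (F.measurableSet_biUnion fun i _ => hS i),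
      measureReal_biUnion_finset (fun i _ j _ hij => hd hij) fun i _ => hS i]
  refine tendsto_iff_norm_sub_tendsto_zero.2 (squeeze_zero (fun _ => norm_nonneg _) (fun F => ?_)
    hlim)
  rw [norm_sub_rev, planeOperator_iUnion_sub_sum E₁ E₂ hc hS hd]
  exact norm_planeOperator_rankOne_le E₁ E₂ hT
    ((MeasurableSet.iUnion hS).diff (F.measurableSet_biUnion fun i _ => hS i))

theorem NormCountablyAdditive.add {T T' : H →L[ℂ] H} {c c' : ℝ} (hc : HSBound T c)
    (hc' : HSBound T' c') (h : NormCountablyAdditive E₁ E₂ T)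
    (h' : NormCountablyAdditive E₁ E₂ T') : NormCountablyAdditive E₁ E₂ (T + T') := by
  intro S hS hd
  simp only [planeOperator_add E₁ E₂ hc hc' (hc.add hc')]
  exact (h S hS hd).add (h' S hS hd)

theorem normCountablyAdditive_sum_rankOne {ι : Type*} (s : Finset ι) (R : ι → H →L[ℂ] H)
    (e g : ι → H) (hR : ∀ i x, R i x = inner ℂ (e i) x • g i) :
    (∃ c, HSBound (∑ i ∈ s, R i) c) ∧ NormCountablyAdditive E₁ E₂ (∑ i ∈ s, R i) := by
  classical
  induction s using Finset.induction_on with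
  | empty =>
    rw [Finset.sum_empty]
    refine ⟨⟨0, hsBound_zero⟩, ?_⟩
    exact normCountablyAdditive_rankOne E₁ E₂ (e := 0) (g := 0) (by simp)
  | insert a s ha ih =>
    rw [Finset.sum_insert ha]
    obtain ⟨c, hc⟩ := hsBound_rankOne (hR a)
    obtain ⟨⟨c', hc'⟩, h'⟩ := ih
    exact ⟨⟨_, hc.add hc'⟩, NormCountablyAdditive.add E₁ E₂ hc hc'
      (normCountablyAdditive_rankOne E₁ E₂ (hR a)) h'⟩

/-- Expanding in an orthonormal basis `b` of the range writes `K` as the sum of the rank one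
operators `⟨K* b_i, ·⟩ b_i`. -/
theorem normCountablyAdditive_of_rank_le {K : H →L[ℂ] H} {n : ℕ}
    (hK : LinearMap.rank (K : H →ₗ[ℂ] H) ≤ (n : Cardinal)) : NormCountablyAdditive E₁ E₂ K := by
  have hfin : FiniteDimensional ℂ (LinearMap.range (K : H →ₗ[ℂ] H)) :=
    Module.rank_lt_aleph0_iff.1 (lt_of_le_of_lt hK (Cardinal.natCast_lt_aleph0))
  let b := stdOrthonormalBasis ℂ (LinearMap.range (K : H →ₗ[ℂ] H))
  have hsum : K = ∑ i, (innerSL ℂ (ContinuousLinearMap.adjoint K (b i))).smulRight (b i : H) := by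
    ext x
    have h := b.sum_repr' ⟨K x, x, rfl⟩
    have h' := congrArg (Subtype.val) h
    rw [sum_apply]
    simp only [ContinuousLinearMap.smulRight_apply, innerSL_apply_apply,
      ContinuousLinearMap.adjoint_inner_left]
    simpa using h'.symm
  rw [hsum]
  exact (normCountablyAdditive_sum_rankOne E₁ E₂ _ _
    (fun i => ContinuousLinearMap.adjoint K (b i)) (fun i => (b i : H)) fun i x => rfl).2

/-- The plane operators of `T - K` are at most `ε` in norm on every set at once, in particular on
all the remainders of the union. -/
theorem NormCountablyAdditive.of_approx {T : H →L[ℂ] H} {c : ℝ} (hT : HSBound T c)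
    (h : ∀ ε > 0, ∃ K : H →L[ℂ] H, (∃ c, HSBound K c) ∧ NormCountablyAdditive E₁ E₂ K ∧
      HSBound (T - K) ε) : NormCountablyAdditive E₁ E₂ T := by
  intro S hS hd
  rw [HasSum, SummationFilter.unconditional_filter, Metric.tendsto_nhds]
  intro ε hε
  obtain ⟨K, ⟨c', hc'⟩, hK, hTK⟩ := h (ε / 2) (by positivity)
  have h1 := Metric.tendsto_nhds.1 (hK S hS hd) (ε / 2) (by positivity)
  filter_upwards [h1] with F hF
  rw [dist_comm, dist_eq_norm, planeOperator_iUnion_sub_sum E₁ E₂ hc' hS hd] at hF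
  rw [dist_comm, dist_eq_norm, planeOperator_iUnion_sub_sum E₁ E₂ hT hS hd]
  have hadd := planeOperator_add E₁ E₂ hTK hc' (by simpa using hT) ((⋃ i, S i) \ ⋃ i ∈ F, S i)
  rw [sub_add_cancel] at hadd
  rw [hadd]
  refine (norm_add_le _ _).trans_lt ?_
  have := norm_planeOperator_le E₁ E₂ hTK ((⋃ i, S i) \ ⋃ i ∈ F, S i)
  linarith

/-- A π-λ argument from rectangles, where the operator is `E₁ s * K * E₂ t`. The step for disjoint
unions relies on additivity in norm, since compact operators are closed under norm limits only. -/
theorem isCompactOperator_planeOperator {K : H →L[ℂ] H} {n : ℕ}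
    (hK : LinearMap.rank (K : H →ₗ[ℂ] H) ≤ (n : Cardinal)) {S : Set (ℝ × ℝ)}
    (hS : MeasurableSet S) : IsCompactOperator (planeOperator E₁ E₂ K S) := by
  have hc := hsBound_of_rank_le hK
  have hadd := normCountablyAdditive_of_rank_le E₁ E₂ hK
  have hrect : ∀ s t, MeasurableSet s → MeasurableSet t →
      IsCompactOperator (planeOperator E₁ E₂ K (s ×ˢ t)) := by
    intro s t hs ht
    rw [planeOperator_rectangle E₁ E₂ hc hs ht]
    exact ((isCompactOperator_of_rank_le hK).clm_comp (E₁ s)).comp_clm (E₂ t)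
  induction S, hS using MeasurableSpace.induction_on_inter (generateFrom_prod.symm)
    isPiSystem_prod with
  | empty => simpa using hrect ∅ ∅ .empty .empty
  | basic S hS =>
    obtain ⟨s, hs, t, ht, rfl⟩ := hS
    exact hrect s t hs ht
  | compl S hS ih =>
    have h : planeOperator E₁ E₂ K Sᶜ =
        planeOperator E₁ E₂ K (Set.univ ×ˢ Set.univ) - planeOperator E₁ E₂ K S := by
      ext u
      refine ext_inner_left ℂ fun v => ?_
      rw [sub_apply, inner_sub_right, inner_planeOperator E₁ E₂ hc, inner_planeOperator E₁ E₂ hc,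
        inner_planeOperator E₁ E₂ hc, Set.univ_prod_univ, eq_sub_iff_add_eq, add_comm,
        Set.compl_eq_univ_sdiff, VectorMeasure.of_add_of_sdiff hS .univ (Set.subset_univ S)]
    rw [h]
    exact (hrect _ _ .univ .univ).sub ih
  | iUnion f hd hf ih =>
    have h := hadd f hf hd
    refine isCompactOperator_of_tendsto h (Filter.Eventually.of_forall fun F => ?_)
    exact Submodule.sum_mem (compactOperator (RingHom.id ℂ) H H) fun i _ => ih i

end CountableAdditivity
-- Finite rank approximation in Hilbert–Schmidt norm
section HilbertSchmidtApproximation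

variable {H : Type u} [NormedAddCommGroup H] [InnerProductSpace ℂ H]

theorem HSBound.mono {T : H →L[ℂ] H} {c c' : ℝ} (hT : HSBound T c) (h : c ≤ c') :
    HSBound T c' :=
  ⟨hT.1.trans h, fun n e he => (hT.2 n e he).trans (pow_le_pow_left₀ hT.1 h 2)⟩

/-- At least half of the indices below `n` are `≥ n / 2`, and there the singular numbers are at
least `s_n`. So `n s_n² → 0`. -/
theorem nat_mul_singularNumber_sq_le {T : H →L[ℂ] H} (hT : T ∈ hilbertSchmidtClass H) (n : ℕ) :
    (n : ℝ) * singularNumber T n ^ 2 ≤ 2 * ∑' j, singularNumber T (j + n / 2) ^ 2 := by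
  have hs : Summable fun j => singularNumber T (j + n / 2) ^ 2 :=
    (summable_nat_add_iff (f := fun j => singularNumber T j ^ 2) (n / 2)).2 hT
  have h1 : ((n - n / 2 : ℕ) : ℝ) * singularNumber T n ^ 2 ≤
      ∑ j ∈ Finset.range (n - n / 2), singularNumber T (j + n / 2) ^ 2 := by
    rw [← nsmul_eq_mul, ← Finset.card_range (n - n / 2), ← Finset.sum_const]
    rw [Finset.card_range]
    refine Finset.sum_le_sum fun j hj => pow_le_pow_left₀ (singularNumber_nonneg _ _) ?_ 2
    have := Finset.mem_range.1 hj
    exact singularNumber_antitone T (by omega)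
  have h2 : (n : ℝ) ≤ 2 * ((n - n / 2 : ℕ) : ℝ) := by
    have : n ≤ 2 * (n - n / 2) := by omega
    exact_mod_cast this
  have h3 := hs.sum_le_tsum (Finset.range (n - n / 2)) fun _ _ => by positivity
  nlinarith [sq_nonneg (singularNumber T n)]

/-- Nearly best approximation in operator norm already converges in Hilbert–Schmidt norm. The slack
`d / n` is allowed because the infimum defining `s_n` need not be attained; it contributes `n (d /
n)² → 0`. -/
theorem exists_hsBound_sub_tendsto {T : H →L[ℂ] H} (hT : T ∈ hilbertSchmidtClass H) (d : ℝ) :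
    ∃ ε : ℕ → ℝ, Filter.Tendsto ε Filter.atTop (nhds 0) ∧
      ∀ n : ℕ, 0 < n → ∀ K : H →L[ℂ] H, LinearMap.rank (K : H →ₗ[ℂ] H) ≤ (n : Cardinal) →
        ‖T - K‖ ≤ singularNumber T n + d / n → HSBound (T - K) (ε n) := by
  have htail := tendsto_sum_nat_add fun j => singularNumber T j ^ 2
  have hhalf : Filter.Tendsto (fun n : ℕ => n / 2) Filter.atTop Filter.atTop :=
    Nat.tendsto_div_const_atTop two_ne_zero
  refine ⟨fun n => Real.sqrt (8 * (∑' j, singularNumber T (j + n / 2) ^ 2) + 4 * (d ^ 2 / n) +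
    ∑' j, singularNumber T (j + n) ^ 2), ?_, fun n hn K hK hTK => ?_⟩
  · have h := (((htail.comp hhalf).const_mul 8).add
      ((tendsto_const_div_atTop_nhds_zero_nat (d ^ 2)).const_mul 4)).add htail
    simp only [mul_zero, add_zero, Function.comp_apply] at h
    rw [← Real.sqrt_zero]
    exact (Real.continuous_sqrt.tendsto 0).comp h
  · refine (hsBound_sub_of_rank_le hT hK).mono (Real.sqrt_le_sqrt (add_le_add_left ?_ _))
    have hn' : (0 : ℝ) < n := Nat.cast_pos.2 hn
    have h1 := nat_mul_singularNumber_sq_le hT n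
    have h2 : ‖T - K‖ ^ 2 ≤ 2 * (singularNumber T n ^ 2 + (d / n) ^ 2) := by
      have := pow_le_pow_left₀ (norm_nonneg _) hTK 2
      nlinarith [sq_nonneg (singularNumber T n - d / n)]
    have h3 : (n : ℝ) * (d / n) ^ 2 = d ^ 2 / n := by field_simp
    have h4 := mul_le_mul_of_nonneg_left h2 (by positivity : (0 : ℝ) ≤ 2 * n)
    nlinarith

end HilbertSchmidtApproximation

/-! ### Uniform approximation by simple functions -/

section UniformApproximation

theorem exists_simpleFunc_norm_sub_le {X : Type*} [MeasurableSpace X] {Φ : X → ℂ}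
    (hΦ : Measurable Φ) {B : ℝ} (hB : ∀ x, ‖Φ x‖ ≤ B) {ε : ℝ} (hε : 0 < ε) :
    ∃ φ : SimpleFunc X ℂ, ∀ x, ‖φ x - Φ x‖ ≤ ε := by
  have htot : TotallyBounded (Metric.closedBall (0 : ℂ) B) :=
    (isCompact_closedBall 0 B).totallyBounded
  obtain ⟨s, hs, hcov⟩ := Metric.totallyBounded_iff.1 htot ε hε
  rcases s.eq_empty_or_nonempty with rfl | hne
  · refine ⟨0, fun x => ?_⟩
    have := hcov (mem_closedBall_zero_iff.2 (hB x))
    simp at this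
  obtain ⟨e, he⟩ := hs.countable.exists_eq_range hne
  subst he
  -- The finite net is enumerated by a sequence with repetitions; an initial segment already
  -- contains every point of it.
  obtain ⟨N, hN⟩ : ∃ N, ∀ k, ∃ i ≤ N, e i = e k := by
    choose g hg using fun y : Set.range e => y.2
    have := hs.fintype
    refine ⟨Finset.univ.sup g, fun k => ⟨g ⟨e k, k, rfl⟩, Finset.le_sup (Finset.mem_univ _), hg _⟩⟩
  refine ⟨(SimpleFunc.nearestPt e N).comp Φ hΦ, fun x => ?_⟩
  have hx := hcov (mem_closedBall_zero_iff.2 (hB x))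
  simp only [Set.mem_iUnion, Set.mem_range, exists_prop, exists_exists_eq_and, Metric.mem_ball] at hx
  obtain ⟨k, hk⟩ := hx
  obtain ⟨i, hi, hik⟩ := hN k
  have h := SimpleFunc.edist_nearestPt_le e (Φ x) hi
  rw [edist_dist, edist_dist, ENNReal.ofReal_le_ofReal_iff dist_nonneg] at h
  rw [SimpleFunc.coe_comp, Function.comp_apply, ← dist_eq_norm]
  refine h.trans ?_
  rw [hik, dist_comm]
  exact hk.le

end UniformApproximation

/-! ### Integration against the plane measure -/

section Integration

variable {H : Type u} [NormedAddCommGroup H] [InnerProductSpace ℂ H] [CompleteSpace H]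
  (E₁ E₂ : SpectralMeasure ℝ H)

theorem norm_integral_mul_Lp_le {X : Type*} [MeasurableSpace X] {m : Measure X} {Φ : X → ℂ}
    (hΦ : MemLp Φ 2 m) (k : Lp ℂ 2 m) :
    ‖∫ p, Φ p * k p ∂m‖ ≤ ‖k‖ * Real.sqrt (∫ p, ‖Φ p‖ ^ 2 ∂m) := by
  have hΦ' : MemLp (fun p => starRingEnd ℂ (Φ p)) 2 m := hΦ.star
  have h := norm_inner_le_norm (𝕜 := ℂ) (hΦ'.toLp _) k
  have h1 : inner ℂ (hΦ'.toLp _) k = ∫ p, Φ p * k p ∂m := by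
    rw [L2.inner_def]
    refine integral_congr_ae ?_
    filter_upwards [hΦ'.coeFn_toLp] with p hp
    rw [hp, RCLike.inner_apply, RCLike.conj_conj, mul_comm]
  have h2 : ‖hΦ'.toLp _‖ = Real.sqrt (∫ p, ‖Φ p‖ ^ 2 ∂m) := by
    rw [eq_comm, Real.sqrt_eq_iff_mul_self_eq (integral_nonneg fun _ => by positivity)
      (norm_nonneg _), ← sq]
    have h3 := inner_self_eq_norm_sq_to_K (𝕜 := ℂ) (hΦ'.toLp _)
    rw [L2.inner_def] at h3
    have h4 : ∫ p, inner ℂ (hΦ'.toLp _ p) (hΦ'.toLp _ p) ∂m = ((∫ p, ‖Φ p‖ ^ 2 ∂m : ℝ) : ℂ) := by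
      rw [← integral_complex_ofReal]
      refine integral_congr_ae ?_
      filter_upwards [hΦ'.coeFn_toLp] with p hp
      rw [hp, inner_self_eq_norm_sq_to_K, RCLike.norm_conj]
      simp
    rw [h4] at h3
    refine Complex.ofReal_injective ?_
    rw [h3]
    norm_cast
  rw [← h1, ← h2, mul_comm]
  exact h

theorem memLp_of_bound {X : Type*} [MeasurableSpace X] {m : Measure X} [IsFiniteMeasure m]
    {Φ : X → ℂ} (hΦ : Measurable Φ) {B : ℝ} (hB : ∀ x, ‖Φ x‖ ≤ B) : MemLp Φ 2 m :=
  MemLp.of_bound hΦ.aestronglyMeasurable B (Filter.Eventually.of_forall hB)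

theorem integrable_mul_kernel {Φ : ℝ × ℝ → ℂ} (hΦ : Measurable Φ) {B : ℝ} (hB : ∀ x, ‖Φ x‖ ≤ B)
    {u v : H} (k : Lp ℂ 2 (planeMeasure E₁ E₂ u v)) :
    Integrable (fun p => Φ p * k p) (planeMeasure E₁ E₂ u v) :=
  (integrable_Lp_two E₁ E₂ u v k).bdd_mul hΦ.aestronglyMeasurable (Filter.Eventually.of_forall hB)

/-- The integral of `Φ` against the scalar measure of `T` at `u`, `v`. -/
noncomputable def doubleForm (T : H →L[ℂ] H) (Φ : ℝ × ℝ → ℂ) (u v : H) : ℂ :=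
  ∫ p, Φ p * operatorKernel E₁ E₂ T u v p ∂(planeMeasure E₁ E₂ u v)

theorem norm_doubleForm_le_sqrt {T : H →L[ℂ] H} {c : ℝ} (hT : HSBound T c) {Φ : ℝ × ℝ → ℂ}
    (u v : H) (hΦ : MemLp Φ 2 (planeMeasure E₁ E₂ u v)) :
    ‖doubleForm E₁ E₂ T Φ u v‖ ≤
      c * Real.sqrt (∫ p, ‖Φ p‖ ^ 2 ∂(planeMeasure E₁ E₂ u v)) :=
  (norm_integral_mul_Lp_le hΦ _).trans
    (mul_le_mul_of_nonneg_right (norm_operatorKernel_le E₁ E₂ hT u v) (Real.sqrt_nonneg _))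

theorem norm_doubleForm_le {T : H →L[ℂ] H} {c : ℝ} (hT : HSBound T c) {Φ : ℝ × ℝ → ℂ}
    (hΦ : Measurable Φ) {B : ℝ} (hB0 : 0 ≤ B) (hB : ∀ x, ‖Φ x‖ ≤ B) (u v : H) :
    ‖doubleForm E₁ E₂ T Φ u v‖ ≤ c * B * ‖v‖ * ‖u‖ := by
  refine (norm_doubleForm_le_sqrt E₁ E₂ hT u v (memLp_of_bound hΦ hB)).trans ?_
  rw [mul_assoc, mul_assoc]
  refine mul_le_mul_of_nonneg_left ?_ hT.1
  refine Real.sqrt_le_iff.2 ⟨by positivity, ?_⟩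
  calc ∫ p, ‖Φ p‖ ^ 2 ∂(planeMeasure E₁ E₂ u v)
      ≤ ∫ _, B ^ 2 ∂(planeMeasure E₁ E₂ u v) := by
        refine integral_mono_of_nonneg (Filter.Eventually.of_forall fun _ => by positivity)
          (integrable_const _) (Filter.Eventually.of_forall fun p => ?_)
        exact pow_le_pow_left₀ (norm_nonneg _) (hB p) 2
    _ = (B * (‖v‖ * ‖u‖)) ^ 2 := by
        rw [integral_const, planeMeasure_real_univ, smul_eq_mul]; ring

theorem doubleForm_add {T : H →L[ℂ] H} {Φ Ψ : ℝ × ℝ → ℂ} (hΦ : Measurable Φ)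
    {B B' : ℝ} (hB : ∀ x, ‖Φ x‖ ≤ B) (hΨ : Measurable Ψ) (hB' : ∀ x, ‖Ψ x‖ ≤ B') (u v : H) :
    doubleForm E₁ E₂ T (Φ + Ψ) u v = doubleForm E₁ E₂ T Φ u v + doubleForm E₁ E₂ T Ψ u v := by
  rw [doubleForm, doubleForm, doubleForm, ← integral_add (integrable_mul_kernel E₁ E₂ hΦ hB _)
    (integrable_mul_kernel E₁ E₂ hΨ hB' _)]
  simp [add_mul]

theorem doubleForm_sub {T : H →L[ℂ] H} {Φ Ψ : ℝ × ℝ → ℂ} (hΦ : Measurable Φ)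
    {B B' : ℝ} (hB : ∀ x, ‖Φ x‖ ≤ B) (hΨ : Measurable Ψ) (hB' : ∀ x, ‖Ψ x‖ ≤ B') (u v : H) :
    doubleForm E₁ E₂ T (Φ - Ψ) u v = doubleForm E₁ E₂ T Φ u v - doubleForm E₁ E₂ T Ψ u v := by
  rw [doubleForm, doubleForm, doubleForm, ← integral_sub (integrable_mul_kernel E₁ E₂ hΦ hB _)
    (integrable_mul_kernel E₁ E₂ hΨ hB' _)]
  simp [sub_mul]

theorem exists_norm_le_simpleFunc {X : Type*} [MeasurableSpace X] (φ : SimpleFunc X ℂ) :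
    ∃ B, 0 ≤ B ∧ ∀ x, ‖φ x‖ ≤ B := by
  obtain ⟨B, hB⟩ := φ.exists_forall_norm_le
  exact ⟨max B 0, le_max_right _ _, fun x => (hB x).trans (le_max_left _ _)⟩

theorem exists_operator_simpleFunc {T : H →L[ℂ] H} {c : ℝ} (hT : HSBound T c)
    (φ : SimpleFunc (ℝ × ℝ) ℂ) :
    ∃ Q : H →L[ℂ] H, (∀ u v, inner ℂ v (Q u) = doubleForm E₁ E₂ T φ u v) ∧
      ((∀ S, MeasurableSet S → IsCompactOperator (planeOperator E₁ E₂ T S)) →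
        IsCompactOperator Q) := by
  induction φ using SimpleFunc.induction with
  | const a hS =>
    rename_i S
    refine ⟨a • planeOperator E₁ E₂ T S, fun u v => ?_, fun h => (h S hS).smul a⟩
    rw [smul_apply, inner_smul_right, inner_planeOperator E₁ E₂ hT, kernelMeasure_apply _ _ _ _ _ hS,
      doubleForm, ← integral_const_mul, ← integral_indicator hS]
    refine integral_congr_ae (Filter.Eventually.of_forall fun p => ?_)
    by_cases hp : p ∈ S <;> simp [hp]
  | add _ h h' =>
    rename_i f g _
    obtain ⟨Q, hQ, hQc⟩ := h
    obtain ⟨Q', hQ', hQc'⟩ := h'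
    obtain ⟨B, -, hB⟩ := exists_norm_le_simpleFunc f
    obtain ⟨B', -, hB'⟩ := exists_norm_le_simpleFunc g
    refine ⟨Q + Q', fun u v => ?_, fun h => (hQc h).add (hQc' h)⟩
    rw [add_apply, inner_add_right, hQ, hQ', SimpleFunc.coe_add,
      doubleForm_add E₁ E₂ f.measurable hB g.measurable hB']

theorem norm_le_of_doubleForm {T Q : H →L[ℂ] H} {c : ℝ} (hT : HSBound T c) {Φ : ℝ × ℝ → ℂ}
    (hΦ : Measurable Φ) {B : ℝ} (hB0 : 0 ≤ B) (hB : ∀ x, ‖Φ x‖ ≤ B)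
    (hQ : ∀ u v, inner ℂ v (Q u) = doubleForm E₁ E₂ T Φ u v) : ‖Q‖ ≤ c * B :=
  opNorm_le_of_inner (mul_nonneg hT.1 hB0) fun u v => by
    rw [hQ]; exact norm_doubleForm_le E₁ E₂ hT hΦ hB0 hB u v

/-- Uniform simple approximations of `Φ` give operators that are Cauchy in operator norm, and norm
convergence carries compactness over to the limit. -/
theorem exists_operator_doubleForm {T : H →L[ℂ] H} {c : ℝ} (hT : HSBound T c) {Φ : ℝ × ℝ → ℂ}
    (hΦ : Measurable Φ) {B : ℝ} (hB : ∀ x, ‖Φ x‖ ≤ B) :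
    ∃ Q : H →L[ℂ] H, (∀ u v, inner ℂ v (Q u) = doubleForm E₁ E₂ T Φ u v) ∧
      ((∀ S, MeasurableSet S → IsCompactOperator (planeOperator E₁ E₂ T S)) →
        IsCompactOperator Q) := by
  choose φ hφ using fun n : ℕ => exists_simpleFunc_norm_sub_le hΦ hB
    (ε := 1 / ((n : ℝ) + 1)) (by positivity)
  choose Q hQ hQc using fun n => exists_operator_simpleFunc E₁ E₂ hT (φ n)
  choose B' _ hB' using fun n => exists_norm_le_simpleFunc (φ n)
  have hlim : Filter.Tendsto (fun n : ℕ => c * (2 * (1 / ((n : ℝ) + 1)))) Filter.atTop (nhds 0) := by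
    have := ((tendsto_one_div_add_atTop_nhds_zero_nat (𝕜 := ℝ)).const_mul 2).const_mul c
    simpa using this
  have hcauchy : CauchySeq Q := by
    refine cauchySeq_of_le_tendsto_0 _ (fun n m N hn hm => ?_) hlim
    rw [dist_eq_norm]
    refine norm_le_of_doubleForm E₁ E₂ hT (Φ := ⇑(φ n) - ⇑(φ m))
      ((φ n).measurable.sub (φ m).measurable) (by positivity) (fun p => ?_) fun u v => ?_
    · have h1 := hφ n p
      have h2 := hφ m p
      have h3 : 1 / ((n : ℝ) + 1) ≤ 1 / ((N : ℝ) + 1) := by gcongr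
      have h4 : 1 / ((m : ℝ) + 1) ≤ 1 / ((N : ℝ) + 1) := by gcongr
      have h5 := norm_sub_le (φ n p - Φ p) (φ m p - Φ p)
      rw [sub_sub_sub_cancel_right] at h5
      rw [Pi.sub_apply]
      linarith
    · rw [sub_apply, inner_sub_right, hQ, hQ, doubleForm_sub E₁ E₂ (φ n).measurable (hB' n)
        (φ m).measurable (hB' m)]
  obtain ⟨Q₀, hQ₀⟩ := cauchySeq_tendsto_of_complete hcauchy
  refine ⟨Q₀, fun u v => ?_, fun h => isCompactOperator_of_tendsto hQ₀
    (Filter.Eventually.of_forall fun n => hQc n h)⟩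
  have h1 : Filter.Tendsto (fun n => inner ℂ v (Q n u)) Filter.atTop (nhds (inner ℂ v (Q₀ u))) :=
    ((innerSL ℂ v).continuous.tendsto _).comp
      (((ContinuousLinearMap.apply ℂ H u).continuous.tendsto Q₀).comp hQ₀)
  refine tendsto_nhds_unique h1 (tendsto_iff_norm_sub_tendsto_zero.2 ?_)
  have hlim' : Filter.Tendsto (fun n : ℕ => c * (1 / ((n : ℝ) + 1)) * ‖v‖ * ‖u‖)
      Filter.atTop (nhds 0) := by
    have := (((tendsto_one_div_add_atTop_nhds_zero_nat (𝕜 := ℝ)).const_mul c).mul_const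
      ‖v‖).mul_const ‖u‖
    simpa using this
  refine squeeze_zero (fun _ => norm_nonneg _) (fun n => ?_) hlim'
  rw [hQ, ← doubleForm_sub E₁ E₂ (φ n).measurable (hB' n) hΦ hB]
  exact norm_doubleForm_le E₁ E₂ hT ((φ n).measurable.sub hΦ) (by positivity) (hφ n) u v

theorem kernelMeasure_variation_univ_ne_top (T : H →L[ℂ] H) (u v : H) :
    IsFiniteMeasure (kernelMeasure E₁ E₂ T u v).variation := by
  have h := integrable_Lp_two E₁ E₂ u v (operatorKernel E₁ E₂ T u v)
  rw [kernelMeasure, Measure.variation_withDensityᵥ h]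
  exact isFiniteMeasure_withDensity (by simpa [HasFiniteIntegral] using h.2.ne)

theorem integrable_kernelMeasure (T : H →L[ℂ] H) (u v : H) {Φ : ℝ × ℝ → ℂ}
    (hΦ : Measurable Φ) {B : ℝ} (hB : ∀ x, ‖Φ x‖ ≤ B) :
    (kernelMeasure E₁ E₂ T u v).Integrable Φ := by
  have := kernelMeasure_variation_univ_ne_top E₁ E₂ T u v
  exact Integrable.of_bound hΦ.aestronglyMeasurable B (Filter.Eventually.of_forall hB)

theorem integral_kernelMeasure_simpleFunc (T : H →L[ℂ] H) (u v : H) (φ : SimpleFunc (ℝ × ℝ) ℂ) :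
    (kernelMeasure E₁ E₂ T u v).integral φ (ContinuousLinearMap.mul ℝ ℂ) =
      doubleForm E₁ E₂ T φ u v := by
  have := kernelMeasure_variation_univ_ne_top E₁ E₂ T u v
  induction φ using SimpleFunc.induction with
  | const a hS =>
    rename_i S
    have hcoe : ⇑(SimpleFunc.piecewise S hS (SimpleFunc.const (ℝ × ℝ) a)
        (SimpleFunc.const (ℝ × ℝ) 0)) = S.indicator fun _ => a := by
      ext p
      by_cases hp : p ∈ S <;> simp [hp]
    rw [hcoe, VectorMeasure.integral_eq_setToFun, setToFun_indicator_const _ hS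
      (measure_ne_top _ _), doubleForm]
    change a * kernelMeasure E₁ E₂ T u v S = _
    rw [kernelMeasure_apply _ _ _ _ _ hS, ← integral_const_mul, ← integral_indicator hS]
    refine integral_congr_ae (Filter.Eventually.of_forall fun p => ?_)
    by_cases hp : p ∈ S <;> simp [hp]
  | add _ h h' =>
    rename_i f g _
    obtain ⟨B, -, hB⟩ := exists_norm_le_simpleFunc f
    obtain ⟨B', -, hB'⟩ := exists_norm_le_simpleFunc g
    rw [SimpleFunc.coe_add, VectorMeasure.integral_add
      (integrable_kernelMeasure E₁ E₂ T u v f.measurable hB)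
      (integrable_kernelMeasure E₁ E₂ T u v g.measurable hB'), h, h',
      doubleForm_add E₁ E₂ f.measurable hB g.measurable hB']

/-- Both sides are continuous under uniform convergence of `Φ` and agree on simple functions. -/
theorem integral_kernelMeasure {T : H →L[ℂ] H} {c : ℝ} (hT : HSBound T c) (u v : H)
    {Φ : ℝ × ℝ → ℂ} (hΦ : Measurable Φ) {B : ℝ} (hB : ∀ x, ‖Φ x‖ ≤ B) :
    (kernelMeasure E₁ E₂ T u v).integral Φ (ContinuousLinearMap.mul ℝ ℂ) =
      doubleForm E₁ E₂ T Φ u v := by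
  have := kernelMeasure_variation_univ_ne_top E₁ E₂ T u v
  choose φ hφ using fun n : ℕ => exists_simpleFunc_norm_sub_le hΦ hB
    (ε := 1 / ((n : ℝ) + 1)) (by positivity)
  choose B' _ hB' using fun n => exists_norm_le_simpleFunc (φ n)
  have h0 := tendsto_one_div_add_atTop_nhds_zero_nat (𝕜 := ℝ)
  have h1 : Filter.Tendsto (fun n => (kernelMeasure E₁ E₂ T u v).integral (φ n)
      (ContinuousLinearMap.mul ℝ ℂ)) Filter.atTop
      (nhds ((kernelMeasure E₁ E₂ T u v).integral Φ (ContinuousLinearMap.mul ℝ ℂ))) := by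
    refine tendsto_iff_norm_sub_tendsto_zero.2 (squeeze_zero (fun _ => norm_nonneg _)
      (g := fun n : ℕ => 1 / ((n : ℝ) + 1) * ‖ContinuousLinearMap.mul ℝ ℂ‖ *
        (kernelMeasure E₁ E₂ T u v).variation.real Set.univ) (fun n => ?_) ?_)
    · rw [← VectorMeasure.integral_sub
        (integrable_kernelMeasure E₁ E₂ T u v (φ n).measurable (hB' n))
        (integrable_kernelMeasure E₁ E₂ T u v hΦ hB)]
      exact VectorMeasure.norm_integral_le_of_norm_le_const
        (Filter.Eventually.of_forall (hφ n))
    · simpa using (h0.mul_const ‖ContinuousLinearMap.mul ℝ ℂ‖).mul_const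
        ((kernelMeasure E₁ E₂ T u v).variation.real Set.univ)
  have h2 : Filter.Tendsto (fun n => doubleForm E₁ E₂ T (φ n) u v) Filter.atTop
      (nhds (doubleForm E₁ E₂ T Φ u v)) := by
    refine tendsto_iff_norm_sub_tendsto_zero.2 (squeeze_zero (fun _ => norm_nonneg _)
      (g := fun n : ℕ => c * (1 / ((n : ℝ) + 1)) * ‖v‖ * ‖u‖) (fun n => ?_) ?_)
    · rw [← doubleForm_sub E₁ E₂ (φ n).measurable (hB' n) hΦ hB]
      exact norm_doubleForm_le E₁ E₂ hT ((φ n).measurable.sub hΦ) (by positivity) (hφ n) u v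
    · simpa using ((h0.const_mul c).mul_const ‖v‖).mul_const ‖u‖
  simp only [integral_kernelMeasure_simpleFunc] at h1
  exact tendsto_nhds_unique h1 h2

open Classical in
/-- The operator valued measure `M` with `M(s × t) = E₁(s) T E₂(t)`. -/
noncomputable def planeVectorMeasure {T : H →L[ℂ] H} (h : NormCountablyAdditive E₁ E₂ T)
    {c : ℝ} (hT : HSBound T c) : VectorMeasure (ℝ × ℝ) (H →L[ℂ] H) where
  measureOf' S := planeOperator E₁ E₂ T S
  empty' := by
    have h := planeOperator_rectangle E₁ E₂ hT (s := ∅) (t := ∅) .empty .empty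
    rw [Set.prod_empty] at h
    rw [h, SpectralMeasure.apply_empty, SpectralMeasure.apply_empty, mul_zero]
  not_measurable' S hS := by
    ext u
    refine ext_inner_left ℂ fun v => ?_
    rw [inner_planeOperator E₁ E₂ hT, VectorMeasure.not_measurable _ hS]
    simp
  m_iUnion' S hS hd := h S hS hd

theorem isDoubleOperatorIntegral_of_doubleForm {T Q : H →L[ℂ] H} {c : ℝ} (hT : HSBound T c)
    (h : NormCountablyAdditive E₁ E₂ T) {Φ : ℝ × ℝ → ℂ} (hΦ : Measurable Φ) {B : ℝ}
    (hB : ∀ x, ‖Φ x‖ ≤ B) (hQ : ∀ u v, inner ℂ v (Q u) = doubleForm E₁ E₂ T Φ u v) :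
    IsDoubleOperatorIntegral E₁ E₂ Φ T Q := by
  refine ⟨planeVectorMeasure E₁ E₂ h hT,
    fun s t hs ht => planeOperator_rectangle E₁ E₂ hT hs ht, fun u v => ?_⟩
  have hscalar : scalarMeasure (planeVectorMeasure E₁ E₂ h hT) u v = kernelMeasure E₁ E₂ T u v := by
    ext S
    exact inner_planeOperator E₁ E₂ hT S u v
  rw [hscalar]
  exact ⟨integrable_kernelMeasure E₁ E₂ T u v hΦ hB, by
    rw [hQ, integral_kernelMeasure E₁ E₂ hT u v hΦ hB]⟩

theorem normCountablyAdditive_of_mem_hilbertSchmidtClass {T : H →L[ℂ] H}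
    (hT : T ∈ hilbertSchmidtClass H) : NormCountablyAdditive E₁ E₂ T := by
  refine NormCountablyAdditive.of_approx E₁ E₂ (hsBound_of_mem_hilbertSchmidtClass hT)
    fun ε hε => ?_
  obtain ⟨δ, hδ, h⟩ := exists_hsBound_sub_tendsto hT 1
  obtain ⟨n, hn, hnpos⟩ := ((hδ.eventually_lt_const hε).and (Filter.eventually_gt_atTop 0)).exists
  obtain ⟨K, hK, hTK⟩ := exists_rank_le_norm_sub_le T n (δ := 1 / n)
    (by have : (0 : ℝ) < n := Nat.cast_pos.2 hnpos
        positivity)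
  exact ⟨K, ⟨_, hsBound_of_rank_le hK⟩, normCountablyAdditive_of_rank_le E₁ E₂ hK,
    (h n hnpos K hK hTK).mono hn.le⟩

end Integration
-- Quantiles and cut points
section Quantiles

/-- The point is the infimum of those where the distribution function reaches `a`; continuity of `m`
from below gives the bound on `Iio`, continuity from above the one on `Iic`. -/
theorem exists_quantile (m : Measure ℝ) [IsFiniteMeasure m] {a : ℝ} (ha : 0 < a)
    (ha' : a < m.real Set.univ) : ∃ t, m.real (Set.Iio t) ≤ a ∧ a ≤ m.real (Set.Iic t) := by
  let S := {s | a ≤ m.real (Set.Iic s)}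
  have hmono : ∀ {s t}, s ≤ t → m.real (Set.Iic s) ≤ m.real (Set.Iic t) :=
    fun h => measureReal_mono (Set.Iic_subset_Iic.2 h)
  have htop : Filter.Tendsto (fun s => m.real (Set.Iic s)) Filter.atTop (nhds (m.real Set.univ)) :=
    (ENNReal.tendsto_toReal (measure_ne_top _ _)).comp (tendsto_measure_Iic_atTop m)
  have hbot : ∃ s, m.real (Set.Iic s) < a := by
    have h : Filter.Tendsto (fun s => m.real (Set.Ici s)) Filter.atBot (nhds (m.real Set.univ)) :=
      (ENNReal.tendsto_toReal (measure_ne_top _ _)).comp (tendsto_measure_Ici_atBot m)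
    obtain ⟨s, hs⟩ := (h.eventually_const_lt (sub_lt_self _ ha)).exists
    have h1 : m.real (Set.Iio s) = m.real Set.univ - m.real (Set.Ici s) := by
      rw [← Set.compl_Ici, measureReal_compl measurableSet_Ici]
    have h2 : m.real (Set.Iic (s - 1)) ≤ m.real (Set.Iio s) :=
      measureReal_mono (Set.Iic_subset_Iio.2 (by linarith))
    exact ⟨s - 1, by linarith⟩
  have hne : S.Nonempty := by
    obtain ⟨s, hs⟩ := (htop.eventually_const_lt ha').exists
    exact ⟨s, hs.le⟩
  have hbdd : BddBelow S := by
    obtain ⟨s, hs⟩ := hbot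
    refine ⟨s, fun r hr => le_of_not_gt fun hrs => ?_⟩
    exact absurd (hr.trans (hmono hrs.le)) (not_le.2 hs)
  obtain ⟨w, hw, hwlim⟩ := exists_seq_strictAnti_tendsto (sInf S)
  obtain ⟨z, hz, hzlt, hzlim⟩ := exists_seq_strictMono_tendsto (sInf S)
  refine ⟨sInf S, ?_, ?_⟩
  · have hU : Set.Iio (sInf S) = ⋃ n, Set.Iic (z n) := by
      ext x
      simp only [Set.mem_Iio, Set.mem_iUnion, Set.mem_Iic]
      constructor
      · intro hx
        obtain ⟨n, hn⟩ := (hzlim.eventually_const_lt hx).exists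
        exact ⟨n, hn.le⟩
      · rintro ⟨n, hn⟩
        exact hn.trans_lt (hzlt n)
    have h := tendsto_measure_iUnion_atTop (μ := m) (s := fun n => Set.Iic (z n))
      fun i j hij => Set.Iic_subset_Iic.2 (hz.monotone hij)
    rw [← hU] at h
    refine le_of_tendsto ((ENNReal.tendsto_toReal (measure_ne_top _ _)).comp h)
      (Filter.Eventually.of_forall fun n => ?_)
    exact (not_le.1 fun hle => absurd (csInf_le hbdd hle) (not_le.2 (hzlt n))).le
  · have hI : Set.Iic (sInf S) = ⋂ n, Set.Iic (w n) := by
      ext x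
      simp only [Set.mem_Iic, Set.mem_iInter]
      exact ⟨fun hx n => hx.trans (hwlim.1 n).le, fun hx => ge_of_tendsto' hwlim.2 hx⟩
    have h := tendsto_measure_iInter_atTop (μ := m) (s := fun n => Set.Iic (w n))
      (fun n => measurableSet_Iic.nullMeasurableSet)
      (fun i j hij => Set.Iic_subset_Iic.2 (hw.antitone hij)) ⟨0, measure_ne_top _ _⟩
    rw [← hI] at h
    refine ge_of_tendsto ((ENNReal.tendsto_toReal (measure_ne_top _ _)).comp h)
      (Filter.Eventually.of_forall fun n => ?_)
    obtain ⟨s, hs, hsn⟩ := exists_lt_of_csInf_lt hne (hwlim.1 n)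
    exact hs.trans (hmono hsn.le)

/-- A finite measure on the line can be cut at `N + 1` points so that the open gaps are light. -/
theorem exists_cut_points (m : Measure ℝ) [IsFiniteMeasure m] (hm : 0 < m.real Set.univ) {N : ℕ}
    (hN : 0 < N) : ∃ t : ℕ → ℝ, Monotone t ∧
      (∀ i, m.real (Set.Ioo (t i) (t (i + 1))) ≤ m.real Set.univ / N) ∧
      m.real (Set.Iio (t 0)) ≤ m.real Set.univ / N ∧
      m.real (Set.Ioi (t N)) ≤ m.real Set.univ / N := by
  set M := m.real Set.univ
  have hN' : (0 : ℝ) < N := Nat.cast_pos.2 hN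
  -- Cuts are made at the levels `k M / (N + 1)` with `1 ≤ k ≤ N`, all strictly inside `(0, M)`, so
  -- both tails are light too. The sequence is constant from index `N - 1` on. A heavy atom can only
  -- sit at a cut point, which the open gaps avoid.
  let c : ℕ → ℕ := fun i => min (i + 1) N
  have hc1 : ∀ i, 1 ≤ c i := fun i => le_min (by omega) hN
  have hcN : ∀ i, c i ≤ N := fun i => min_le_right _ _
  have hq : ∀ k : ℕ, ∃ x, 1 ≤ k → k ≤ N → m.real (Set.Iio x) ≤ k * (M / (N + 1)) ∧
      k * (M / (N + 1)) ≤ m.real (Set.Iic x) := by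
    intro k
    by_cases hk : 1 ≤ k ∧ k ≤ N
    · obtain ⟨x, hx⟩ := exists_quantile m (a := k * (M / (N + 1)))
        (mul_pos (Nat.cast_pos.2 hk.1) (by positivity)) (by
          rw [mul_div_assoc', div_lt_iff₀ (by positivity), mul_comm]
          have : (k : ℝ) ≤ N := by exact_mod_cast hk.2
          exact mul_lt_mul_of_pos_left (by linarith) hm)
      exact ⟨x, fun _ _ => hx⟩
    · exact ⟨0, fun h1 h2 => absurd ⟨h1, h2⟩ hk⟩
  choose q hq using hq
  have hle : M / ((N : ℝ) + 1) ≤ M / N :=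
    div_le_div_of_nonneg_left hm.le hN' (by linarith)
  have h1 : ∀ i, m.real (Set.Iio (q (c i))) ≤ c i * (M / (N + 1)) :=
    fun i => (hq _ (hc1 i) (hcN i)).1
  have h2 : ∀ i, c i * (M / (N + 1)) ≤ m.real (Set.Iic (q (c i))) :=
    fun i => (hq _ (hc1 i) (hcN i)).2
  refine ⟨fun i => q (c i), monotone_nat_of_le_succ fun i => ?_, fun i => ?_, ?_, ?_⟩
  · rcases (min_le_min_right N (by omega : i + 1 ≤ i + 1 + 1)).eq_or_lt with h | h
    · exact le_of_eq (congrArg q h)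
    · by_contra hcon
      push Not at hcon
      have h3 : (c i : ℝ) * (M / (N + 1)) < (c (i + 1) : ℝ) * (M / (N + 1)) :=
        mul_lt_mul_of_pos_right (by exact_mod_cast h) (by positivity)
      have h4 : m.real (Set.Iic (q (c (i + 1)))) ≤ m.real (Set.Iio (q (c i))) :=
        measureReal_mono fun x hx => lt_of_le_of_lt hx hcon
      linarith [h1 i, h2 (i + 1)]
  · refine le_trans ?_ hle
    rcases le_or_gt (q (c (i + 1))) (q (c i)) with h | h
    · rw [Set.Ioo_eq_empty (not_lt.2 h)]
      simp only [measureReal_empty]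
      positivity
    · have h3 : m.real (Set.Iic (q (c i))) + m.real (Set.Ioo (q (c i)) (q (c (i + 1)))) =
          m.real (Set.Iio (q (c (i + 1)))) := by
        rw [← measureReal_union _ measurableSet_Ioo, Set.Iic_union_Ioo_eq_Iio h]
        exact Set.disjoint_left.2 fun x hx hx' => absurd hx'.1 (not_lt.2 hx)
      have h4 : (c (i + 1) : ℝ) ≤ c i + 1 := by
        have : c (i + 1) ≤ c i + 1 := by simp only [c]; omega
        exact_mod_cast this
      have h5 := mul_le_mul_of_nonneg_right h4 (by positivity : 0 ≤ M / ((N : ℝ) + 1))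
      linarith [h1 (i + 1), h2 i]
  · refine le_trans ?_ hle
    have h3 : c 0 = 1 := by simp only [c]; omega
    simpa [h3] using h1 0
  · refine le_trans ?_ hle
    have h3 : c N = N := by simp only [c]; omega
    have h4 := h2 N
    rw [h3] at h4
    have h5 : m.real (Set.Ioi (q N)) = M - m.real (Set.Iic (q N)) := by
      rw [← Set.compl_Iic, measureReal_compl measurableSet_Iic]
    have h6 : (N : ℝ) * (M / (N + 1)) = M - M / (N + 1) := by field_simp; ring
    simp only [h3]
    rw [h5]
    linarith

end Quantiles
-- Regularity of the divided difference
section DividedDifference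

variable {f : ℝ → ℂ} {L : ℝ}

theorem dividedDifference_self (x : ℝ) : dividedDifference f (x, x) = 0 := by
  simp [dividedDifference]

theorem dividedDifference_of_ne {x y : ℝ} (h : x ≠ y) :
    dividedDifference f (x, y) = (f x - f y) / ((x - y : ℝ) : ℂ) := by
  simp [dividedDifference, h]

theorem dividedDifference_swap (x y : ℝ) :
    dividedDifference f (x, y) = dividedDifference f (y, x) := by
  rcases eq_or_ne x y with rfl | h
  · rfl
  · rw [dividedDifference_of_ne h, dividedDifference_of_ne h.symm, ← neg_sub (f y) (f x),
      ← neg_sub y x, Complex.ofReal_neg, neg_div_neg_eq]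

theorem norm_dividedDifference_le (hL : 0 ≤ L) (hf : ∀ x y, ‖f x - f y‖ ≤ L * |x - y|)
    (p : ℝ × ℝ) : ‖dividedDifference f p‖ ≤ L := by
  obtain ⟨x, y⟩ := p
  rcases eq_or_ne x y with rfl | h
  · rw [dividedDifference_self, norm_zero]; exact hL
  · rw [dividedDifference_of_ne h, norm_div, Complex.norm_real, Real.norm_eq_abs,
      div_le_iff₀ (abs_pos.2 (sub_ne_zero.2 h))]
    exact hf x y

theorem measurable_dividedDifference (hf : Continuous f) : Measurable (dividedDifference f) := by
  unfold dividedDifference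
  refine Measurable.ite (measurableSet_eq_fun measurable_fst measurable_snd) measurable_const ?_
  have h1 : Measurable fun p : ℝ × ℝ => f p.1 := hf.measurable.comp measurable_fst
  have h2 : Measurable fun p : ℝ × ℝ => f p.2 := hf.measurable.comp measurable_snd
  exact (h1.sub h2).div (Complex.measurable_ofReal.comp (measurable_fst.sub measurable_snd))

/-- With `D` the divided difference, the increment equals `((f x - f c) - D(c, y) (x - c)) / (x -
y)`, and both terms of the numerator are at most `L |x - c|`. -/
theorem norm_dividedDifference_sub_le (hf : ∀ x y, ‖f x - f y‖ ≤ L * |x - y|) {x y c : ℝ}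
    (hx : x ≠ y) (hc : c ≠ y) :
    ‖dividedDifference f (x, y) - dividedDifference f (c, y)‖ ≤ 2 * L * (|x - c| / |x - y|) := by
  have hxy : ((x - y : ℝ) : ℂ) ≠ 0 := Complex.ofReal_ne_zero.2 (sub_ne_zero.2 hx)
  have hcy : ((c - y : ℝ) : ℂ) ≠ 0 := Complex.ofReal_ne_zero.2 (sub_ne_zero.2 hc)
  have hpos : 0 < |x - y| := abs_pos.2 (sub_ne_zero.2 hx)
  have hid : dividedDifference f (x, y) - dividedDifference f (c, y) =
      ((f x - f c) - (f c - f y) / ((c - y : ℝ) : ℂ) * ((x - c : ℝ) : ℂ)) /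
        ((x - y : ℝ) : ℂ) := by
    rw [dividedDifference_of_ne hx, dividedDifference_of_ne hc]
    field_simp
    push_cast
    ring
  rw [hid, norm_div, Complex.norm_real, Real.norm_eq_abs, div_le_iff₀ hpos]
  have h1 : ‖(f c - f y) / ((c - y : ℝ) : ℂ)‖ ≤ L := by
    rw [norm_div, Complex.norm_real, Real.norm_eq_abs, div_le_iff₀ (abs_pos.2 (sub_ne_zero.2 hc))]
    exact hf c y
  have h2 : ‖(f c - f y) / ((c - y : ℝ) : ℂ) * ((x - c : ℝ) : ℂ)‖ ≤ L * |x - c| := by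
    rw [norm_mul, Complex.norm_real, Real.norm_eq_abs]
    exact mul_le_mul_of_nonneg_right h1 (abs_nonneg _)
  have h3 : 2 * L * (|x - c| / |x - y|) * |x - y| = L * |x - c| + L * |x - c| := by
    field_simp; ring
  rw [h3]
  exact (norm_sub_le _ _).trans (add_le_add (hf x c) h2)

/-- The telescoping majorant of the error of freezing a variable in a gap of length `ℓ`. -/
theorem sq_norm_dividedDifference_sub_le (hL : 0 ≤ L) (hf : ∀ x y, ‖f x - f y‖ ≤ L * |x - y|)
    {x y c d e ℓ : ℝ} (hx : x ≠ y) (hc : c ≠ y) (hℓ : 0 < ℓ) (hxc : |x - c| ≤ ℓ)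
    (hd : 0 ≤ d) (hxy : d ≤ |x - y|) (he : d + ℓ ≤ e) :
    ‖dividedDifference f (x, y) - dividedDifference f (c, y)‖ ^ 2 ≤
      4 * L ^ 2 * (6 * (ℓ / (d + ℓ) - ℓ / (e + ℓ))) := by
  have h0 : ℓ / (e + ℓ) ≤ ℓ / (d + ℓ + ℓ) :=
    div_le_div_of_nonneg_left hℓ.le (by positivity) (by linarith)
  have hid : ℓ / (d + ℓ) - ℓ / (d + ℓ + ℓ) = ℓ ^ 2 / ((d + ℓ) * (d + ℓ + ℓ)) := by
    field_simp; ring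
  have hpos : 0 < |x - y| := abs_pos.2 (sub_ne_zero.2 hx)
  have hsub : ‖dividedDifference f (x, y) - dividedDifference f (c, y)‖ ≤ 2 * L := by
    refine (norm_sub_le _ _).trans ?_
    linarith [norm_dividedDifference_le hL hf (x, y), norm_dividedDifference_le hL hf (c, y)]
  -- The trivial bound serves for `d ≤ ℓ` and the bound by `ℓ / d` for `d ≥ ℓ`. The constant `6` is
  -- what `(d + ℓ)(d + 2ℓ)` gives at the crossover `d = ℓ`.
  have key : ‖dividedDifference f (x, y) - dividedDifference f (c, y)‖ ^ 2 ≤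
      4 * L ^ 2 * (6 * (ℓ ^ 2 / ((d + ℓ) * (d + ℓ + ℓ)))) := by
    rcases le_total d ℓ with h | h
    · have h1 : 1 ≤ 6 * (ℓ ^ 2 / ((d + ℓ) * (d + ℓ + ℓ))) := by
        rw [mul_div_assoc', le_div_iff₀ (by positivity)]
        nlinarith
      calc _ ≤ (2 * L) ^ 2 := pow_le_pow_left₀ (norm_nonneg _) hsub 2
        _ = 4 * L ^ 2 * 1 := by ring
        _ ≤ _ := mul_le_mul_of_nonneg_left h1 (by positivity)
    · have hdpos : 0 < d := hℓ.trans_le h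
      have h1 : |x - c| / |x - y| ≤ ℓ / d := div_le_div₀ hℓ.le hxc hdpos hxy
      have h2 : (ℓ / d) ^ 2 ≤ 6 * (ℓ ^ 2 / ((d + ℓ) * (d + ℓ + ℓ))) := by
        rw [div_pow, mul_div_assoc', div_le_div_iff₀ (by positivity) (by positivity)]
        have : (d + ℓ) * (d + ℓ + ℓ) ≤ 6 * d ^ 2 := by nlinarith
        nlinarith [sq_nonneg ℓ]
      calc _ ≤ (2 * L * (|x - c| / |x - y|)) ^ 2 :=
            pow_le_pow_left₀ (norm_nonneg _) (norm_dividedDifference_sub_le hf hx hc) 2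
        _ ≤ (2 * L * (ℓ / d)) ^ 2 := by gcongr
        _ = 4 * L ^ 2 * (ℓ / d) ^ 2 := by ring
        _ ≤ _ := mul_le_mul_of_nonneg_left h2 (by positivity)
  refine key.trans (mul_le_mul_of_nonneg_left ?_ (by positivity))
  rw [← hid]
  linarith

end DividedDifference

/-! ### Kernels of finite rank -/

section TensorSums

/-- `K` is a sum of at most `r` products of bounded measurable functions of one variable. -/
def IsTensorSum (r : ℕ) (K : ℝ × ℝ → ℂ) : Prop :=
  ∃ (ι : Type) (_ : Fintype ι) (a b : ι → ℝ → ℂ) (B : ℝ), Fintype.card ι ≤ r ∧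
    (∀ i, Measurable (a i)) ∧ (∀ i, Measurable (b i)) ∧ (∀ i x, ‖a i x‖ ≤ B) ∧
    (∀ i x, ‖b i x‖ ≤ B) ∧ ∀ p, K p = ∑ i, a i p.1 * b i p.2

theorem IsTensorSum.mono {r s : ℕ} {K : ℝ × ℝ → ℂ} (h : IsTensorSum r K) (hrs : r ≤ s) :
    IsTensorSum s K := by
  obtain ⟨ι, _, a, b, B, hr, h⟩ := h
  exact ⟨ι, _, a, b, B, hr.trans hrs, h⟩

theorem IsTensorSum.add {r s : ℕ} {K K' : ℝ × ℝ → ℂ} (h : IsTensorSum r K)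
    (h' : IsTensorSum s K') : IsTensorSum (r + s) (fun p => K p + K' p) := by
  obtain ⟨ι, _, a, b, B, hr, ha, hb, haB, hbB, h⟩ := h
  obtain ⟨ι', _, a', b', B', hr', ha', hb', haB', hbB', h'⟩ := h'
  refine ⟨ι ⊕ ι', inferInstance, Sum.elim a a', Sum.elim b b', max B B', ?_, ?_, ?_, ?_, ?_, ?_⟩
  · rw [Fintype.card_sum]; exact add_le_add hr hr'
  · rintro (i | i) <;> simp [ha, ha']
  · rintro (i | i) <;> simp [hb, hb']
  · rintro (i | i) x
    · exact (haB i x).trans (le_max_left _ _)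
    · exact (haB' i x).trans (le_max_right _ _)
  · rintro (i | i) x
    · exact (hbB i x).trans (le_max_left _ _)
    · exact (hbB' i x).trans (le_max_right _ _)
  · intro p
    change K p + K' p = _
    rw [h, h', Fintype.sum_sum_type]
    rfl

theorem IsTensorSum.neg {r : ℕ} {K : ℝ × ℝ → ℂ} (h : IsTensorSum r K) :
    IsTensorSum r (fun p => -K p) := by
  obtain ⟨ι, _, a, b, B, hr, ha, hb, haB, hbB, h⟩ := h
  refine ⟨ι, _, fun i x => -a i x, b, B, hr, fun i => (ha i).neg, hb, fun i x => ?_, hbB,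
    fun p => ?_⟩
  · rw [norm_neg]; exact haB i x
  · change -K p = _
    rw [h, ← Finset.sum_neg_distrib]
    simp only [neg_mul]

theorem IsTensorSum.sub {r s : ℕ} {K K' : ℝ × ℝ → ℂ} (h : IsTensorSum r K)
    (h' : IsTensorSum s K') : IsTensorSum (r + s) (fun p => K p - K' p) := by
  simpa only [sub_eq_add_neg] using h.add h'.neg

theorem isTensorSum_finset_sum {ι : Type} (s : Finset ι) (a b : ι → ℝ → ℂ) (B : ℝ)
    (ha : ∀ i ∈ s, Measurable (a i)) (hb : ∀ i ∈ s, Measurable (b i))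
    (haB : ∀ i ∈ s, ∀ x, ‖a i x‖ ≤ B) (hbB : ∀ i ∈ s, ∀ x, ‖b i x‖ ≤ B) :
    IsTensorSum s.card fun p => ∑ i ∈ s, a i p.1 * b i p.2 :=
  ⟨s, inferInstance, fun i => a i, fun i => b i, B, by simp, fun i => ha i i.2, fun i => hb i i.2,
    fun i => haB i i.2, fun i => hbB i i.2, fun p =>
      (Finset.sum_coe_sort s fun i => a i p.1 * b i p.2).symm⟩

theorem IsTensorSum.measurable {r : ℕ} {K : ℝ × ℝ → ℂ} (h : IsTensorSum r K) : Measurable K := by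
  obtain ⟨ι, _, a, b, B, hr, ha, hb, haB, hbB, h⟩ := h
  rw [funext h]
  exact Finset.measurable_fun_sum _ fun i _ =>
    ((ha i).comp measurable_fst).mul ((hb i).comp measurable_snd)

theorem IsTensorSum.exists_bound {r : ℕ} {K : ℝ × ℝ → ℂ} (h : IsTensorSum r K) :
    ∃ B, ∀ p, ‖K p‖ ≤ B := by
  obtain ⟨ι, _, a, b, B, hr, ha, hb, haB, hbB, h⟩ := h
  refine ⟨∑ _ : ι, B * B, fun p => ?_⟩
  rw [h]
  refine norm_sum_le_of_le _ fun i _ => ?_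
  rw [norm_mul]
  exact mul_le_mul (haB i _) (hbB i _) (norm_nonneg _) ((norm_nonneg _).trans (haB i p.1))

end TensorSums
-- Gaps between cut points and their error weights
section Gaps

/-- The open gap between consecutive cut points. -/
def gap (t : ℕ → ℝ) (i : ℕ) : Set ℝ := Set.Ioo (t i) (t (i + 1))

theorem measurableSet_gap (t : ℕ → ℝ) (i : ℕ) : MeasurableSet (gap t i) := measurableSet_Ioo

variable {t : ℕ → ℝ} (ht : Monotone t)
include ht

theorem lt_of_mem_gap {i j : ℕ} {x y : ℝ} (hx : x ∈ gap t i) (hy : y ∈ gap t j) (h : i < j) :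
    x < y := (hx.2.trans_le (ht h)).trans hy.1

theorem gap_index_unique {i j : ℕ} {x : ℝ} (hi : x ∈ gap t i) (hj : x ∈ gap t j) : i = j := by
  rcases lt_trichotomy i j with h | h | h
  · exact absurd (lt_of_mem_gap ht hi hj h) (lt_irrefl x)
  · exact h
  · exact absurd (lt_of_mem_gap ht hj hi h) (lt_irrefl x)

theorem cutPoint_notMem_gap (m i : ℕ) : t m ∉ gap t i := by
  rintro ⟨h1, h2⟩
  rcases le_or_gt m i with h | h
  · exact absurd (ht h) (not_le.2 h1)
  · exact absurd (ht h) (not_le.2 h2)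

omit ht in
theorem exists_cutPoint_or_gap (N : ℕ) {x : ℝ} (h0 : t 0 ≤ x) (hN : x ≤ t N) :
    (∃ i ≤ N, x = t i) ∨ ∃ i < N, x ∈ gap t i := by
  induction N with
  | zero => exact Or.inl ⟨0, le_rfl, le_antisymm hN h0⟩
  | succ N ih =>
    rcases le_or_gt x (t N) with h | h
    · rcases ih h with ⟨i, hi, hx⟩ | ⟨i, hi, hx⟩
      · exact Or.inl ⟨i, by omega, hx⟩
      · exact Or.inr ⟨i, by omega, hx⟩
    · rcases hN.eq_or_lt with h' | h'
      · exact Or.inl ⟨N + 1, le_rfl, h'⟩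
      · exact Or.inr ⟨N, by omega, h, h'⟩

end Gaps

section GapWeights

/-- The bound, up to a factor `4 L²`, for the squared error of freezing the first variable on the
product of the gaps `i` and `j`, the gap `i` being the shorter one. -/
noncomputable def gapWeight (t : ℕ → ℝ) (i j : ℕ) : ℝ :=
  if i = j then 1
  else if i < j then
    6 * ((t (i + 1) - t i) / (t j - t (i + 1) + (t (i + 1) - t i)) -
      (t (i + 1) - t i) / (t (j + 1) - t (i + 1) + (t (i + 1) - t i)))
  else
    6 * ((t (i + 1) - t i) / (t i - t (j + 1) + (t (i + 1) - t i)) -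
      (t (i + 1) - t i) / (t i - t j + (t (i + 1) - t i)))

theorem div_add_antitone {ℓ d e : ℝ} (hℓ : 0 ≤ ℓ) (hd : 0 ≤ d) (hde : d ≤ e) :
    ℓ / (e + ℓ) ≤ ℓ / (d + ℓ) := by
  rcases hℓ.eq_or_lt with rfl | h
  · simp
  · exact div_le_div_of_nonneg_left hℓ (by positivity) (by linarith)

variable {t : ℕ → ℝ} (ht : Monotone t)
include ht

theorem gapWeight_nonneg (i j : ℕ) : 0 ≤ gapWeight t i j := by
  have hℓ : 0 ≤ t (i + 1) - t i := sub_nonneg.2 (ht i.le_succ)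
  have hj : t j ≤ t (j + 1) := ht j.le_succ
  unfold gapWeight
  split_ifs with h h'
  · exact zero_le_one
  · have h1 : t (i + 1) ≤ t j := ht h'
    have := div_add_antitone hℓ (sub_nonneg.2 h1) (by linarith : t j - t (i + 1) ≤
      t (j + 1) - t (i + 1))
    linarith
  · have h1 : t (j + 1) ≤ t i := ht (by omega)
    have := div_add_antitone hℓ (sub_nonneg.2 h1) (by linarith : t i - t (j + 1) ≤ t i - t j)
    linarith

/-- On each side of `i` the weights telescope to at most `6 ℓ / ℓ`, and the diagonal adds `1`. The
bound depends neither on the number nor on the lengths of the gaps. -/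
theorem sum_gapWeight_le (N i : ℕ) : ∑ j ∈ Finset.range N, gapWeight t i j ≤ 13 := by
  have hℓ : 0 ≤ t (i + 1) - t i := sub_nonneg.2 (ht i.le_succ)
  set ℓ := t (i + 1) - t i with hℓdef
  have hself : ℓ / (0 + ℓ) ≤ 1 := by rw [zero_add]; exact div_self_le_one ℓ
  have hleft : ∑ j ∈ Finset.range i, gapWeight t i j ≤ 6 := by
    have h1 : ∀ j ∈ Finset.range i, gapWeight t i j =
        6 * (ℓ / (t i - t (j + 1) + ℓ)) - 6 * (ℓ / (t i - t j + ℓ)) := by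
      intro j hj
      have hj' := Finset.mem_range.1 hj
      rw [gapWeight, if_neg (by omega), if_neg (by omega), mul_sub]
    rw [Finset.sum_congr rfl h1, Finset.sum_range_sub (fun j => 6 * (ℓ / (t i - t j + ℓ))) i,
      sub_self]
    have h2 : 0 ≤ ℓ / (t i - t 0 + ℓ) :=
      div_nonneg hℓ (add_nonneg (sub_nonneg.2 (ht i.zero_le)) hℓ)
    linarith
  have hright : ∀ n, ∑ j ∈ Finset.range n, gapWeight t i (i + 1 + j) ≤ 6 := by
    intro n
    have h1 : ∀ j ∈ Finset.range n, gapWeight t i (i + 1 + j) =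
        6 * (ℓ / (t (i + 1 + j) - t (i + 1) + ℓ)) -
          6 * (ℓ / (t (i + 1 + (j + 1)) - t (i + 1) + ℓ)) := by
      intro j _
      rw [gapWeight, if_neg (by omega), if_pos (by omega), mul_sub, add_assoc (i + 1) j 1]
    rw [Finset.sum_congr rfl h1,
      Finset.sum_range_sub' (fun j => 6 * (ℓ / (t (i + 1 + j) - t (i + 1) + ℓ))) n, add_zero,
      sub_self]
    have h2 : 0 ≤ ℓ / (t (i + 1 + n) - t (i + 1) + ℓ) :=
      div_nonneg hℓ (add_nonneg (sub_nonneg.2 (ht (by omega))) hℓ)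
    linarith
  calc ∑ j ∈ Finset.range N, gapWeight t i j
      ≤ ∑ j ∈ Finset.range (i + 1 + N), gapWeight t i j :=
        Finset.sum_le_sum_of_subset_of_nonneg (Finset.range_subset_range.2 (by omega))
          fun j _ _ => gapWeight_nonneg ht i j
    _ = ∑ j ∈ Finset.range i, gapWeight t i j + gapWeight t i i +
          ∑ j ∈ Finset.range N, gapWeight t i (i + 1 + j) := by
        rw [Finset.sum_range_add, Finset.sum_range_succ]
    _ ≤ 13 := by
        have h3 : gapWeight t i i = 1 := if_pos rfl
        have := hright N
        linarith

/-- Here `d` and `e` are the distances from the gap `i` to the near and far ends of the gap `j`.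
That the gap `i` is the shorter one says `d + ℓ ≤ e`, as the telescoping majorant requires. -/
theorem sq_norm_sub_le_gapWeight {f : ℝ → ℂ} {L : ℝ} (hL : 0 ≤ L)
    (hf : ∀ x y, ‖f x - f y‖ ≤ L * |x - y|) {i j : ℕ} {x y : ℝ} (hx : x ∈ gap t i)
    (hy : y ∈ gap t j) (hij : t (i + 1) - t i ≤ t (j + 1) - t j) :
    ‖dividedDifference f (x, y) - dividedDifference f (t i, y)‖ ^ 2 ≤
      4 * L ^ 2 * gapWeight t i j := by
  have hℓ : 0 < t (i + 1) - t i := sub_pos.2 (hx.1.trans hx.2)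
  have hxc : |x - t i| ≤ t (i + 1) - t i := by
    rw [abs_of_pos (sub_pos.2 hx.1)]
    linarith [hx.2]
  rcases lt_trichotomy i j with h | rfl | h
  · have h1 : t (i + 1) ≤ t j := ht h
    have hxy : x < y := lt_of_mem_gap ht hx hy h
    rw [gapWeight, if_neg h.ne, if_pos h]
    refine sq_norm_dividedDifference_sub_le hL hf hxy.ne (hx.1.trans hxy).ne hℓ hxc
      (sub_nonneg.2 h1) ?_ (by linarith)
    rw [abs_sub_comm, abs_of_pos (sub_pos.2 hxy)]
    linarith [hx.2, hy.1]
  · rw [gapWeight, if_pos rfl, mul_one]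
    have h1 := norm_sub_le (dividedDifference f (x, y)) (dividedDifference f (t i, y))
    have h2 : ‖dividedDifference f (x, y) - dividedDifference f (t i, y)‖ ≤ 2 * L := by
      linarith [norm_dividedDifference_le hL hf (x, y), norm_dividedDifference_le hL hf (t i, y)]
    calc _ ≤ (2 * L) ^ 2 := pow_le_pow_left₀ (norm_nonneg _) h2 2
      _ = _ := by ring
  · have h1 : t (j + 1) ≤ t i := ht h
    have hxy : y < x := lt_of_mem_gap ht hy hx h
    rw [gapWeight, if_neg h.ne', if_neg (by omega)]
    refine sq_norm_dividedDifference_sub_le hL hf hxy.ne' (hy.2.trans_le h1).ne' hℓ hxc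
      (sub_nonneg.2 h1) ?_ (by linarith)
    rw [abs_of_pos (sub_pos.2 hxy)]
    linarith [hx.1, hy.2]

end GapWeights

/-! ### The frozen kernel -/

section FrozenKernel

/-- The cut points `t 0, …, t N`. -/
noncomputable def cutPoints (t : ℕ → ℝ) (N : ℕ) : Finset ℝ := (Finset.range (N + 1)).image t

/-- The union of the gaps that are at least as long as the gap `i`. -/
def longGaps (t : ℕ → ℝ) (N i : ℕ) : Set ℝ :=
  ⋃ j ∈ {j | j < N ∧ t (i + 1) - t i ≤ t (j + 1) - t j}, gap t j

/-- The union of the gaps that are longer than the gap `j`. -/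
def longerGaps (t : ℕ → ℝ) (N j : ℕ) : Set ℝ :=
  ⋃ i ∈ {i | i < N ∧ t (j + 1) - t j < t (i + 1) - t i}, gap t i

/-- The kernel `k` on the lines through the cut points; on a product of two gaps, the variable in the
shorter gap is frozen at its left end point. -/
noncomputable def frozenKernel (k : ℝ × ℝ → ℂ) (t : ℕ → ℝ) (N : ℕ) (p : ℝ × ℝ) : ℂ :=
  (∑ q ∈ cutPoints t N, Set.indicator {q} (fun _ => 1) p.1 * k (q, p.2) +
    ∑ q ∈ cutPoints t N, Set.indicator (cutPoints t N : Set ℝ)ᶜ (fun x => k (x, q)) p.1 *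
      Set.indicator {q} (fun _ => 1) p.2) +
  (∑ i ∈ Finset.range N, Set.indicator (gap t i) (fun _ => 1) p.1 *
      Set.indicator (longGaps t N i) (fun y => k (t i, y)) p.2 +
    ∑ j ∈ Finset.range N, Set.indicator (longerGaps t N j) (fun x => k (x, t j)) p.1 *
      Set.indicator (gap t j) (fun _ => 1) p.2)

/-- Two sums over at most `N + 1` cut points and two over `N` gaps. -/
theorem isTensorSum_frozenKernel {k : ℝ × ℝ → ℂ} (hk : Measurable k) {L : ℝ}
    (hL : ∀ p, ‖k p‖ ≤ L) (t : ℕ → ℝ) (N : ℕ) :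
    IsTensorSum (4 * N + 2) (frozenKernel k t N) := by
  have h1 : ∀ s : Set ℝ, ∀ x, ‖s.indicator (fun _ => (1 : ℂ)) x‖ ≤ max 1 L := fun s x =>
    (norm_indicator_le_norm_self _ x).trans (by simp)
  have h2 : ∀ s : Set ℝ, ∀ g : ℝ → ℝ × ℝ, ∀ x, ‖s.indicator (fun y => k (g y)) x‖ ≤ max 1 L :=
    fun s g x => (norm_indicator_le_norm_self (fun y => k (g y)) x).trans
      ((hL _).trans (le_max_right _ _))
  have hcard : (cutPoints t N).card ≤ N + 1 := by
    refine Finset.card_image_le.trans ?_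
    rw [Finset.card_range]
  have hm1 : ∀ q, Measurable fun y => k (q, y) := fun q => hk.comp measurable_prodMk_left
  have hm2 : ∀ q, Measurable fun x => k (x, q) := fun q => hk.comp measurable_prodMk_right
  have hgaps : ∀ I : Set ℕ, MeasurableSet (⋃ j ∈ I, gap t j) := fun I =>
    MeasurableSet.biUnion I.to_countable fun j _ => measurableSet_gap t j
  refine IsTensorSum.mono (((isTensorSum_finset_sum (cutPoints t N)
    (fun q => Set.indicator {q} fun _ => 1) (fun q y => k (q, y)) (max 1 L)
    (fun q _ => measurable_const.indicator (measurableSet_singleton q)) (fun q _ => hm1 q)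
    (fun q _ => h1 _) (fun q _ y => (hL _).trans (le_max_right _ _))).add
    (isTensorSum_finset_sum (cutPoints t N)
      (fun q => Set.indicator (cutPoints t N : Set ℝ)ᶜ fun x => k (x, q))
      (fun q => Set.indicator {q} fun _ => 1) (max 1 L)
      (fun q _ => (hm2 q).indicator (cutPoints t N).measurableSet.compl)
      (fun q _ => measurable_const.indicator (measurableSet_singleton q))
      (fun q _ => h2 _ fun x => (x, q)) (fun q _ => h1 _))).add
    ((isTensorSum_finset_sum (Finset.range N)
      (fun i => Set.indicator (gap t i) fun _ => 1)
      (fun i => Set.indicator (longGaps t N i) fun y => k (t i, y)) (max 1 L)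
      (fun i _ => measurable_const.indicator (measurableSet_gap t i))
      (fun i _ => (hm1 _).indicator (hgaps _))
      (fun i _ => h1 _) (fun i _ => h2 _ fun y => (t i, y))).add
    (isTensorSum_finset_sum (Finset.range N)
      (fun j => Set.indicator (longerGaps t N j) fun x => k (x, t j))
      (fun j => Set.indicator (gap t j) fun _ => 1) (max 1 L)
      (fun j _ => (hm2 _).indicator (hgaps _))
      (fun j _ => measurable_const.indicator (measurableSet_gap t j))
      (fun j _ => h2 _ fun x => (x, t j)) (fun j _ => h1 _)))) ?_
  rw [Finset.card_range]
  omega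

theorem mem_cutPoints {t : ℕ → ℝ} {N : ℕ} {x : ℝ} : x ∈ cutPoints t N ↔ ∃ i ≤ N, x = t i := by
  simp only [cutPoints, Finset.mem_image, Finset.mem_range, Nat.lt_succ_iff, eq_comm]

variable {t : ℕ → ℝ} (ht : Monotone t) (k : ℝ × ℝ → ℂ) (N : ℕ)
include ht

theorem notMem_gap_of_mem_cutPoints {x : ℝ} (hx : x ∈ cutPoints t N) (i : ℕ) : x ∉ gap t i := by
  obtain ⟨m, -, rfl⟩ := mem_cutPoints.1 hx
  exact cutPoint_notMem_gap ht m i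

/-- Exactness on the cut lines matters because atoms there need not be light. The complement
indicator in the second sum keeps crossings of cut lines from being counted twice. -/
theorem frozenKernel_of_left_mem {x y : ℝ} (hx : x ∈ cutPoints t N) :
    frozenKernel k t N (x, y) = k (x, y) := by
  have hg := notMem_gap_of_mem_cutPoints ht N hx
  have h3 : ∀ j, x ∉ longerGaps t N j := by
    intro j hj
    simp only [longerGaps, Set.mem_iUnion] at hj
    obtain ⟨i, -, hi⟩ := hj
    exact hg i hi
  rw [frozenKernel, Finset.sum_eq_single x, Finset.sum_eq_zero (s := cutPoints t N),
    Finset.sum_eq_zero (s := Finset.range N), Finset.sum_eq_zero (s := Finset.range N)]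
  · simp
  · intro j _; simp [h3 j]
  · intro i _; simp [hg i]
  · intro q _; simp [hx]
  · intro q _ hq; simp [hq.symm]
  · exact fun h => absurd hx h

theorem frozenKernel_of_right_mem {x y : ℝ} (hx : x ∉ cutPoints t N) (hy : y ∈ cutPoints t N) :
    frozenKernel k t N (x, y) = k (x, y) := by
  have hg := notMem_gap_of_mem_cutPoints ht N hy
  have h3 : ∀ i, y ∉ longGaps t N i := by
    intro i hi
    simp only [longGaps, Set.mem_iUnion] at hi
    obtain ⟨j, -, hj⟩ := hi
    exact hg j hj
  rw [frozenKernel, Finset.sum_eq_zero, Finset.sum_eq_single y,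
    Finset.sum_eq_zero (s := Finset.range N), Finset.sum_eq_zero (s := Finset.range N)]
  · simp [hx]
  · intro j _; simp [hg j]
  · intro i _; simp [h3 i]
  · intro q _ hq; simp [hq.symm]
  · exact fun h => absurd hy h
  · intro q hq
    have : x ≠ q := fun h => hx (h ▸ hq)
    simp [this]

omit ht in
theorem frozenKernel_of_notMem {x y : ℝ} (hx : x ∉ cutPoints t N) (hy : y ∉ cutPoints t N) :
    frozenKernel k t N (x, y) =
      ∑ i ∈ Finset.range N, Set.indicator (gap t i) (fun _ => 1) x *
        Set.indicator (longGaps t N i) (fun y => k (t i, y)) y +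
      ∑ j ∈ Finset.range N, Set.indicator (longerGaps t N j) (fun x => k (x, t j)) x *
        Set.indicator (gap t j) (fun _ => 1) y := by
  rw [frozenKernel, Finset.sum_eq_zero, Finset.sum_eq_zero (s := cutPoints t N)]
  · simp
  · intro q hq
    have : y ≠ q := fun h => hy (h ▸ hq)
    simp [this]
  · intro q hq
    have : x ≠ q := fun h => hx (h ▸ hq)
    simp [this]

omit ht in
theorem frozenKernel_eq_zero {x y : ℝ} (hx : x ∉ cutPoints t N) (hy : y ∉ cutPoints t N)
    (h : (∀ i < N, x ∉ gap t i) ∨ ∀ j < N, y ∉ gap t j) : frozenKernel k t N (x, y) = 0 := by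
  rw [frozenKernel_of_notMem k N hx hy, Finset.sum_eq_zero, Finset.sum_eq_zero, add_zero]
  · intro j hj
    rcases h with h | h
    · have : x ∉ longerGaps t N j := by
        simp only [longerGaps, Set.mem_iUnion]
        rintro ⟨i, hi, hxi⟩
        exact h i hi.1 hxi
      simp [this]
    · simp [h j (Finset.mem_range.1 hj)]
  · intro i hi
    rcases h with h | h
    · simp [h i (Finset.mem_range.1 hi)]
    · have : y ∉ longGaps t N i := by
        simp only [longGaps, Set.mem_iUnion]
        rintro ⟨j, hj, hyj⟩
        exact h j hj.1 hyj
      simp [this]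

/-- `longGaps` uses a weak inequality and `longerGaps` a strict one, so exactly one term survives;
in a tie the first variable is frozen. -/
theorem frozenKernel_of_gaps {x y : ℝ} {i j : ℕ} (hi : i < N) (hj : j < N) (hx : x ∈ gap t i)
    (hy : y ∈ gap t j) : frozenKernel k t N (x, y) =
      if t (i + 1) - t i ≤ t (j + 1) - t j then k (t i, y) else k (x, t j) := by
  have hx' : x ∉ cutPoints t N := fun h => notMem_gap_of_mem_cutPoints ht N h i hx
  have hy' : y ∉ cutPoints t N := fun h => notMem_gap_of_mem_cutPoints ht N h j hy
  have hlong : y ∈ longGaps t N i ↔ t (i + 1) - t i ≤ t (j + 1) - t j := by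
    simp only [longGaps, Set.mem_iUnion]
    constructor
    · rintro ⟨j', hj', hyj⟩
      rw [gap_index_unique ht hy hyj]
      exact hj'.2
    · exact fun h => ⟨j, ⟨hj, h⟩, hy⟩
  have hlonger : x ∈ longerGaps t N j ↔ t (j + 1) - t j < t (i + 1) - t i := by
    simp only [longerGaps, Set.mem_iUnion]
    constructor
    · rintro ⟨i', hi', hxi⟩
      rw [gap_index_unique ht hx hxi]
      exact hi'.2
    · exact fun h => ⟨i, ⟨hi, h⟩, hx⟩
  rw [frozenKernel_of_notMem k N hx' hy', Finset.sum_eq_single i, Finset.sum_eq_single j]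
  · split_ifs with h
    · simp [hx, hy, hlong.2 h, hlonger, not_lt.2 h]
    · simp [hx, hy, hlong, h, hlonger.2 (not_le.1 h)]
  · intro j' _ hj'
    have : y ∉ gap t j' := fun h => hj' (gap_index_unique ht h hy)
    simp [this]
  · exact fun h => absurd (Finset.mem_range.2 hj) h
  · intro i' _ hi'
    have : x ∉ gap t i' := fun h => hi' (gap_index_unique ht h hx)
    simp [this]
  · exact fun h => absurd (Finset.mem_range.2 hi) h

end FrozenKernel
-- Low rank approximation of the divided difference in `L²`
section KernelApproximation

variable {f : ℝ → ℂ} {L : ℝ}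

/-- The majorant of the squared error of the frozen kernel. -/
noncomputable def frozenError (t : ℕ → ℝ) (N : ℕ) (L : ℝ) (p : ℝ × ℝ) : ℝ :=
  (((Set.Iio (t 0) ∪ Set.Ioi (t N)) ×ˢ Set.univ).indicator (fun _ => L ^ 2) p +
    (Set.univ ×ˢ (Set.Iio (t 0) ∪ Set.Ioi (t N))).indicator (fun _ => L ^ 2) p) +
  ∑ i ∈ Finset.range N, ∑ j ∈ Finset.range N, (gap t i ×ˢ gap t j).indicator
    (fun _ => 4 * L ^ 2 * (gapWeight t i j + gapWeight t j i)) p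

/-- The error vanishes on the cut lines. Off them, it is at most `L` outside `[t 0, t N]²`, where
the frozen kernel is zero. On a product of gaps the two weights cover the two choices of the frozen
variable, by symmetry of the divided difference. -/
theorem sq_norm_sub_frozenKernel_le {t : ℕ → ℝ} (ht : Monotone t) (hL : 0 ≤ L)
    (hf : ∀ x y, ‖f x - f y‖ ≤ L * |x - y|) (N : ℕ) (p : ℝ × ℝ) :
    ‖dividedDifference f p - frozenKernel (dividedDifference f) t N p‖ ^ 2 ≤
      frozenError t N L p := by
  obtain ⟨x, y⟩ := p
  have hterm : ∀ i j, 0 ≤ (gap t i ×ˢ gap t j).indicator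
      (fun _ => 4 * L ^ 2 * (gapWeight t i j + gapWeight t j i)) (x, y) := fun i j =>
    Set.indicator_nonneg (fun _ _ => mul_nonneg (by positivity)
      (add_nonneg (gapWeight_nonneg ht i j) (gapWeight_nonneg ht j i))) _
  have hsum : 0 ≤ ∑ i ∈ Finset.range N, ∑ j ∈ Finset.range N, (gap t i ×ˢ gap t j).indicator
      (fun _ => 4 * L ^ 2 * (gapWeight t i j + gapWeight t j i)) (x, y) :=
    Finset.sum_nonneg fun i _ => Finset.sum_nonneg fun j _ => hterm i j
  have hind : ∀ S : Set (ℝ × ℝ), 0 ≤ S.indicator (fun _ => L ^ 2) (x, y) := fun S =>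
    Set.indicator_nonneg (fun _ _ => by positivity) _
  have hnonneg : 0 ≤ frozenError t N L (x, y) :=
    add_nonneg (add_nonneg (hind _) (hind _)) hsum
  by_cases hx : x ∈ cutPoints t N
  · rw [frozenKernel_of_left_mem ht _ N hx]; simpa using hnonneg
  by_cases hy : y ∈ cutPoints t N
  · rw [frozenKernel_of_right_mem ht _ N hx hy]; simpa using hnonneg
  have hcase : ∀ z, z ∉ cutPoints t N → z ∉ Set.Iio (t 0) ∪ Set.Ioi (t N) →
      ∃ i < N, z ∈ gap t i := by
    intro z hz hO
    simp only [Set.mem_union, Set.mem_Iio, Set.mem_Ioi, not_or, not_lt] at hO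
    rcases exists_cutPoint_or_gap N hO.1 hO.2 with h | h
    · exact absurd (mem_cutPoints.2 h) hz
    · exact h
  have hsq : ‖dividedDifference f (x, y)‖ ^ 2 ≤ L ^ 2 :=
    pow_le_pow_left₀ (norm_nonneg _) (norm_dividedDifference_le hL hf _) 2
  have hgapO : ∀ z, z ∈ Set.Iio (t 0) ∪ Set.Ioi (t N) → ∀ i < N, z ∉ gap t i := by
    rintro z (hz | hz) i hi ⟨h1, h2⟩
    · exact absurd (h1.trans hz) (not_lt.2 (ht i.zero_le))
    · exact absurd (hz.trans h2) (not_lt.2 (ht hi))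
  by_cases hxO : x ∈ Set.Iio (t 0) ∪ Set.Ioi (t N)
  · rw [frozenKernel_eq_zero _ N hx hy (Or.inl (hgapO x hxO)), sub_zero]
    have h1 : ((Set.Iio (t 0) ∪ Set.Ioi (t N)) ×ˢ Set.univ).indicator (fun _ => L ^ 2) (x, y) =
      L ^ 2 := Set.indicator_of_mem (Set.mk_mem_prod hxO (Set.mem_univ y)) _
    rw [frozenError, h1]
    linarith [hind (Set.univ ×ˢ (Set.Iio (t 0) ∪ Set.Ioi (t N)))]
  by_cases hyO : y ∈ Set.Iio (t 0) ∪ Set.Ioi (t N)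
  · rw [frozenKernel_eq_zero _ N hx hy (Or.inr (hgapO y hyO)), sub_zero]
    have h1 : (Set.univ ×ˢ (Set.Iio (t 0) ∪ Set.Ioi (t N))).indicator (fun _ => L ^ 2) (x, y) =
      L ^ 2 := Set.indicator_of_mem (Set.mk_mem_prod (Set.mem_univ x) hyO) _
    rw [frozenError, h1]
    linarith [hind ((Set.Iio (t 0) ∪ Set.Ioi (t N)) ×ˢ Set.univ)]
  obtain ⟨i, hi, hxi⟩ := hcase x hx hxO
  obtain ⟨j, hj, hyj⟩ := hcase y hy hyO
  have hone : 4 * L ^ 2 * (gapWeight t i j + gapWeight t j i) ≤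
      ∑ i ∈ Finset.range N, ∑ j ∈ Finset.range N, (gap t i ×ˢ gap t j).indicator
        (fun _ => 4 * L ^ 2 * (gapWeight t i j + gapWeight t j i)) (x, y) := by
    have h1 : (gap t i ×ˢ gap t j).indicator
        (fun _ => 4 * L ^ 2 * (gapWeight t i j + gapWeight t j i)) (x, y) =
        4 * L ^ 2 * (gapWeight t i j + gapWeight t j i) := Set.indicator_of_mem (Set.mk_mem_prod hxi hyj) _
    refine h1.symm.le.trans ((Finset.single_le_sum (fun j _ => hterm i j)
      (Finset.mem_range.2 hj)).trans ?_)
    exact Finset.single_le_sum (f := fun i => ∑ j ∈ Finset.range N, (gap t i ×ˢ gap t j).indicator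
        (fun _ => 4 * L ^ 2 * (gapWeight t i j + gapWeight t j i)) (x, y))
      (fun i _ => Finset.sum_nonneg fun j _ => hterm i j) (Finset.mem_range.2 hi)
  have hL2 : 0 ≤ 4 * L ^ 2 := by positivity
  have hw1 := mul_nonneg hL2 (gapWeight_nonneg ht i j)
  have hw2 := mul_nonneg hL2 (gapWeight_nonneg ht j i)
  have hmain : ‖dividedDifference f (x, y) - frozenKernel (dividedDifference f) t N (x, y)‖ ^ 2 ≤
      4 * L ^ 2 * (gapWeight t i j + gapWeight t j i) := by
    rw [frozenKernel_of_gaps ht _ N hi hj hxi hyj, mul_add]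
    split_ifs with h
    · linarith [sq_norm_sub_le_gapWeight ht hL hf hxi hyj h]
    · rw [dividedDifference_swap x y, dividedDifference_swap x (t j)]
      linarith [sq_norm_sub_le_gapWeight ht hL hf hyj hxi (not_le.1 h).le]
  have h3 := hmain.trans hone
  rw [frozenError]
  linarith [hind ((Set.Iio (t 0) ∪ Set.Ioi (t N)) ×ˢ Set.univ),
    hind (Set.univ ×ˢ (Set.Iio (t 0) ∪ Set.Ioi (t N)))]

theorem integrable_indicator_prod_const {μ ν : Measure ℝ} [IsFiniteMeasure μ] [IsFiniteMeasure ν]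
    {s t : Set ℝ} (hs : MeasurableSet s) (ht : MeasurableSet t) (c : ℝ) :
    Integrable ((s ×ˢ t).indicator fun _ => c) (μ.prod ν) :=
  (integrable_const c).indicator (hs.prod ht)

theorem integral_indicator_prod_const {μ ν : Measure ℝ} [IsFiniteMeasure μ] [IsFiniteMeasure ν]
    {s t : Set ℝ} (hs : MeasurableSet s) (ht : MeasurableSet t) (c : ℝ) :
    ∫ p, (s ×ˢ t).indicator (fun _ => c) p ∂(μ.prod ν) = μ.real s * ν.real t * c := by
  rw [integral_indicator_const _ (hs.prod ht), measureReal_prod_prod, smul_eq_mul]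

/-- The divided difference is approximated in `L²` of a product of probability measures, with error
`O(N^{-1/2})`, by kernels of rank `O(N)`. -/
theorem exists_isTensorSum_integral_le {μ ν : Measure ℝ} [IsFiniteMeasure μ] [IsFiniteMeasure ν]
    (hμ : μ.real Set.univ = 1) (hν : ν.real Set.univ = 1) (hL : 0 ≤ L)
    (hf : ∀ x y, ‖f x - f y‖ ≤ L * |x - y|) (hfc : Continuous f) {N : ℕ} (hN : 0 < N) :
    ∃ K, IsTensorSum (6 * N) K ∧
      ∫ p, ‖dividedDifference f p - K p‖ ^ 2 ∂(μ.prod ν) ≤ 424 * L ^ 2 / N := by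
  -- Cutting by `μ + ν` yields one set of points for both axes; each gap has mass at most `2 / N`
  -- for `μ` and for `ν`.
  have hm : (μ + ν).real Set.univ = 2 := by rw [measureReal_add_apply, hμ, hν]; norm_num
  obtain ⟨t, ht, hgap, hlo, hhi⟩ := exists_cut_points (μ + ν) (by rw [hm]; norm_num) hN
  rw [hm] at hlo hhi
  simp only [hm] at hgap
  have hN' : (0 : ℝ) < N := Nat.cast_pos.2 hN
  have hμs : ∀ s, μ.real s ≤ (μ + ν).real s := fun s => by
    rw [measureReal_add_apply]; linarith [measureReal_nonneg (μ := ν) (s := s)]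
  have hνs : ∀ s, ν.real s ≤ (μ + ν).real s := fun s => by
    rw [measureReal_add_apply]; linarith [measureReal_nonneg (μ := μ) (s := s)]
  have hO : (μ + ν).real (Set.Iio (t 0) ∪ Set.Ioi (t N)) ≤ 4 / N := by
    refine (measureReal_union_le _ _).trans ?_
    have : (4 : ℝ) / N = 2 / N + 2 / N := by ring
    linarith
  have hOm : MeasurableSet (Set.Iio (t 0) ∪ Set.Ioi (t N)) :=
    measurableSet_Iio.union measurableSet_Ioi
  have hg : ∀ i, MeasurableSet (gap t i) := measurableSet_gap t
  refine ⟨_, (isTensorSum_frozenKernel (measurable_dividedDifference hfc)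
    (norm_dividedDifference_le hL hf) t N).mono (by omega), ?_⟩
  have hint1 := integrable_indicator_prod_const (μ := μ) (ν := ν) hOm .univ (L ^ 2)
  have hint2 := integrable_indicator_prod_const (μ := μ) (ν := ν) .univ hOm (L ^ 2)
  have hint3 : ∀ i j, Integrable ((gap t i ×ˢ gap t j).indicator fun _ =>
      4 * L ^ 2 * (gapWeight t i j + gapWeight t j i)) (μ.prod ν) := fun i j =>
    integrable_indicator_prod_const (hg i) (hg j) _
  have hint4 : Integrable (fun p => ∑ i ∈ Finset.range N, ∑ j ∈ Finset.range N,
      (gap t i ×ˢ gap t j).indicator (fun _ =>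
        4 * L ^ 2 * (gapWeight t i j + gapWeight t j i)) p) (μ.prod ν) :=
    integrable_finsetSum _ fun i _ => integrable_finsetSum _ fun j _ => hint3 i j
  calc ∫ p, ‖dividedDifference f p - frozenKernel (dividedDifference f) t N p‖ ^ 2 ∂(μ.prod ν)
      ≤ ∫ p, frozenError t N L p ∂(μ.prod ν) :=
        integral_mono_of_nonneg (Filter.Eventually.of_forall fun _ => by positivity)
          ((hint1.add hint2).add hint4)
          (Filter.Eventually.of_forall (sq_norm_sub_frozenKernel_le ht hL hf N))
    _ = μ.real (Set.Iio (t 0) ∪ Set.Ioi (t N)) * L ^ 2 +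
          ν.real (Set.Iio (t 0) ∪ Set.Ioi (t N)) * L ^ 2 +
        ∑ i ∈ Finset.range N, ∑ j ∈ Finset.range N, μ.real (gap t i) * ν.real (gap t j) *
          (4 * L ^ 2 * (gapWeight t i j + gapWeight t j i)) := by
        unfold frozenError
        rw [integral_add (f := fun p => _ + _) (hint1.add hint2) hint4, integral_add hint1 hint2,
          integral_indicator_prod_const hOm .univ, integral_indicator_prod_const .univ hOm, hμ, hν,
          integral_finsetSum _ fun i _ => integrable_finsetSum _ fun j _ => hint3 i j]
        simp only [mul_one, one_mul]
        congr 1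
        refine Finset.sum_congr rfl fun i _ => ?_
        rw [integral_finsetSum _ fun j _ => hint3 i j]
        exact Finset.sum_congr rfl fun j _ => integral_indicator_prod_const (hg i) (hg j) _
    _ ≤ 4 / N * L ^ 2 + 4 / N * L ^ 2 +
        ∑ i ∈ Finset.range N, ∑ j ∈ Finset.range N, 2 / N * (2 / N) *
          (4 * L ^ 2 * (gapWeight t i j + gapWeight t j i)) := by
        gcongr with i _ j _
        · exact (hμs _).trans hO
        · exact (hνs _).trans hO
        · exact mul_nonneg (by positivity)
            (add_nonneg (gapWeight_nonneg ht i j) (gapWeight_nonneg ht j i))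
        · exact (hμs _).trans (hgap i)
        · exact (hνs _).trans (hgap j)
    _ = 8 / N * L ^ 2 + 16 / N ^ 2 * L ^ 2 *
        (∑ i ∈ Finset.range N, ∑ j ∈ Finset.range N, gapWeight t i j +
          ∑ i ∈ Finset.range N, ∑ j ∈ Finset.range N, gapWeight t j i) := by
        simp only [← Finset.sum_add_distrib, Finset.mul_sum]
        congr 1
        · ring
        · refine Finset.sum_congr rfl fun i _ => Finset.sum_congr rfl fun j _ => ?_
          ring
    _ ≤ 8 / N * L ^ 2 + 16 / N ^ 2 * L ^ 2 * (N * 13 + N * 13) := by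
        have h : ∑ i ∈ Finset.range N, ∑ j ∈ Finset.range N, gapWeight t i j ≤ N * 13 := by
          refine (Finset.sum_le_sum fun i _ => sum_gapWeight_le ht N i).trans_eq ?_
          simp
        have h' := h
        rw [Finset.sum_comm] at h'
        gcongr
    -- `424 = 8 + 16 * 26`: the tails give `8`, and each of the two weight sums is at most `13 N`.
    _ = 424 * L ^ 2 / N := by
        field_simp
        ring

end KernelApproximation
-- Pairing operators with kernels of finite rank
section TensorKernels

variable {H : Type u} [NormedAddCommGroup H] [InnerProductSpace ℂ H]

theorem opNorm_le_of_inner_unit {A : H →L[ℂ] H} {c : ℝ} (hc : 0 ≤ c)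
    (h : ∀ u v, ‖u‖ = 1 → ‖v‖ = 1 → ‖inner ℂ v (A u)‖ ≤ c) : ‖A‖ ≤ c := by
  refine opNorm_le_of_inner hc fun u v => ?_
  rcases eq_or_ne u 0 with rfl | hu
  · simp
  rcases eq_or_ne v 0 with rfl | hv
  · simp
  have hu' : u = (‖u‖ : ℂ) • ((‖u‖ : ℂ)⁻¹ • u) := by
    rw [smul_inv_smul₀ (by exact_mod_cast norm_ne_zero_iff.2 hu)]
  have hv' : v = (‖v‖ : ℂ) • ((‖v‖ : ℂ)⁻¹ • v) := by
    rw [smul_inv_smul₀ (by exact_mod_cast norm_ne_zero_iff.2 hv)]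
  have h1 := h ((‖u‖ : ℂ)⁻¹ • u) ((‖v‖ : ℂ)⁻¹ • v) (norm_smul_inv_norm hu)
    (norm_smul_inv_norm hv)
  calc ‖inner ℂ v (A u)‖
      = ‖v‖ * ‖u‖ * ‖inner ℂ ((‖v‖ : ℂ)⁻¹ • v) (A ((‖u‖ : ℂ)⁻¹ • u))‖ := by
        generalize (‖u‖ : ℂ)⁻¹ • u = u₁ at hu'
        generalize (‖v‖ : ℂ)⁻¹ • v = v₁ at hv'
        conv_lhs => rw [hu', hv']
        rw [map_smul, inner_smul_left, inner_smul_right, norm_mul, norm_mul]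
        simp only [RCLike.norm_conj, Complex.norm_real, norm_norm, mul_assoc]
    _ ≤ ‖v‖ * ‖u‖ * c := by gcongr
    _ = c * ‖v‖ * ‖u‖ := by ring

theorem exists_projection {ι : Type} [Fintype ι] (x : ι → H) :
    ∃ P : H →L[ℂ] H, ‖P‖ ≤ 1 ∧ LinearMap.rank (P : H →ₗ[ℂ] H) ≤ (Fintype.card ι : Cardinal) ∧
      ∀ i y, inner ℂ (x i) (P y) = inner ℂ (x i) y := by
  let V := Submodule.span ℂ (Set.range x)
  have : FiniteDimensional ℂ V := FiniteDimensional.span_of_finite ℂ (Set.finite_range x)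
  refine ⟨V.starProjection, V.starProjection_norm_le, ?_, fun i y => ?_⟩
  · have h1 : LinearMap.rank (V.starProjection : H →ₗ[ℂ] H) ≤ Module.rank ℂ V := by
      refine Submodule.rank_mono ?_
      rintro _ ⟨y, rfl⟩
      exact V.starProjection_apply_mem y
    refine h1.trans ?_
    rw [← Module.finrank_eq_rank]
    exact_mod_cast finrank_range_le_card x
  · rw [← V.inner_starProjection_left_eq_right,
      V.starProjection_eq_self_iff.2 (Submodule.subset_span (Set.mem_range_self i))]

variable [CompleteSpace H] (E₁ E₂ : SpectralMeasure ℝ H)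

/-- The vectors are the images of `conj a` and `b` under the two isometries. What matters is that
they do not depend on `T`. -/
theorem exists_doubleForm_product_eq {a b : ℝ → ℂ} (ha : Measurable a) (hb : Measurable b) {B : ℝ}
    (haB : ∀ x, ‖a x‖ ≤ B) (hbB : ∀ x, ‖b x‖ ≤ B) (u v : H) :
    ∃ x y : H, ∀ (T : H →L[ℂ] H) (c : ℝ), HSBound T c →
      doubleForm E₁ E₂ T (fun p => a p.1 * b p.2) u v = inner ℂ x (T y) := by
  have ha2 : MemLp (fun x => starRingEnd ℂ (a x)) 2 (E₁.diag v) :=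
    (memLp_of_bound ha haB).star
  have hb2 : MemLp b 2 (E₂.diag u) := memLp_of_bound hb hbB
  refine ⟨E₁.isometry v (ha2.toLp _), E₂.isometry u (hb2.toLp _), fun T c hT => ?_⟩
  refine Eq.trans (Eq.trans ?_ (L2.inner_def _ _).symm) (inner_operatorKernel E₁ E₂ hT u v _ _)
  refine integral_congr_ae ?_
  unfold planeMeasure
  filter_upwards [coeFn_tensorConj (ha2.toLp _) (hb2.toLp _),
    Measure.quasiMeasurePreserving_fst.ae_eq_comp ha2.coeFn_toLp,
    Measure.quasiMeasurePreserving_snd.ae_eq_comp hb2.coeFn_toLp] with p h1 h2 h3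
  simp only [Function.comp_apply] at h2 h3
  rw [h1, h2, h3, RCLike.inner_apply]
  simp only [map_mul, RCLike.conj_conj]
  ring

/-- The pairing is `∑ ⟨x_i, T y_i⟩` with at most `r` terms, so `T` may be replaced by `P T`, where
`P` projects onto the span of the `x_i`. This operator has rank at most `r`, hence Hilbert–Schmidt
norm at most `√r ‖T‖`, however large that of `T` is. -/
theorem norm_doubleForm_le_of_isTensorSum {T : H →L[ℂ] H} {c : ℝ} (hT : HSBound T c) {r : ℕ}
    {Φ : ℝ × ℝ → ℂ} (hΦ : IsTensorSum r Φ) (u v : H) :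
    ‖doubleForm E₁ E₂ T Φ u v‖ ≤
      Real.sqrt r * ‖T‖ * Real.sqrt (∫ p, ‖Φ p‖ ^ 2 ∂(planeMeasure E₁ E₂ u v)) := by
  have hmeas := hΦ.measurable
  obtain ⟨B', hB'⟩ := hΦ.exists_bound
  obtain ⟨ι, _, a, b, B, hr, ha, hb, haB, hbB, h⟩ := hΦ
  choose x y hxy using fun i => exists_doubleForm_product_eq E₁ E₂ (ha i) (hb i) (haB i) (hbB i) u v
  obtain ⟨P, hP, hPr, hPx⟩ := exists_projection x
  have hsum : ∀ (S : H →L[ℂ] H) (d : ℝ), HSBound S d →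
      doubleForm E₁ E₂ S Φ u v = ∑ i, inner ℂ (x i) (S (y i)) := by
    intro S d hS
    rw [← Finset.sum_congr rfl fun i _ => hxy i S d hS]
    unfold doubleForm
    rw [← integral_finsetSum _ fun i _ => integrable_mul_kernel E₁ E₂
      (Φ := fun p => a i p.1 * b i p.2)
      (((ha i).comp measurable_fst).mul ((hb i).comp measurable_snd)) (B := B * B) (fun p => ?_) _]
    · simp only [h, Finset.sum_mul]
    · rw [norm_mul]
      exact mul_le_mul (haB i _) (hbB i _) (norm_nonneg _) ((norm_nonneg _).trans (haB i p.1))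
  have hPT := hT.comp_contraction P hP
  have hrank : LinearMap.rank ((P ∘L T : H →L[ℂ] H) : H →ₗ[ℂ] H) ≤ (r : Cardinal) :=
    (LinearMap.rank_comp_le_left _ _).trans (hPr.trans (by exact_mod_cast hr))
  have heq : doubleForm E₁ E₂ T Φ u v = doubleForm E₁ E₂ (P ∘L T) Φ u v := by
    rw [hsum T c hT, hsum _ c hPT]
    exact Finset.sum_congr rfl fun i _ => (hPx i _).symm
  rw [heq]
  have hnorm : ‖P ∘L T‖ ≤ ‖T‖ := (P.opNorm_comp_le T).trans
    (mul_le_of_le_one_left (norm_nonneg _) hP)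
  exact norm_doubleForm_le_sqrt E₁ E₂ ((hsBound_of_rank_le hrank).mono (by gcongr)) u v
    (memLp_of_bound hmeas hB')

end TensorKernels

/-! ### The logarithmic bound for operators of finite rank -/

section FiniteRankEstimate

theorem integrable_sq_norm {X : Type*} [MeasurableSpace X] {m : Measure X} [IsFiniteMeasure m]
    {Φ : X → ℂ} (hΦ : Measurable Φ) {B : ℝ} (hB : ∀ x, ‖Φ x‖ ≤ B) :
    Integrable (fun x => ‖Φ x‖ ^ 2) m :=
  Integrable.of_bound (hΦ.norm.pow_const 2).aestronglyMeasurable (B ^ 2)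
    (Filter.Eventually.of_forall fun x => by
      rw [norm_pow, norm_norm]; exact pow_le_pow_left₀ (norm_nonneg _) (hB x) 2)

theorem integral_sq_norm_sub_le {X : Type*} [MeasurableSpace X] {m : Measure X} [IsFiniteMeasure m]
    {Φ Ψ : X → ℂ} (hΦ : Measurable Φ) (hΨ : Measurable Ψ) {B B' : ℝ} (hB : ∀ x, ‖Φ x‖ ≤ B)
    (hB' : ∀ x, ‖Ψ x‖ ≤ B') :
    ∫ x, ‖Φ x - Ψ x‖ ^ 2 ∂m ≤ 2 * ∫ x, ‖Φ x‖ ^ 2 ∂m + 2 * ∫ x, ‖Ψ x‖ ^ 2 ∂m := by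
  have h1 := integrable_sq_norm (m := m) hΦ hB
  have h2 := integrable_sq_norm (m := m) hΨ hB'
  rw [← integral_const_mul, ← integral_const_mul,
    ← integral_add (h1.const_mul 2) (h2.const_mul 2)]
  refine integral_mono_of_nonneg (Filter.Eventually.of_forall fun _ => by positivity)
    ((h1.const_mul 2).add (h2.const_mul 2)) (Filter.Eventually.of_forall fun x => ?_)
  have := pow_le_pow_left₀ (norm_nonneg _) (norm_sub_le (Φ x) (Ψ x)) 2
  change _ ≤ 2 * ‖Φ x‖ ^ 2 + 2 * ‖Ψ x‖ ^ 2
  nlinarith [sq_nonneg (‖Φ x‖ - ‖Ψ x‖)]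

variable {H : Type u} [NormedAddCommGroup H] [InnerProductSpace ℂ H] [CompleteSpace H]
  (E₁ E₂ : SpectralMeasure ℝ H) {f : ℝ → ℂ} {L : ℝ}

theorem sqrt_mul_mul_sqrt_le {r I c t : ℝ} (hr : 0 ≤ r) (hc : 0 ≤ c) (ht : 0 ≤ t)
    (h : r * I ≤ c ^ 2) : Real.sqrt r * t * Real.sqrt I ≤ c * t := by
  have h1 : Real.sqrt r * Real.sqrt I ≤ c := by
    rw [← Real.sqrt_mul hr]
    exact Real.sqrt_le_iff.2 ⟨hc, h⟩
  calc Real.sqrt r * t * Real.sqrt I = Real.sqrt r * Real.sqrt I * t := by ring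
    _ ≤ c * t := mul_le_mul_of_nonneg_right h1 ht

/-- Dyadic telescoping `K 0 + ∑_{j<m} (K (j + 1) - K j) + (D - K m)`. In each piece the growth of
the rank (for the last one, the rank of `T`) is balanced by the decay of the `L²` error, so all `m +
2` pieces obey the same bound. -/
theorem norm_doubleForm_dividedDifference_le (hL : 0 ≤ L)
    (hf : ∀ x y, ‖f x - f y‖ ≤ L * |x - y|) (hfc : Continuous f) {T : H →L[ℂ] H} (m : ℕ)
    (hT : LinearMap.rank (T : H →ₗ[ℂ] H) ≤ ((2 ^ m : ℕ) : Cardinal)) {u v : H} (hu : ‖u‖ = 1)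
    (hv : ‖v‖ = 1) :
    ‖doubleForm E₁ E₂ T (dividedDifference f) u v‖ ≤ 152 * L * ‖T‖ * (m + 2) := by
  have hTb := hsBound_of_rank_le hT
  have hD := measurable_dividedDifference hfc
  have hDB := norm_dividedDifference_le hL hf
  have hmass : ∀ (E : SpectralMeasure ℝ H) (w : H), ‖w‖ = 1 → (E.diag w).real Set.univ = 1 := by
    intro E w hw
    rw [E.diag_real _ .univ, E.univ']
    simp [hw]
  choose K hK hKe using fun j : ℕ => exists_isTensorSum_integral_le (hmass E₁ v hv) (hmass E₂ u hu)
    hL hf hfc (N := 2 ^ j) (by positivity)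
  change ∀ j, ∫ p, ‖dividedDifference f p - K j p‖ ^ 2 ∂(planeMeasure E₁ E₂ u v) ≤ _ at hKe
  choose B hB using fun j => (hK j).exists_bound
  have hKm := fun j => (hK j).measurable
  have hEB : ∀ j p, ‖dividedDifference f p - K j p‖ ≤ L + B j := fun j p =>
    (norm_sub_le _ _).trans (add_le_add (hDB p) (hB j p))
  have hEm : ∀ j, Measurable fun p => dividedDifference f p - K j p := fun j => hD.sub (hKm j)
  have hpow : ∀ j : ℕ, (0 : ℝ) < 2 ^ j := fun j => by positivity
  have h0 : ‖doubleForm E₁ E₂ T (K 0) u v‖ ≤ 152 * L * ‖T‖ := by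
    refine (norm_doubleForm_le_of_isTensorSum E₁ E₂ hTb (hK 0) u v).trans
      (sqrt_mul_mul_sqrt_le (Nat.cast_nonneg _) (by positivity) (norm_nonneg _) ?_)
    have h1 := integral_sq_norm_sub_le (m := planeMeasure E₁ E₂ u v) hD (hEm 0) hDB (hEB 0)
    simp only [sub_sub_cancel] at h1
    have h2 : ∫ p, ‖dividedDifference f p‖ ^ 2 ∂(planeMeasure E₁ E₂ u v) ≤ L ^ 2 := by
      calc ∫ p, ‖dividedDifference f p‖ ^ 2 ∂(planeMeasure E₁ E₂ u v)
          ≤ ∫ _, L ^ 2 ∂(planeMeasure E₁ E₂ u v) :=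
            integral_mono (integrable_sq_norm hD hDB) (integrable_const _)
              fun p => pow_le_pow_left₀ (norm_nonneg _) (hDB p) 2
        _ = L ^ 2 := by rw [integral_const, planeMeasure_real_univ, hu, hv]; simp
    have h3 := hKe 0
    norm_num at h3 ⊢
    nlinarith [sq_nonneg L]
  have hstep : ∀ j, ‖doubleForm E₁ E₂ T (K (j + 1) - K j) u v‖ ≤ 152 * L * ‖T‖ := by
    intro j
    refine (norm_doubleForm_le_of_isTensorSum E₁ E₂ hTb ((hK (j + 1)).sub (hK j)) u v).trans
      (sqrt_mul_mul_sqrt_le (Nat.cast_nonneg _) (by positivity) (norm_nonneg _) ?_)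
    have h1 := integral_sq_norm_sub_le (m := planeMeasure E₁ E₂ u v) (hEm j) (hEm (j + 1))
      (hEB j) (hEB (j + 1))
    simp only [sub_sub_sub_cancel_left] at h1
    have h2 := hKe j
    have h3 := hKe (j + 1)
    push_cast at h2 h3 ⊢
    have h4 : 424 * L ^ 2 / (2 : ℝ) ^ (j + 1) = 424 * L ^ 2 / 2 ^ j / 2 := by
      rw [pow_succ (2 : ℝ), div_div]
    have h5 : (2 : ℝ) ^ j * (424 * L ^ 2 / 2 ^ j) = 424 * L ^ 2 := by field_simp
    have h6 : ∫ p, ‖K (j + 1) p - K j p‖ ^ 2 ∂(planeMeasure E₁ E₂ u v) ≤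
        3 * (424 * L ^ 2 / 2 ^ j) := by linarith
    -- The constant `152` is fixed here: `54 * 424 = 22896 ≤ 152 ^ 2`. The first and last pieces
    -- need less.
    calc _ ≤ (6 * (2 : ℝ) ^ (j + 1) + 6 * 2 ^ j) * (3 * (424 * L ^ 2 / 2 ^ j)) := by gcongr
      _ = 54 * (2 ^ j * (424 * L ^ 2 / 2 ^ j)) := by ring
      _ ≤ (152 * L) ^ 2 := by rw [h5]; nlinarith [sq_nonneg L]
  have hlast : ‖doubleForm E₁ E₂ T (dividedDifference f - K m) u v‖ ≤ 152 * L * ‖T‖ := by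
    refine (norm_doubleForm_le_sqrt E₁ E₂ hTb u v (memLp_of_bound (hEm m) (hEB m))).trans
      (sqrt_mul_mul_sqrt_le (Nat.cast_nonneg _) (by positivity) (norm_nonneg _) ?_)
    have h2 := hKe m
    push_cast at h2 ⊢
    calc _ ≤ (2 : ℝ) ^ m * (424 * L ^ 2 / 2 ^ m) := mul_le_mul_of_nonneg_left h2 (hpow m).le
      _ = 424 * L ^ 2 := by field_simp
      _ ≤ (152 * L) ^ 2 := by nlinarith [sq_nonneg L]
  have hind : ∀ j : ℕ, ‖doubleForm E₁ E₂ T (K j) u v‖ ≤ 152 * L * ‖T‖ * (j + 1) := by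
    intro j
    induction j with
    | zero => simpa using h0
    | succ j ih =>
      have h1 := doubleForm_sub E₁ E₂ (T := T) (hKm (j + 1)) (hB (j + 1)) (hKm j) (hB j) u v
      have h2 := norm_add_le (doubleForm E₁ E₂ T (K j) u v)
        (doubleForm E₁ E₂ T (K (j + 1) - K j) u v)
      rw [h1, add_sub_cancel] at h2
      have h3 := hstep j
      rw [h1] at h3
      push_cast
      linarith
  have h1 := doubleForm_sub E₁ E₂ (T := T) hD hDB (hKm m) (hB m) u v
  have h2 := norm_add_le (doubleForm E₁ E₂ T (K m) u v)
    (doubleForm E₁ E₂ T (dividedDifference f - K m) u v)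
  rw [h1, add_sub_cancel] at h2
  rw [h1] at hlast
  linarith [hind m]

/-- The double operator integral of an operator of rank at most `2 ^ m` is bounded by a multiple of
`m + 2`. -/
theorem norm_le_of_rank_le (hL : 0 ≤ L) (hf : ∀ x y, ‖f x - f y‖ ≤ L * |x - y|)
    (hfc : Continuous f) {T Q : H →L[ℂ] H} (m : ℕ)
    (hT : LinearMap.rank (T : H →ₗ[ℂ] H) ≤ ((2 ^ m : ℕ) : Cardinal))
    (hQ : ∀ u v, inner ℂ v (Q u) = doubleForm E₁ E₂ T (dividedDifference f) u v) :
    ‖Q‖ ≤ 152 * L * ‖T‖ * (m + 2) :=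
  opNorm_le_of_inner_unit (by positivity) fun u v hu hv => by
    rw [hQ]; exact norm_doubleForm_dividedDifference_le E₁ E₂ hL hf hfc m hT hu hv

end FiniteRankEstimate
-- The double operator integral as a linear transformer
section DoubleIntegral

variable {H : Type u} [NormedAddCommGroup H] [InnerProductSpace ℂ H] [CompleteSpace H]
  (E₁ E₂ : SpectralMeasure ℝ H)

open Classical in
/-- The double operator integral of a Hilbert–Schmidt operator. -/
noncomputable def doubleIntegral (Φ : ℝ × ℝ → ℂ) (T : H →L[ℂ] H) : H →L[ℂ] H :=
  if h : ∃ Q : H →L[ℂ] H, ∀ u v, inner ℂ v (Q u) = doubleForm E₁ E₂ T Φ u v then h.choose else 0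

variable {Φ : ℝ × ℝ → ℂ} (hΦ : Measurable Φ) {B : ℝ} (hB : ∀ x, ‖Φ x‖ ≤ B)
include hΦ hB

theorem inner_doubleIntegral {T : H →L[ℂ] H} {c : ℝ} (hT : HSBound T c) (u v : H) :
    inner ℂ v (doubleIntegral E₁ E₂ Φ T u) = doubleForm E₁ E₂ T Φ u v := by
  have h : ∃ Q : H →L[ℂ] H, ∀ u v, inner ℂ v (Q u) = doubleForm E₁ E₂ T Φ u v :=
    (exists_operator_doubleForm E₁ E₂ hT hΦ hB).imp fun _ h => h.1
  rw [doubleIntegral, dif_pos h]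
  exact h.choose_spec u v

theorem doubleIntegral_add {S T : H →L[ℂ] H} {a b : ℝ} (hS : HSBound S a) (hT : HSBound T b) :
    doubleIntegral E₁ E₂ Φ (S + T) = doubleIntegral E₁ E₂ Φ S + doubleIntegral E₁ E₂ Φ T := by
  ext u
  refine ext_inner_left ℂ fun v => ?_
  rw [add_apply, inner_add_right, inner_doubleIntegral E₁ E₂ hΦ hB (hS.add hT),
    inner_doubleIntegral E₁ E₂ hΦ hB hS, inner_doubleIntegral E₁ E₂ hΦ hB hT, doubleForm,
    doubleForm, doubleForm, ← integral_add (integrable_mul_kernel E₁ E₂ hΦ hB _)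
    (integrable_mul_kernel E₁ E₂ hΦ hB _), operatorKernel_add E₁ E₂ hS hT (hS.add hT)]
  refine integral_congr_ae ?_
  filter_upwards [Lp.coeFn_add (operatorKernel E₁ E₂ S u v) (operatorKernel E₁ E₂ T u v)] with p hp
  rw [hp, Pi.add_apply, mul_add]

theorem doubleIntegral_smul {T : H →L[ℂ] H} {c : ℝ} (hT : HSBound T c) (a : ℂ) :
    doubleIntegral E₁ E₂ Φ (a • T) = a • doubleIntegral E₁ E₂ Φ T := by
  ext u
  refine ext_inner_left ℂ fun v => ?_
  rw [smul_apply, inner_smul_right, inner_doubleIntegral E₁ E₂ hΦ hB (hT.smul a),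
    inner_doubleIntegral E₁ E₂ hΦ hB hT, doubleForm, doubleForm, ← integral_const_mul,
    operatorKernel_smul E₁ E₂ hT a (hT.smul a)]
  refine integral_congr_ae ?_
  filter_upwards [Lp.coeFn_smul a (operatorKernel E₁ E₂ T u v)] with p hp
  rw [hp, Pi.smul_apply, smul_eq_mul]
  ring

theorem doubleIntegral_sub {S T : H →L[ℂ] H} {a b : ℝ} (hS : HSBound S a) (hT : HSBound T b) :
    doubleIntegral E₁ E₂ Φ (S - T) = doubleIntegral E₁ E₂ Φ S - doubleIntegral E₁ E₂ Φ T := by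
  rw [sub_eq_add_neg, doubleIntegral_add E₁ E₂ hΦ hB hS hT.neg, ← neg_one_smul ℂ T,
    doubleIntegral_smul E₁ E₂ hΦ hB hT, neg_one_smul, ← sub_eq_add_neg]

theorem norm_doubleIntegral_le {T : H →L[ℂ] H} {c : ℝ} (hT : HSBound T c) (hB0 : 0 ≤ B) :
    ‖doubleIntegral E₁ E₂ Φ T‖ ≤ c * B :=
  norm_le_of_doubleForm E₁ E₂ hT hΦ hB0 hB (inner_doubleIntegral E₁ E₂ hΦ hB hT)

theorem isCompactOperator_doubleIntegral {K : H →L[ℂ] H} {n : ℕ}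
    (hK : LinearMap.rank (K : H →ₗ[ℂ] H) ≤ (n : Cardinal)) :
    IsCompactOperator (doubleIntegral E₁ E₂ Φ K) := by
  obtain ⟨Q, hQ, hc⟩ := exists_operator_doubleForm E₁ E₂ (hsBound_of_rank_le hK) hΦ hB
  have h : doubleIntegral E₁ E₂ Φ K = Q := by
    ext u
    refine ext_inner_left ℂ fun v => ?_
    rw [inner_doubleIntegral E₁ E₂ hΦ hB (hsBound_of_rank_le hK), hQ]
  rw [h]
  exact hc fun S hS => isCompactOperator_planeOperator E₁ E₂ hK hS

end DoubleIntegral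

/-! ### Finite rank approximation in the Matsaev ideal -/

section FiniteRankApproximation

variable {H : Type u} [NormedAddCommGroup H] [InnerProductSpace ℂ H]

theorem rank_smul_le (c : ℂ) (K : H →L[ℂ] H) :
    LinearMap.rank ((c • K : H →L[ℂ] H) : H →ₗ[ℂ] H) ≤ LinearMap.rank (K : H →ₗ[ℂ] H) := by
  have : ((c • K : H →L[ℂ] H) : H →ₗ[ℂ] H) =
      (c • LinearMap.id : H →ₗ[ℂ] H) ∘ₗ (K : H →ₗ[ℂ] H) := by
    ext; simp
  rw [this]
  exact LinearMap.rank_comp_le_right _ _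

/-- `K k` approximates `T` to order `o(2 ^ (-k))` by operators of rank `O(2 ^ 2 ^ k)`. -/
def IsRankApprox (T : H →L[ℂ] H) (K : ℕ → H →L[ℂ] H) : Prop :=
  ∃ a : ℕ, (∀ k, LinearMap.rank (K k : H →ₗ[ℂ] H) ≤ ((2 ^ (2 ^ k + a) : ℕ) : Cardinal)) ∧
    Filter.Tendsto (fun k => 2 ^ k * ‖T - K k‖) Filter.atTop (nhds 0)

theorem IsRankApprox.add {S T : H →L[ℂ] H} {K K' : ℕ → H →L[ℂ] H} (h : IsRankApprox S K)
    (h' : IsRankApprox T K') : IsRankApprox (S + T) (fun k => K k + K' k) := by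
  obtain ⟨a, ha, h⟩ := h
  obtain ⟨b, hb, h'⟩ := h'
  refine ⟨a + b + 1, fun k => ?_, ?_⟩
  · refine (LinearMap.rank_add_le (K k : H →ₗ[ℂ] H) (K' k : H →ₗ[ℂ] H)).trans
      ((add_le_add (ha k) (hb k)).trans ?_)
    have h1 : 2 ^ (2 ^ k + a) ≤ 2 ^ (2 ^ k + (a + b)) := Nat.pow_le_pow_right two_pos (by omega)
    have h2 : 2 ^ (2 ^ k + b) ≤ 2 ^ (2 ^ k + (a + b)) := Nat.pow_le_pow_right two_pos (by omega)
    have h3 : 2 ^ (2 ^ k + a) + 2 ^ (2 ^ k + b) ≤ 2 ^ (2 ^ k + (a + b + 1)) := by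
      rw [← add_assoc (2 ^ k) (a + b) 1, pow_succ]; omega
    exact_mod_cast h3
  · refine squeeze_zero (fun _ => by positivity) (fun k => ?_) (by simpa using h.add h')
    rw [← mul_add, add_sub_add_comm]
    gcongr
    exact norm_add_le _ _

theorem IsRankApprox.smul {T : H →L[ℂ] H} {K : ℕ → H →L[ℂ] H} (h : IsRankApprox T K) (c : ℂ) :
    IsRankApprox (c • T) (fun k => c • K k) := by
  obtain ⟨a, ha, h⟩ := h
  refine ⟨a, fun k => (rank_smul_le c (K k)).trans (ha k), ?_⟩
  have := h.const_mul ‖c‖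
  rw [mul_zero] at this
  refine this.congr fun k => ?_
  rw [← smul_sub, norm_smul]
  ring

theorem IsRankApprox.sub {S T : H →L[ℂ] H} {K K' : ℕ → H →L[ℂ] H} (h : IsRankApprox S K)
    (h' : IsRankApprox T K') : IsRankApprox (S - T) (fun k => K k - K' k) := by
  simpa [sub_eq_add_neg] using h.add (h'.smul (-1))

theorem IsRankApprox.exists_hsBound {T : H →L[ℂ] H} {K : ℕ → H →L[ℂ] H} (h : IsRankApprox T K)
    (k : ℕ) : ∃ c, HSBound (K k) c := by
  obtain ⟨a, ha, -⟩ := h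
  exact ⟨_, hsBound_of_rank_le (ha k)⟩

/-- Cauchy condensation of `∑ s_j / (1 + j)`; the factor `2 ^ i / (1 + 2 ^ i)` is at least `1 / 2`.
-/
theorem sum_singularNumber_pow_le {T : H →L[ℂ] H} (hT : T ∈ matsaevIdeal H) (n : ℕ) :
    ∑ i ∈ Finset.range n, singularNumber T (2 ^ i) ≤ 4 * matsaevNorm T := by
  have hf0 : ∀ j : ℕ, 0 ≤ singularNumber T j / (1 + (j : ℝ)) := fun j =>
    div_nonneg (singularNumber_nonneg _ _) (by positivity)
  have hanti : ∀ ⦃i j : ℕ⦄, 1 < i → i ≤ j →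
      singularNumber T j / (1 + (j : ℝ)) ≤ singularNumber T i / (1 + (i : ℝ)) := by
    intro i j _ hij
    exact div_le_div₀ (singularNumber_nonneg _ _) (singularNumber_antitone T hij) (by positivity)
      (by gcongr)
  have h := Finset.sum_condensed_le hanti n
  have h1 : singularNumber T 1 / (1 + ((1 : ℕ) : ℝ)) +
      ∑ k ∈ Finset.Ico 2 (2 ^ n + 1), singularNumber T k / (1 + (k : ℝ)) ≤ matsaevNorm T := by
    have h2 := hT.sum_le_tsum (insert 1 (Finset.Ico 2 (2 ^ n + 1))) fun j _ => hf0 j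
    rwa [Finset.sum_insert (by simp)] at h2
  have h3 : ∑ i ∈ Finset.range n, singularNumber T (2 ^ i) ≤
      2 * ∑ k ∈ Finset.range (n + 1), 2 ^ k • (singularNumber T (2 ^ k) / (1 + ((2 ^ k : ℕ) : ℝ))) := by
    rw [Finset.mul_sum]
    refine (Finset.sum_le_sum fun i _ => ?_).trans (Finset.sum_le_sum_of_subset_of_nonneg
      (Finset.range_subset_range.2 n.le_succ) fun i _ _ =>
        mul_nonneg zero_le_two (nsmul_nonneg (hf0 _) _))
    rw [nsmul_eq_mul, mul_div_assoc', mul_div_assoc', le_div_iff₀ (by positivity)]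
    have h4 : (1 : ℝ) ≤ 2 ^ i := one_le_pow₀ one_le_two
    push_cast
    nlinarith [singularNumber_nonneg T (2 ^ i)]
  rw [nsmul_eq_mul] at h
  push_cast at h
  push_cast at h1 h3
  linarith [hf0 1]

/-- A second condensation, applied to the sequence `s_{2 ^ k}`. The weight `2 ^ k` is the logarithm
of the rank `2 ^ 2 ^ k`, just what the finite rank bound costs. -/
theorem sum_pow_mul_singularNumber_le {T : H →L[ℂ] H} (hT : T ∈ matsaevIdeal H) (n : ℕ) :
    ∑ k ∈ Finset.range n, 2 ^ k * singularNumber T (2 ^ 2 ^ k) ≤ 8 * matsaevNorm T := by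
  have hanti : ∀ ⦃i j : ℕ⦄, 1 < i → i ≤ j →
      singularNumber T (2 ^ j) ≤ singularNumber T (2 ^ i) := fun i j _ hij =>
    singularNumber_antitone T (Nat.pow_le_pow_right two_pos hij)
  have h := Finset.sum_condensed_le hanti n
  have h1 : singularNumber T (2 ^ 1) +
      ∑ k ∈ Finset.Ico 2 (2 ^ n + 1), singularNumber T (2 ^ k) ≤ 4 * matsaevNorm T := by
    refine le_trans ?_ (sum_singularNumber_pow_le hT (2 ^ n + 1))
    rw [← Finset.sum_insert (f := fun k => singularNumber T (2 ^ k))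
      (by simp : 1 ∉ Finset.Ico 2 (2 ^ n + 1))]
    refine Finset.sum_le_sum_of_subset_of_nonneg (fun k hk => ?_)
      fun i _ _ => singularNumber_nonneg _ _
    have := Nat.one_le_two_pow (n := n)
    simp only [Finset.mem_insert, Finset.mem_Ico, Finset.mem_range] at hk ⊢
    omega
  have h3 : ∑ k ∈ Finset.range n, 2 ^ k * singularNumber T (2 ^ 2 ^ k) ≤
      ∑ k ∈ Finset.range (n + 1), 2 ^ k • singularNumber T (2 ^ 2 ^ k) := by
    simp only [nsmul_eq_mul, Nat.cast_pow, Nat.cast_ofNat]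
    exact Finset.sum_le_sum_of_subset_of_nonneg (Finset.range_subset_range.2 n.le_succ)
      fun i _ _ => mul_nonneg (by positivity) (singularNumber_nonneg _ _)
  rw [nsmul_eq_mul] at h
  push_cast at h
  rw [pow_one] at h1
  linarith [singularNumber_nonneg T 2]

theorem norm_le_matsaevNorm {T : H →L[ℂ] H} (hT : T ∈ matsaevIdeal H) : ‖T‖ ≤ matsaevNorm T := by
  have h := hT.le_tsum 0 fun j _ => div_nonneg (singularNumber_nonneg T j) (by positivity)
  simpa [singularNumber_zero_index, matsaevNorm] using h

/-- The error of a nearly optimal approximation of rank `2 ^ 2 ^ k`. -/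
noncomputable def rankError (T : H →L[ℂ] H) (k : ℕ) : ℝ :=
  singularNumber T (2 ^ 2 ^ k) + ‖T‖ / ((2 ^ 2 ^ k : ℕ) : ℝ)

theorem rankError_nonneg (T : H →L[ℂ] H) (k : ℕ) : 0 ≤ rankError T k :=
  add_nonneg (singularNumber_nonneg _ _) (by positivity)

theorem rankError_succ_le (T : H →L[ℂ] H) (k : ℕ) : rankError T (k + 1) ≤ rankError T k := by
  have h : 2 ^ 2 ^ k ≤ 2 ^ 2 ^ (k + 1) :=
    Nat.pow_le_pow_right two_pos (Nat.pow_le_pow_right two_pos k.le_succ)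
  unfold rankError
  gcongr
  exact singularNumber_antitone T h

theorem rankError_zero_le (T : H →L[ℂ] H) : rankError T 0 ≤ 2 * ‖T‖ := by
  have h1 := singularNumber_le_norm T (2 ^ 2 ^ 0)
  have h2 : ‖T‖ / ((2 ^ 2 ^ 0 : ℕ) : ℝ) ≤ ‖T‖ := by
    norm_num
  exact (add_le_add h1 h2).trans_eq (two_mul _).symm

/-- The slack `‖T‖ / 2 ^ 2 ^ k` contributes a geometric series with sum at most `2 ‖T‖`, because `2
* k ≤ 2 ^ k`; whence `10 = 8 + 2`. -/
theorem sum_pow_mul_rankError_le {T : H →L[ℂ] H} (hT : T ∈ matsaevIdeal H) (n : ℕ) :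
    ∑ k ∈ Finset.range n, 2 ^ k * rankError T k ≤ 10 * matsaevNorm T := by
  have h1 := sum_pow_mul_singularNumber_le hT n
  have hpow : ∀ k : ℕ, (2 : ℝ) ^ k * (‖T‖ / ((2 ^ 2 ^ k : ℕ) : ℝ)) ≤ ‖T‖ * (1 / 2) ^ k := by
    intro k
    have h2 : 2 * k ≤ 2 ^ k := by
      rcases k with _ | k
      · simp
      · have := Nat.lt_two_pow_self (n := k)
        rw [pow_succ]; omega
    have h3 : (2 : ℝ) ^ k * 2 ^ k ≤ ((2 ^ 2 ^ k : ℕ) : ℝ) := by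
      rw [← pow_add, ← two_mul]
      exact_mod_cast Nat.pow_le_pow_right two_pos h2
    rw [mul_div_assoc', div_le_iff₀ (by positivity)]
    calc (2 : ℝ) ^ k * ‖T‖ = ‖T‖ * (1 / 2) ^ k * (2 ^ k * 2 ^ k) := by
          rw [div_pow, one_pow]; field_simp
      _ ≤ _ := by gcongr
  have h2 : ∑ k ∈ Finset.range n, (2 : ℝ) ^ k * (‖T‖ / ((2 ^ 2 ^ k : ℕ) : ℝ)) ≤ ‖T‖ * 2 := by
    refine (Finset.sum_le_sum fun k _ => hpow k).trans ?_
    rw [← Finset.mul_sum]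
    gcongr
    exact sum_geometric_two_le n
  simp only [rankError, mul_add, Finset.sum_add_distrib]
  linarith [norm_le_matsaevNorm hT]

theorem exists_rankApprox (T : H →L[ℂ] H) : ∃ K : ℕ → H →L[ℂ] H,
    ∀ k, LinearMap.rank (K k : H →ₗ[ℂ] H) ≤ ((2 ^ 2 ^ k : ℕ) : Cardinal) ∧
      ‖T - K k‖ ≤ rankError T k := by
  suffices h : ∀ k, ∃ K : H →L[ℂ] H, LinearMap.rank (K : H →ₗ[ℂ] H) ≤
      ((2 ^ 2 ^ k : ℕ) : Cardinal) ∧ ‖T - K‖ ≤ rankError T k by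
    choose K hK using h
    exact ⟨K, hK⟩
  intro k
  -- For `T = 0` there is no positive slack, but zero is its own approximation.
  rcases eq_or_ne T 0 with rfl | hT
  · exact ⟨0, by simp [LinearMap.rank_zero], by simpa using rankError_nonneg (0 : H →L[ℂ] H) k⟩
  · have := norm_pos_iff.2 hT
    exact exists_rank_le_norm_sub_le T _ (by positivity)

/-- A sequence of nearly optimal approximations of `T` of ranks `2 ^ 2 ^ k`. -/
noncomputable def rankApprox (T : H →L[ℂ] H) : ℕ → H →L[ℂ] H := (exists_rankApprox T).choose

theorem rank_rankApprox_le (T : H →L[ℂ] H) (k : ℕ) :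
    LinearMap.rank (rankApprox T k : H →ₗ[ℂ] H) ≤ ((2 ^ 2 ^ k : ℕ) : Cardinal) :=
  ((exists_rankApprox T).choose_spec k).1

theorem norm_sub_rankApprox_le (T : H →L[ℂ] H) (k : ℕ) : ‖T - rankApprox T k‖ ≤ rankError T k :=
  ((exists_rankApprox T).choose_spec k).2

theorem summable_pow_mul_rankError {T : H →L[ℂ] H} (hT : T ∈ matsaevIdeal H) :
    Summable fun k => 2 ^ k * rankError T k :=
  summable_of_sum_range_le (fun k => mul_nonneg (by positivity) (rankError_nonneg T k))
    (sum_pow_mul_rankError_le hT)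

theorem isRankApprox_rankApprox {T : H →L[ℂ] H} (hT : T ∈ matsaevIdeal H) :
    IsRankApprox T (rankApprox T) :=
  ⟨0, rank_rankApprox_le T, squeeze_zero (fun _ => by positivity)
    (fun k => mul_le_mul_of_nonneg_left (norm_sub_rankApprox_le T k) (by positivity))
    (summable_pow_mul_rankError hT).tendsto_atTop_zero⟩

end FiniteRankApproximation
-- The extension to the Matsaev ideal
section Extension

variable {H : Type u} [NormedAddCommGroup H] [InnerProductSpace ℂ H] [CompleteSpace H]
  (E₁ E₂ : SpectralMeasure ℝ H) {f : ℝ → ℂ} {L : ℝ}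

/-- The finite rank bound costs a factor `2 ^ k + a + 2 = O(2 ^ k)`, which the decay `o(2 ^ (-k))`
of the norms absorbs. -/
theorem tendsto_doubleIntegral_of_isRankApprox_zero (hL : 0 ≤ L)
    (hf : ∀ x y, ‖f x - f y‖ ≤ L * |x - y|) (hfc : Continuous f) {K : ℕ → H →L[ℂ] H}
    (hK : IsRankApprox 0 K) :
    Filter.Tendsto (fun k => doubleIntegral E₁ E₂ (dividedDifference f) (K k)) Filter.atTop
      (nhds 0) := by
  obtain ⟨a, ha, h⟩ := hK
  simp only [zero_sub, norm_neg] at h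
  refine squeeze_zero_norm (a := fun k => 152 * L * (a + 3) * (2 ^ k * ‖K k‖)) (fun k => ?_)
    (by simpa using h.const_mul (152 * L * (a + 3)))
  refine (norm_le_of_rank_le E₁ E₂ hL hf hfc _ (ha k) (inner_doubleIntegral E₁ E₂
    (measurable_dividedDifference hfc) (norm_dividedDifference_le hL hf)
    (hsBound_of_rank_le (ha k)))).trans ?_
  have h1 : (1 : ℝ) ≤ 2 ^ k := one_le_pow₀ one_le_two
  have h2 : ((2 ^ k + a : ℕ) : ℝ) + 2 ≤ (a + 3) * 2 ^ k := by
    push_cast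
    nlinarith [Nat.cast_nonneg (α := ℝ) a]
  calc 152 * L * ‖K k‖ * (((2 ^ k + a : ℕ) : ℝ) + 2)
      ≤ 152 * L * ‖K k‖ * ((a + 3) * 2 ^ k) := by gcongr
    _ = _ := by ring

/-- Independence of the approximating sequence: since `rankApprox` is a choice and not linear in
`T`, linearity of the extension rests on this. -/
theorem tendsto_doubleIntegral_congr (hL : 0 ≤ L)
    (hf : ∀ x y, ‖f x - f y‖ ≤ L * |x - y|) (hfc : Continuous f) {T Q : H →L[ℂ] H}
    {K K' : ℕ → H →L[ℂ] H} (hK : IsRankApprox T K) (hK' : IsRankApprox T K')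
    (h : Filter.Tendsto (fun k => doubleIntegral E₁ E₂ (dividedDifference f) (K k)) Filter.atTop
      (nhds Q)) :
    Filter.Tendsto (fun k => doubleIntegral E₁ E₂ (dividedDifference f) (K' k)) Filter.atTop
      (nhds Q) := by
  have h0 : IsRankApprox 0 fun k => K' k - K k := by simpa using hK'.sub hK
  have h1 := (tendsto_doubleIntegral_of_isRankApprox_zero E₁ E₂ hL hf hfc h0).add h
  rw [zero_add] at h1
  refine h1.congr fun k => ?_
  obtain ⟨c, hc⟩ := hK.exists_hsBound k
  obtain ⟨c', hc'⟩ := hK'.exists_hsBound k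
  rw [doubleIntegral_sub E₁ E₂ (measurable_dividedDifference hfc)
    (norm_dividedDifference_le hL hf) hc' hc, sub_add_cancel]

theorem norm_doubleIntegral_rankApprox_succ_sub_le (hL : 0 ≤ L)
    (hf : ∀ x y, ‖f x - f y‖ ≤ L * |x - y|) (hfc : Continuous f) (T : H →L[ℂ] H) (k : ℕ) :
    ‖doubleIntegral E₁ E₂ (dividedDifference f) (rankApprox T (k + 1)) -
      doubleIntegral E₁ E₂ (dividedDifference f) (rankApprox T k)‖ ≤
      1520 * L * (2 ^ k * rankError T k) := by
  have hD := measurable_dividedDifference hfc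
  have hDB := norm_dividedDifference_le hL hf
  have hr : LinearMap.rank ((rankApprox T (k + 1) - rankApprox T k : H →L[ℂ] H) : H →ₗ[ℂ] H) ≤
      ((2 ^ (2 ^ (k + 1) + 1) : ℕ) : Cardinal) := by
    rw [sub_eq_add_neg, ← neg_one_smul ℂ (rankApprox T k)]
    refine (LinearMap.rank_add_le (rankApprox T (k + 1) : H →ₗ[ℂ] H)
      (((-1 : ℂ) • rankApprox T k : H →L[ℂ] H) : H →ₗ[ℂ] H)).trans
      ((add_le_add (rank_rankApprox_le T (k + 1))
        ((rank_smul_le _ _).trans (rank_rankApprox_le T k))).trans ?_)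
    have h1 : 2 ^ 2 ^ k ≤ 2 ^ 2 ^ (k + 1) :=
      Nat.pow_le_pow_right two_pos (Nat.pow_le_pow_right two_pos k.le_succ)
    have h2 : 2 ^ 2 ^ (k + 1) + 2 ^ 2 ^ k ≤ 2 ^ (2 ^ (k + 1) + 1) := by
      rw [pow_succ 2 (2 ^ (k + 1))]; omega
    exact_mod_cast h2
  rw [← doubleIntegral_sub E₁ E₂ hD hDB (hsBound_of_rank_le (rank_rankApprox_le T (k + 1)))
    (hsBound_of_rank_le (rank_rankApprox_le T k))]
  refine (norm_le_of_rank_le E₁ E₂ hL hf hfc _ hr (inner_doubleIntegral E₁ E₂ hD hDB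
    (hsBound_of_rank_le hr))).trans ?_
  have hn : ‖rankApprox T (k + 1) - rankApprox T k‖ ≤ 2 * rankError T k := by
    have h1 := norm_sub_le (T - rankApprox T k) (T - rankApprox T (k + 1))
    rw [sub_sub_sub_cancel_left] at h1
    linarith [norm_sub_rankApprox_le T k, norm_sub_rankApprox_le T (k + 1), rankError_succ_le T k]
  have h1 : (1 : ℝ) ≤ 2 ^ k := one_le_pow₀ one_le_two
  have h2 : ((2 ^ (k + 1) + 1 : ℕ) : ℝ) + 2 ≤ 5 * 2 ^ k := by
    push_cast
    rw [pow_succ]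
    linarith
  have h3 := rankError_nonneg T k
  -- `1520 = 152 * 2 * 5`: both approximants are within `rankError T k` of `T`, and the logarithm of
  -- the rank plus two is at most `5 * 2 ^ k`.
  calc 152 * L * ‖rankApprox T (k + 1) - rankApprox T k‖ * (((2 ^ (k + 1) + 1 : ℕ) : ℝ) + 2)
      ≤ 152 * L * (2 * rankError T k) * (5 * 2 ^ k) := by gcongr
    _ = _ := by ring

theorem norm_doubleIntegral_rankApprox_zero_le (hL : 0 ≤ L)
    (hf : ∀ x y, ‖f x - f y‖ ≤ L * |x - y|) (hfc : Continuous f) (T : H →L[ℂ] H) :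
    ‖doubleIntegral E₁ E₂ (dividedDifference f) (rankApprox T 0)‖ ≤ 1368 * L * ‖T‖ := by
  have hr : LinearMap.rank (rankApprox T 0 : H →ₗ[ℂ] H) ≤ ((2 ^ 1 : ℕ) : Cardinal) :=
    rank_rankApprox_le T 0
  refine (norm_le_of_rank_le E₁ E₂ hL hf hfc 1 hr (inner_doubleIntegral E₁ E₂
    (measurable_dividedDifference hfc) (norm_dividedDifference_le hL hf)
    (hsBound_of_rank_le hr))).trans ?_
  have hn : ‖rankApprox T 0‖ ≤ 3 * ‖T‖ := by
    have h1 := norm_sub_le T (T - rankApprox T 0)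
    rw [sub_sub_cancel] at h1
    linarith [norm_sub_rankApprox_le T 0, rankError_zero_le T]
  calc 152 * L * ‖rankApprox T 0‖ * (((1 : ℕ) : ℝ) + 2)
      ≤ 152 * L * (3 * ‖T‖) * (((1 : ℕ) : ℝ) + 2) := by gcongr
    _ = _ := by push_cast; ring

/-- The increments are dominated by the summable `2 ^ k * rankError T k`, and `16568 = 1368 + 1520 *
10` adds the first term to their total. -/
theorem exists_tendsto_doubleIntegral_rankApprox (hL : 0 ≤ L)
    (hf : ∀ x y, ‖f x - f y‖ ≤ L * |x - y|) (hfc : Continuous f) {T : H →L[ℂ] H}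
    (hT : T ∈ matsaevIdeal H) :
    ∃ Q : H →L[ℂ] H, Filter.Tendsto (fun k => doubleIntegral E₁ E₂ (dividedDifference f)
      (rankApprox T k)) Filter.atTop (nhds Q) ∧ IsCompactOperator Q ∧
      ‖Q‖ ≤ 16568 * L * matsaevNorm T := by
  have hstep := norm_doubleIntegral_rankApprox_succ_sub_le E₁ E₂ hL hf hfc T
  have hsum := (summable_pow_mul_rankError hT).mul_left (1520 * L)
  have hcauchy : CauchySeq fun k => doubleIntegral E₁ E₂ (dividedDifference f) (rankApprox T k) :=
    cauchySeq_of_dist_le_of_summable _ (fun k => by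
      rw [dist_comm, dist_eq_norm]; exact hstep k) hsum
  obtain ⟨Q, hQ⟩ := cauchySeq_tendsto_of_complete hcauchy
  refine ⟨Q, hQ, isCompactOperator_of_tendsto hQ (Filter.Eventually.of_forall fun k =>
    isCompactOperator_doubleIntegral E₁ E₂ (measurable_dividedDifference hfc)
      (norm_dividedDifference_le hL hf) (rank_rankApprox_le T k)), ?_⟩
  refine le_of_tendsto hQ.norm (Filter.Eventually.of_forall fun n => ?_)
  have h1 : ‖doubleIntegral E₁ E₂ (dividedDifference f) (rankApprox T n)‖ ≤
      1368 * L * ‖T‖ + ∑ k ∈ Finset.range n, 1520 * L * (2 ^ k * rankError T k) := by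
    induction n with
    | zero => simpa using norm_doubleIntegral_rankApprox_zero_le E₁ E₂ hL hf hfc T
    | succ n ih =>
      have h2 := norm_add_le (doubleIntegral E₁ E₂ (dividedDifference f) (rankApprox T n))
        (doubleIntegral E₁ E₂ (dividedDifference f) (rankApprox T (n + 1)) -
          doubleIntegral E₁ E₂ (dividedDifference f) (rankApprox T n))
      rw [add_sub_cancel] at h2
      rw [Finset.sum_range_succ]
      linarith [hstep n]
  rw [← Finset.mul_sum] at h1
  have h2 := mul_le_mul_of_nonneg_left (sum_pow_mul_rankError_le hT n)
    (by positivity : 0 ≤ 1520 * L)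
  have h3 := mul_le_mul_of_nonneg_left (norm_le_matsaevNorm hT) (by positivity : 0 ≤ 1368 * L)
  linarith

/-- The extension of the double operator integral from the Hilbert–Schmidt class to the Matsaev
ideal. -/
theorem exists_extension (hL : 0 ≤ L) (hf : ∀ x y, ‖f x - f y‖ ≤ L * |x - y|)
    (hfc : Continuous f) :
    ∃ J : matsaevIdeal H →ₗ[ℂ] (H →L[ℂ] H),
      (∀ (T : H →L[ℂ] H) (hT : T ∈ hilbertSchmidtClass H),
        J ⟨T, hilbertSchmidtClass_subset hT⟩ = doubleIntegral E₁ E₂ (dividedDifference f) T) ∧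
      (∀ T, IsCompactOperator (J T)) ∧
      ∀ T, ‖J T‖ ≤ 16568 * L * matsaevNorm (T : H →L[ℂ] H) := by
  have hD := measurable_dividedDifference hfc
  have hDB := norm_dividedDifference_le hL hf
  choose J hJ hJc hJn using fun T : matsaevIdeal H =>
    exists_tendsto_doubleIntegral_rankApprox E₁ E₂ hL hf hfc T.2
  have happ := fun T : matsaevIdeal H => isRankApprox_rankApprox T.2
  refine ⟨{ toFun := J, map_add' := fun S T => ?_, map_smul' := fun c T => ?_ }, fun T hT => ?_,
    hJc, hJn⟩
  · refine tendsto_nhds_unique (tendsto_doubleIntegral_congr E₁ E₂ hL hf hfc (happ (S + T))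
      ((happ S).add (happ T)) (hJ (S + T))) (((hJ S).add (hJ T)).congr fun k => ?_)
    exact (doubleIntegral_add E₁ E₂ hD hDB (hsBound_of_rank_le (rank_rankApprox_le _ k))
      (hsBound_of_rank_le (rank_rankApprox_le _ k))).symm
  · refine tendsto_nhds_unique (tendsto_doubleIntegral_congr E₁ E₂ hL hf hfc (happ (c • T))
      ((happ T).smul c) (hJ (c • T))) (((hJ T).const_smul c).congr fun k => ?_)
    exact (doubleIntegral_smul E₁ E₂ hD hDB (hsBound_of_rank_le (rank_rankApprox_le _ k)) c).symm
  -- For Hilbert–Schmidt `T` the same approximants converge in Hilbert–Schmidt norm, for which the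
  -- double integral is continuous. The slack parameter `‖T‖` is the one built into `rankError`.
  · refine tendsto_nhds_unique (hJ ⟨T, hilbertSchmidtClass_subset hT⟩)
      (tendsto_iff_norm_sub_tendsto_zero.2 ?_)
    obtain ⟨ε, hε, h⟩ := exists_hsBound_sub_tendsto hT ‖T‖
    have hn : Filter.Tendsto (fun k : ℕ => 2 ^ 2 ^ k) Filter.atTop (Filter.atTop (α := ℕ)) :=
      (tendsto_pow_atTop_atTop_of_one_lt one_lt_two).comp
        (tendsto_pow_atTop_atTop_of_one_lt one_lt_two)
    have hlim := (hε.comp hn).mul_const L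
    rw [zero_mul] at hlim
    refine squeeze_zero (fun _ => norm_nonneg _) (fun k => ?_) hlim
    have hk := h (2 ^ 2 ^ k) (by positivity) _ (rank_rankApprox_le T k) (norm_sub_rankApprox_le T k)
    rw [norm_sub_rev, ← doubleIntegral_sub E₁ E₂ hD hDB (hsBound_of_mem_hilbertSchmidtClass hT)
      (hsBound_of_rank_le (rank_rankApprox_le T k))]
    exact norm_doubleIntegral_le E₁ E₂ hD hDB hk hL

end Extension

/-! ### The Lipschitz seminorm -/

section LipNorm

theorem lipNorm_nonneg (f : ℝ → ℂ) : 0 ≤ lipNorm f :=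
  Real.iSup_nonneg fun _ => by positivity

/-- The constant `K` serves only to bound the difference quotients, so that their real supremum is
meaningful. -/
theorem norm_sub_le_lipNorm {f : ℝ → ℂ} {K : NNReal} (hf : LipschitzWith K f) (x y : ℝ) :
    ‖f x - f y‖ ≤ lipNorm f * |x - y| := by
  rcases eq_or_ne x y with rfl | h
  · simp
  rw [← div_le_iff₀ (abs_pos.2 (sub_ne_zero.2 h))]
  refine le_ciSup (f := fun p : {p : ℝ × ℝ // p.1 ≠ p.2} =>
    ‖f p.1.1 - f p.1.2‖ / |p.1.1 - p.1.2|) ⟨K, ?_⟩ ⟨(x, y), h⟩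
  rintro _ ⟨⟨⟨a, b⟩, hab⟩, rfl⟩
  exact (div_le_iff₀ (abs_pos.2 (sub_ne_zero.2 hab))).2 (hf.norm_sub_le a b)

end LipNorm
end DoubleOp

theorem mainTheorem5 :
    ∃ C : ℝ, ∀ (H : Type u) [NormedAddCommGroup H] [InnerProductSpace ℂ H] [CompleteSpace H]
      (E₁ E₂ : DoubleOp.SpectralMeasure ℝ H) (f : ℝ → ℂ),
      (∃ K : NNReal, LipschitzWith K f) →
      ∃ J : DoubleOp.matsaevIdeal H →ₗ[ℂ] (H →L[ℂ] H),
        (∀ (T : H →L[ℂ] H) (hT : T ∈ DoubleOp.hilbertSchmidtClass H),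
          DoubleOp.IsDoubleOperatorIntegral E₁ E₂ (DoubleOp.dividedDifference f) T
            (J ⟨T, DoubleOp.hilbertSchmidtClass_subset hT⟩)) ∧
        (∀ T : DoubleOp.matsaevIdeal H, IsCompactOperator (J T)) ∧
        ∀ T : DoubleOp.matsaevIdeal H,
          ‖J T‖ ≤ C * DoubleOp.lipNorm f * DoubleOp.matsaevNorm (T : H →L[ℂ] H) := by
  refine ⟨16568, fun H _ _ _ E₁ E₂ f ⟨K, hK⟩ => ?_⟩
  have hL := DoubleOp.lipNorm_nonneg f
  have hf := DoubleOp.norm_sub_le_lipNorm hK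
  obtain ⟨J, hJ, hc, hn⟩ := DoubleOp.exists_extension E₁ E₂ hL hf hK.continuous
  refine ⟨J, fun T hT => ?_, hc, hn⟩
  have hD := DoubleOp.measurable_dividedDifference hK.continuous
  have hDB := DoubleOp.norm_dividedDifference_le hL hf
  have hTb := DoubleOp.hsBound_of_mem_hilbertSchmidtClass hT
  rw [hJ T hT]
  exact DoubleOp.isDoubleOperatorIntegral_of_doubleForm E₁ E₂ hTb
    (DoubleOp.normCountablyAdditive_of_mem_hilbertSchmidtClass E₁ E₂ hT) hD hDB
    (DoubleOp.inner_doubleIntegral E₁ E₂ hD hDB hTb)
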